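/- Let $u$ be a real-valued harmonic function in the open unit disc $\mathbb D$, and put $M_r(u)=\max_{0\le\theta\le 2\pi}u(re^{i\theta})$ for $0<r<1$. For a function $h:[0,1]\to[0,\infty)$ let $\Delta^h=\{x+iy:\ 0<y<1,\ |x|\le h(y)\}$, and for $\varphi\in[0,2\pi]$ let $\Omega^h(\varphi)=f_\varphi(\Delta^h)$, where $f_\varphi(z)=e^{i\varphi}\,\frac{i-z}{i+z}$ maps the upper half-plane onto $\mathbb D$. Say that $u$ has zero limits along $h$ if $$\lim_{z\in\Omega^h(\varphi),\ z\to e^{i\varphi}}u(z)=0\qquad\text{for every }\varphi\in[0,2\pi].$$ Then $u\equiv 0$ in $\mathbb D$ in each of the following four cases. (a) $u$ has zero limits along $h(t)=0$, and $M_r(u)=o\big((1-r)^{-2}\big)$ as $r\to1-$. (b) For some $c>0$, $u$ has zero limits along $h(t)=ct^3$, and $\log^+M_r(u)=o\big((1-r)^{-1}\big)$ as $r\to1-$. (c) For some $c>0$, $u$ has zero limits along $h(t)=ct$, and $\log^+M_r(u)=o\big((1-r)^{-\pi/(2\arctan(1/c))}\big)$ as $r\to1-$. (d) For some $0<\gamma<1$,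 $u$ has zero limits along $h(t)=t^\gamma$, and $\log^+\log^+M_r(u)=o\big((1-r)^{\gamma-1}\big)$ as $r\to1-$. -/

import Mathlib

open Filter Topology Asymptotics

noncomputable section

/-- `M_r(u) = max_{0 ≤ θ ≤ 2π} u(r e^{iθ})`. For `0 < r < 1` and `u` continuous on the open unit
disc this supremum is attained; it is the maximum of `u` itself, not of `|u|`. -/
def circleMax (u : ℂ → ℝ) (r : ℝ) : ℝ :=
  sSup ((fun θ : ℝ => u ((r : ℂ) * Complex.exp ((θ : ℂ) * Complex.I))) '' Set.Icc 0 (2 * Real.pi))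

/-- The approach domain `Δ^h = {x + iy : |x| ≤ h(y), 0 < y < 1}` in the upper half-plane. -/
def approachDomain (h : ℝ → ℝ) : Set ℂ :=
  {z : ℂ | 0 < z.im ∧ z.im < 1 ∧ |z.re| ≤ h z.im}

/-- The map `f_φ(z) = e^{iφ} (i - z) / (i + z)` of the upper half-plane onto the unit disc; it sends
`0` to `e^{iφ}`. -/
def discMap (φ : ℝ) (z : ℂ) : ℂ :=
  Complex.exp ((φ : ℂ) * Complex.I) * ((Complex.I - z) / (Complex.I + z))

/-- The approach region `Ω^h(φ) = f_φ(Δ^h)` in the unit disc, with vertex `e^{iφ}`. -/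
def approachRegion (h : ℝ → ℝ) (φ : ℝ) : Set ℂ :=
  discMap φ '' approachDomain h

/-- `u(z) → 0` as `z → e^{iφ}`, `z ∈ Ω^h(φ)`, for every `φ ∈ [0, 2π]`. -/
def HasZeroLimitsAlong (h : ℝ → ℝ) (u : ℂ → ℝ) : Prop :=
  ∀ φ ∈ Set.Icc (0 : ℝ) (2 * Real.pi),
    Tendsto u (𝓝[approachRegion h φ] Complex.exp ((φ : ℂ) * Complex.I)) (𝓝 0)

end

/-!
Write `u = Re F` with `F` holomorphic in the disc. Zero limits along `h` contain the radial limits,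
and radial limits zero alone do not force `u = 0`; the growth condition has to exclude the
singularities of `u` at the circle. No Poisson representation is used: everything is deduced from
the maximum principle with explicit comparison functions.

**From bounded to vanishing.** Work with `Ψ z = F (e^{iz})` on the upper half-plane, where radii
become vertical lines. If `Re Ψ` is bounded near a real point, its vertical limits zero upgrade to
unrestricted limits zero (`tendsto_re_of_bounded_of_vertical_limits`). So let `G` be the open set of
real points near which `Re Ψ` is bounded, and suppose that its complement `E` is nonempty. By Baire's
theorem there are an open interval meeting `E` and an `η > 0` such that `|Re Ψ(x + iy)| ≤ 1` for all
`x ∈ E` in the interval and `0 < y ≤ η`. Over a component `(a, b)` of the complement of `E` the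
function `Re Ψ` vanishes on the real side of the box `(a, b) × (0, η)` and is bounded on the three
others, so the maximum principle bounds it in the box as soon as it is known to be bounded, by any
constant whatsoever, near the two corners `a` and `b`. The bound does not depend on the component,
hence `Re Ψ` is bounded near a point of `E`, a contradiction
(`reVanishesAt_of_corner_bounds`). With `E` empty, the maximum principle in the disc gives `u = 0`.

**Corners.** What remains is local: if `Re Φ` has limits zero on a real interval `(0, δ)`, tends to
zero (or is bounded) along the region `|x| ≤ h(y)` and obeys the growth condition, then `Re Φ` is
bounded in a quarter disc `x > 0, y > 0` at `0`. By reflection `Φ` continues to a function `X` across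
`(0, δ)`, and a Phragmén–Lindelöf argument is applied to the right of the imaginary axis.

* Radial limits (`exists_re_le_of_radial_corner`): comparison in rhombi turns
  `Re Φ = o(y ^ (-2))` into `Re Φ = o(|z| ^ (-2))`, which is of critical order for a quadrant. Here
  only upper bounds are available at first. Once an upper bound is known around a point of `E`, the
  Borel–Carathéodory inequality gives `-Re Φ = O(1 / y)`, and the same argument bounds `-Φ`.
* Cubic regions (`exists_abs_re_le_of_cubic_corner`): in the coordinate `w = 1 / z` the limit zero in
  discs of radius comparable to `|z| ^ 3` makes the derivative `o(|w|)` on the imaginary axis. The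
  derivative has zero exponential type in the half-plane, so it is `o(|w|)` there, and `Re Φ` is
  `o(|w| ^ 2)`, of critical order for the quadrant again.
* Cones (`exists_abs_re_le_of_conical_corner`): the same, in the coordinate `w = z ^ (-α)` which
  opens the complementary angle `|arg z| < arctan (1 / c)` to a half-plane.
* Cusps (`exists_abs_re_le_of_cusp_corner`): the complement of the region is the cusp
  `|y| ≤ const · x ^ (1 / γ)`. On its sides `X' z ^ (1 / γ)` is bounded, and a Phragmén–Lindelöf
  principle for cusps with the comparison function `exp (A z ^ (1 - 1 / γ))` bounds it inside.
  Integrating `X'` from the real axis, where `Re X = 0`, bounds `Re X`.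
-/

/-! ### The maximum principle with exceptional boundary points -/

/-- The maximum principle with the boundary condition given by upper limits; `f` need not extend to
the frontier. -/
theorem norm_le_of_frontier_limsup {D : Set ℂ} (hD : IsOpen D) (hb : Bornology.IsBounded D)
    {f : ℂ → ℂ} (hf : DifferentiableOn ℂ f D) {C : ℝ}
    (h : ∀ ζ ∈ frontier D, ∀ ε > 0, ∀ᶠ z in 𝓝[D] ζ, ‖f z‖ ≤ C + ε) :
    ∀ z ∈ D, ‖f z‖ ≤ C := by
  intro z₀ hz₀
  by_contra! hlt
  set K : Set ℂ := {z | z ∈ D ∧ ‖f z₀‖ ≤ ‖f z‖} with hK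
  have hKD : K ⊆ D := fun z hz => hz.1
  have hKcl : IsClosed K := by
    refine isClosed_of_closure_subset fun ζ hζ => ?_
    have hfr : ∃ᶠ z in 𝓝 ζ, z ∈ K := mem_closure_iff_frequently.1 hζ
    by_cases hζD : ζ ∈ D
    · refine ⟨hζD, ?_⟩
      have hc : ContinuousAt f ζ := (hf.differentiableAt (hD.mem_nhds hζD)).continuousAt
      exact ge_of_tendsto_of_frequently hc.norm (hfr.mono fun z hz => hz.2)
    · have hζf : ζ ∈ frontier D := by
        rw [hD.frontier_eq]
        exact ⟨closure_mono hKD hζ, hζD⟩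
      have := h ζ hζf ((‖f z₀‖ - C) / 2) (by linarith)
      rw [eventually_nhdsWithin_iff] at this
      obtain ⟨z, hz1, hz2⟩ := (hfr.and_eventually this).exists
      have := hz2 hz1.1
      have := hz1.2
      linarith
  have hKc : IsCompact K := Metric.isCompact_of_isClosed_isBounded hKcl (hb.subset hKD)
  have hcont : ContinuousOn (fun z => ‖f z‖) K := (hf.continuousOn.mono hKD).norm
  obtain ⟨z₁, hz₁K, hz₁⟩ := hKc.exists_isMaxOn ⟨z₀, hz₀, le_rfl⟩ hcont
  have hmax : ∀ z ∈ D, ‖f z‖ ≤ ‖f z₁‖ := by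
    intro z hz
    by_cases hzK : ‖f z₀‖ ≤ ‖f z‖
    · exact hz₁ ⟨hz, hzK⟩
    · exact (not_le.1 hzK).le.trans hz₁K.2
  set K' : Set ℂ := K ∩ (fun z => ‖f z‖) ⁻¹' {‖f z₁‖} with hK'
  have hK'c : IsCompact K' := by
    have : IsClosed K' := hcont.preimage_isClosed_of_isClosed hKcl isClosed_singleton
    exact hKc.of_isClosed_subset this Set.inter_subset_left
  -- the rightmost point of the set where the maximum is attained
  obtain ⟨z₂, hz₂K, hz₂⟩ := hK'c.exists_isMaxOn ⟨z₁, hz₁K, rfl⟩ Complex.continuous_re.continuousOn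
  have hz₂D : z₂ ∈ D := hKD hz₂K.1
  have heq : ‖f z₂‖ = ‖f z₁‖ := hz₂K.2
  have hloc : IsLocalMax (norm ∘ f) z₂ := by
    filter_upwards [hD.mem_nhds hz₂D] with z hz
    simpa [heq] using hmax z hz
  have hev := Complex.norm_eventually_eq_of_isLocalMax
    (hf.eventually_differentiableAt (hD.mem_nhds hz₂D)) hloc
  have hev2 : ∀ᶠ z in 𝓝 z₂, z ∈ K' := by
    filter_upwards [hev, hD.mem_nhds hz₂D] with z hz hzD
    exact ⟨⟨hzD, by rw [hz, heq]; exact hz₁K.2⟩, by simp [hz, heq]⟩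
  have ht : Tendsto (fun t : ℝ => z₂ + (t : ℂ)) (𝓝[>] 0) (𝓝 z₂) := by
    have : Continuous (fun t : ℝ => z₂ + (t : ℂ)) := by fun_prop
    simpa using (this.tendsto 0).mono_left nhdsWithin_le_nhds
  obtain ⟨t, ht1, ht2⟩ := ((ht.eventually hev2).and self_mem_nhdsWithin).exists
  have := hz₂ ht1
  simp at this
  exact absurd this (not_le.2 ht2)

/-- The maximum principle with finitely many exceptional boundary points, near which the function is
only assumed to be bounded: the powers `f ^ N`, multiplied by a polynomial vanishing at the
exceptional points, satisfy the ordinary maximum principle, and `N` tends to infinity. -/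
theorem norm_le_of_frontier_limsup_off_finset {D : Set ℂ} (hD : IsOpen D)
    (hb : Bornology.IsBounded D) {f : ℂ → ℂ} (hf : DifferentiableOn ℂ f D) {C : ℝ} (hC : 0 < C)
    (S : Finset ℂ)
    (h : ∀ ζ ∈ frontier D, ζ ∉ S → ∀ ε > 0, ∀ᶠ z in 𝓝[D] ζ, ‖f z‖ ≤ C + ε)
    (hS : ∀ ζ ∈ S, ∃ M, ∀ᶠ z in 𝓝[D] ζ, ‖f z‖ ≤ M) (hSD : ∀ ζ ∈ S, ζ ∉ D) :
    ∀ z ∈ D, ‖f z‖ ≤ C := by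
  set p : ℂ → ℂ := fun z => ∏ ζ ∈ S, (z - ζ) with hp
  have hpd : Differentiable ℂ p := by
    have : ∀ ζ ∈ S, Differentiable ℂ (fun z : ℂ => z - ζ) := fun ζ _ => by fun_prop
    simpa [hp] using Differentiable.fun_finsetProd this
  obtain ⟨B, hB⟩ : ∃ B, ∀ z ∈ closure D, ‖p z‖ ≤ B :=
    hb.isCompact_closure.exists_bound_of_continuousOn hpd.continuous.continuousOn
  set B' := max B 1
  have hB' : 0 < B' := lt_of_lt_of_le one_pos (le_max_right _ _)
  have key : ∀ N : ℕ, ∀ z ∈ D, ‖f z‖ ^ N * ‖p z‖ ≤ C ^ N * B' := by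
    intro N
    have := norm_le_of_frontier_limsup hD hb (f := fun z => f z ^ N * p z) (C := C ^ N * B')
      ((hf.pow N).mul hpd.differentiableOn) ?_
    · simpa using this
    intro ζ hζ ε hε
    by_cases hζS : ζ ∈ S
    · obtain ⟨M, hM⟩ := hS ζ hζS
      have hp0 : Tendsto (fun z => (max M 0) ^ N * ‖p z‖) (𝓝[D] ζ) (𝓝 0) := by
        have h1 : p ζ = 0 := Finset.prod_eq_zero hζS (sub_self ζ)
        have h2 : Tendsto (fun z => (max M 0) ^ N * ‖p z‖) (𝓝 ζ) (𝓝 ((max M 0) ^ N * ‖p ζ‖)) :=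
          (tendsto_const_nhds.mul (hpd.continuous.tendsto ζ).norm)
        rw [h1, norm_zero, mul_zero] at h2
        exact h2.mono_left nhdsWithin_le_nhds
      filter_upwards [hM, hp0.eventually (gt_mem_nhds hε)] with z hz1 hz2
      rw [norm_mul, norm_pow]
      have : ‖f z‖ ^ N ≤ (max M 0) ^ N := by gcongr; exact hz1.trans (le_max_left _ _)
      have h3 : ‖f z‖ ^ N * ‖p z‖ ≤ (max M 0) ^ N * ‖p z‖ := by gcongr
      have : 0 < C ^ N * B' := by positivity
      linarith
    · have hT : Tendsto (fun e : ℝ => (C + e) ^ N * B') (𝓝[>] 0) (𝓝 (C ^ N * B')) := by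
        have : Continuous (fun e : ℝ => (C + e) ^ N * B') := by fun_prop
        simpa using (this.tendsto 0).mono_left nhdsWithin_le_nhds
      obtain ⟨e, he1, he2⟩ := ((hT.eventually (gt_mem_nhds
        (show C ^ N * B' < C ^ N * B' + ε by linarith))).and self_mem_nhdsWithin).exists
      filter_upwards [h ζ hζ hζS e he2, self_mem_nhdsWithin] with z hz hzD
      rw [norm_mul, norm_pow]
      refine le_trans ?_ he1.le
      have h1 : ‖p z‖ ≤ B' := (hB z (subset_closure hzD)).trans (le_max_left _ _)
      gcongr
  intro z hz
  by_contra! hlt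
  have hpz : 0 < ‖p z‖ := by
    rw [norm_pos_iff, hp, Finset.prod_ne_zero_iff]
    intro ζ hζ h0
    exact hSD ζ hζ (by rwa [← sub_eq_zero.1 h0])
  have hq : 1 < ‖f z‖ / C := (one_lt_div hC).2 hlt
  obtain ⟨N, hN⟩ := pow_unbounded_of_one_lt (B' / ‖p z‖) hq
  have := key N z hz
  rw [div_pow, div_lt_div_iff₀ hpz (by positivity)] at hN
  linarith

/-- The real part version is the norm version for `exp ∘ f`. -/
theorem re_le_of_frontier_limsup_off_finset {D : Set ℂ} (hD : IsOpen D)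
    (hb : Bornology.IsBounded D) {f : ℂ → ℂ} (hf : DifferentiableOn ℂ f D) {C : ℝ}
    (S : Finset ℂ)
    (h : ∀ ζ ∈ frontier D, ζ ∉ S → ∀ ε > 0, ∀ᶠ z in 𝓝[D] ζ, (f z).re ≤ C + ε)
    (hS : ∀ ζ ∈ S, ∃ M, ∀ᶠ z in 𝓝[D] ζ, (f z).re ≤ M) (hSD : ∀ ζ ∈ S, ζ ∉ D) :
    ∀ z ∈ D, (f z).re ≤ C := by
  have := norm_le_of_frontier_limsup_off_finset hD hb (f := fun z => Complex.exp (f z)) hf.cexp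
    (Real.exp_pos C) S ?_ ?_ hSD
  · intro z hz
    simpa [Complex.norm_exp] using this z hz
  · intro ζ hζ hζS ε hε
    have hT : Tendsto (fun e : ℝ => Real.exp (C + e)) (𝓝[>] 0) (𝓝 (Real.exp C)) := by
      have : Continuous (fun e : ℝ => Real.exp (C + e)) := by fun_prop
      simpa using (this.tendsto 0).mono_left nhdsWithin_le_nhds
    obtain ⟨e, he1, he2⟩ := ((hT.eventually (gt_mem_nhds
      (show Real.exp C < Real.exp C + ε by linarith))).and self_mem_nhdsWithin).exists
    filter_upwards [h ζ hζ hζS e he2] with z hz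
    rw [Complex.norm_exp]
    exact (Real.exp_le_exp.2 hz).trans he1.le
  · intro ζ hζ
    obtain ⟨M, hM⟩ := hS ζ hζ
    refine ⟨Real.exp M, ?_⟩
    filter_upwards [hM] with z hz
    rw [Complex.norm_exp]
    exact Real.exp_le_exp.2 hz

theorem re_le_of_frontier_limsup {D : Set ℂ} (hD : IsOpen D)
    (hb : Bornology.IsBounded D) {f : ℂ → ℂ} (hf : DifferentiableOn ℂ f D) {C : ℝ}
    (h : ∀ ζ ∈ frontier D, ∀ ε > 0, ∀ᶠ z in 𝓝[D] ζ, (f z).re ≤ C + ε) :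
    ∀ z ∈ D, (f z).re ≤ C :=
  re_le_of_frontier_limsup_off_finset hD hb hf ∅ (fun ζ hζ _ => h ζ hζ) (by simp) (by simp)

/-- A Phragmén–Lindelöf principle of critical order in a half-plane from which a half-disc has been
removed: zero exponential type and a bound on the boundary give the same bound inside. -/
theorem norm_le_of_zero_exponential_type {f : ℂ → ℂ} {R C : ℝ} (hC : 0 < C)
    (hf : DifferentiableOn ℂ f {w | 0 < w.re ∧ R < ‖w‖})
    (hc : ContinuousOn f {w | 0 ≤ w.re ∧ R ≤ ‖w‖})
    (h1 : ∀ w : ℂ, w.re = 0 → R ≤ ‖w‖ → ‖f w‖ ≤ C)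
    (h2 : ∀ w : ℂ, 0 ≤ w.re → ‖w‖ = R → ‖f w‖ ≤ C)
    (hg : ∀ ε > 0, ∃ R', ∀ w : ℂ, 0 < w.re → R' ≤ ‖w‖ → ‖f w‖ ≤ Real.exp (ε * ‖w‖)) :
    ∀ w : ℂ, 0 < w.re → R < ‖w‖ → ‖f w‖ ≤ C := by
  intro w₀ hw₀ hw₀R
  have key : ∀ ε > 0, ‖f w₀‖ ≤ C * Real.exp (6 * ε * w₀.re) := by
    intro ε hε
    obtain ⟨R', hR'⟩ := hg ε hε
    -- The maximum principle is applied in a large half-disc centred at `c`, the foot of `w₀` on the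
    -- imaginary axis.
    set c : ℂ := ⟨0, w₀.im⟩ with hcdef
    obtain ⟨d, hd1, hd2, hd3, hd4⟩ : ∃ d : ℝ, R' + ‖c‖ ≤ d ∧ ‖c‖ ≤ d ∧ Real.exp (-(ε * d)) ≤ C
        ∧ w₀.re < d := by
      have e1 : Tendsto (fun d : ℝ => Real.exp (-(ε * d))) atTop (𝓝 0) :=
        Real.tendsto_exp_neg_atTop_nhds_zero.comp (tendsto_id.const_mul_atTop hε)
      have := (eventually_ge_atTop (R' + ‖c‖)).and ((eventually_ge_atTop ‖c‖).and
        ((e1.eventually (ge_mem_nhds hC)).and (eventually_gt_atTop w₀.re)))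
      obtain ⟨d, h1, h2, h3, h4⟩ := this.exists
      exact ⟨d, h1, h2, h3, h4⟩
    have hd0 : 0 < d := hw₀.trans hd4
    set D : Set ℂ := {w | 0 < w.re ∧ R < ‖w‖ ∧ ‖w - c‖ < d} with hDdef
    have hbd : Bornology.IsBounded D :=
      (Metric.isBounded_ball (x := c) (r := d)).subset fun w hw => by
        simpa [dist_eq_norm] using hw.2.2
    have hcl : closure D ⊆ {w | 0 ≤ w.re ∧ R ≤ ‖w‖ ∧ ‖w - c‖ ≤ d} := by
      refine closure_minimal (fun w hw => ⟨hw.1.le, hw.2.1.le, hw.2.2.le⟩) ?_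
      exact (isClosed_le continuous_const Complex.continuous_re).inter
        ((isClosed_le continuous_const continuous_norm).inter
          (isClosed_le (continuous_id.sub continuous_const).norm continuous_const))
    have hDo : IsOpen D := (isOpen_lt continuous_const Complex.continuous_re).inter
        ((isOpen_lt continuous_const continuous_norm).inter
          (isOpen_lt (continuous_id.sub continuous_const).norm continuous_const))
    -- `Re g ≥ 0` in the half-disc, `Re g ≥ 3 ε d` on its arc, and `Re g (w₀) ≤ 6 ε Re w₀` does not
    -- depend on the radius `d`.
    set g : ℂ → ℂ := fun w => ((3 * ε / d : ℝ) : ℂ) * (2 * d * (w - c) - (w - c) ^ 2) with hgdef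
    have hgre : ∀ w, (g w).re = 3 * ε / d * (2 * d * w.re - w.re ^ 2 + (w.im - w₀.im) ^ 2) := by
      intro w
      simp only [hgdef, Complex.re_ofReal_mul, hcdef]
      simp [pow_two]
      left; ring
    have hgd : Differentiable ℂ g := by fun_prop
    have hnsq : ∀ w : ℂ, ‖w - c‖ ^ 2 = w.re ^ 2 + (w.im - w₀.im) ^ 2 := by
      intro w
      rw [Complex.sq_norm, Complex.normSq_apply, hcdef]; simp; ring
    have hg0 : ∀ w : ℂ, 0 ≤ w.re → ‖w - c‖ ≤ d → 0 ≤ (g w).re := by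
      intro w hw hwd
      rw [hgre]
      have : w.re ≤ d := by
        have := Complex.re_le_norm (w - c)
        simp [hcdef] at this; simp [hcdef] at hwd; linarith
      have : 0 ≤ w.re * (2 * d - w.re) := mul_nonneg hw (by linarith)
      have : 0 ≤ 2 * d * w.re - w.re ^ 2 + (w.im - w₀.im) ^ 2 := by nlinarith [sq_nonneg (w.im - w₀.im)]
      positivity
    have hres := Complex.norm_le_of_forall_mem_frontier_norm_le hbd
      (f := fun w => f w * Complex.exp (-(g w))) (C := C) ?_ ?_ (z := w₀) (subset_closure ?_)
    · rw [norm_mul, Complex.norm_exp] at hres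
      have e : (-(g w₀)).re ≥ -(6 * ε * w₀.re) := by
        rw [Complex.neg_re, hgre]
        have : 3 * ε / d * (2 * d * w₀.re - w₀.re ^ 2 + (w₀.im - w₀.im) ^ 2)
            = 6 * ε * w₀.re - 3 * ε / d * w₀.re ^ 2 := by field_simp; ring
        have : 0 ≤ 3 * ε / d * w₀.re ^ 2 := by positivity
        linarith
      have h3 : ‖f w₀‖ * Real.exp (-(6 * ε * w₀.re)) ≤ C :=
        le_trans (by gcongr) hres
      rw [Real.exp_neg] at h3
      rwa [← div_eq_mul_inv, div_le_iff₀ (Real.exp_pos _)] at h3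
    · have hsub : D ⊆ {w | 0 < w.re ∧ R < ‖w‖} := fun w hw => ⟨hw.1, hw.2.1⟩
      have hsub2 : closure D ⊆ {w | 0 ≤ w.re ∧ R ≤ ‖w‖} := fun w hw => ⟨(hcl hw).1, (hcl hw).2.1⟩
      exact ⟨(hf.mono hsub).mul (hgd.neg.cexp).differentiableOn,
        (hc.mono hsub2).mul (hgd.neg.cexp).continuous.continuousOn⟩
    · intro w hw
      rw [hDo.frontier_eq] at hw
      obtain ⟨hw1, hw2, hw3⟩ := hcl hw.1
      rw [norm_mul, Complex.norm_exp, Complex.neg_re]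
      have hgw := hg0 w hw1 hw3
      have hle1 : Real.exp (-(g w).re) ≤ 1 := Real.exp_le_one_iff.2 (by linarith)
      by_cases hA : ‖f w‖ ≤ C
      · calc ‖f w‖ * Real.exp (-(g w).re) ≤ C * 1 := by gcongr
          _ = C := mul_one C
      · have hre : 0 < w.re := lt_of_le_of_ne hw1 fun h => hA (h1 w h.symm hw2)
        have hRw : R < ‖w‖ := lt_of_le_of_ne hw2 fun h => hA (h2 w hw1 h.symm)
        have hwd : ‖w - c‖ = d := le_antisymm hw3 (not_lt.1 fun h => hw.2 ⟨hre, hRw, h⟩)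
        have hn1 : ‖w‖ ≤ 2 * d := by
          have := norm_sub_norm_le w c
          linarith
        have hn2 : R' ≤ ‖w‖ := by
          have := norm_sub_le w c
          linarith
        have hgb : 3 * ε * d ≤ (g w).re := by
          rw [hgre]
          have h5 := hnsq w
          rw [hwd] at h5
          have hwre : w.re ≤ d := by
            have := Complex.re_le_norm (w - c)
            simp [hcdef] at this; simp [hcdef] at hwd; linarith
          have : d ^ 2 ≤ 2 * d * w.re - w.re ^ 2 + (w.im - w₀.im) ^ 2 := by nlinarith
          calc 3 * ε * d = 3 * ε / d * d ^ 2 := by field_simp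
            _ ≤ _ := by gcongr
        calc ‖f w‖ * Real.exp (-(g w).re) ≤ Real.exp (ε * (2 * d)) * Real.exp (-(3 * ε * d)) := by
              gcongr
              exact (hR' w hre hn2).trans (Real.exp_le_exp.2 (by gcongr))
          _ = Real.exp (-(ε * d)) := by rw [← Real.exp_add]; ring_nf
          _ ≤ C := hd3
    · refine ⟨hw₀, hw₀R, ?_⟩
      have : w₀ - c = (w₀.re : ℂ) := by
        apply Complex.ext <;> simp [hcdef]
      rw [this, Complex.norm_real, Real.norm_of_nonneg hw₀.le]; exact hd4
  have hT : Tendsto (fun e : ℝ => C * Real.exp (6 * e * w₀.re)) (𝓝[>] 0) (𝓝 C) := by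
    have : Continuous (fun e : ℝ => C * Real.exp (6 * e * w₀.re)) := by fun_prop
    simpa using (this.tendsto 0).mono_left nhdsWithin_le_nhds
  exact ge_of_tendsto hT (by filter_upwards [self_mem_nhdsWithin] with e he using key e he)

/-! ### Boundary limits of bounded functions -/

theorem isOpen_im_pos : IsOpen {z : ℂ | 0 < z.im} := isOpen_lt continuous_const Complex.continuous_im

/-- A bound by a function vanishing at `x₀`, for real parts with boundary values at most zero on the
diameter of a half-disc: the comparison function is harmonic, nonnegative in the half-disc, and at
least `C` on the arc. -/
theorem re_le_half_disc_barrier {Φ : ℂ → ℂ} {x₀ d C : ℝ} (hd : 0 < d) (hC : 0 ≤ C)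
    (hΦ : DifferentiableOn ℂ Φ {z | 0 < z.im})
    (hb : ∀ z : ℂ, 0 < z.im → ‖z - x₀‖ ≤ d → (Φ z).re ≤ C)
    (h0 : ∀ x : ℝ, |x - x₀| ≤ d → ∀ ε > 0, ∀ᶠ z in 𝓝[{z : ℂ | 0 < z.im}] (x : ℂ), (Φ z).re ≤ ε) :
    ∀ z : ℂ, 0 < z.im → ‖z - x₀‖ < d →
      (Φ z).re ≤ C / d ^ 2 * ((z.re - x₀) ^ 2 - z.im ^ 2 + 2 * d * z.im) := by
  set D : Set ℂ := {z | 0 < z.im ∧ ‖z - x₀‖ < d} with hD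
  have hDo : IsOpen D := isOpen_im_pos.inter
    (isOpen_lt (continuous_id.sub continuous_const).norm continuous_const)
  have hbd : Bornology.IsBounded D :=
    (Metric.isBounded_ball (x := (x₀ : ℂ)) (r := d)).subset fun w hw => by
      simpa [dist_eq_norm] using hw.2
  have hcl : closure D ⊆ {z | 0 ≤ z.im ∧ ‖z - x₀‖ ≤ d} :=
    closure_minimal (fun z hz => ⟨hz.1.le, hz.2.le⟩)
      ((isClosed_le continuous_const Complex.continuous_im).inter
        (isClosed_le (continuous_id.sub continuous_const).norm continuous_const))
  set g : ℂ → ℂ := fun z => ((C / d ^ 2 : ℝ) : ℂ) * ((z - x₀) ^ 2 - 2 * d * Complex.I * (z - x₀))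
    with hg
  have hgd : Differentiable ℂ g := by fun_prop
  have hgre : ∀ z, (g z).re = C / d ^ 2 * ((z.re - x₀) ^ 2 - z.im ^ 2 + 2 * d * z.im) := by
    intro z
    simp only [hg, Complex.re_ofReal_mul]
    simp [pow_two]
  have hDH : D ⊆ {z | 0 < z.im} := fun z hz => hz.1
  have hnsq : ∀ z : ℂ, ‖z - x₀‖ ^ 2 = (z.re - x₀) ^ 2 + z.im ^ 2 := by
    intro z
    rw [Complex.sq_norm, Complex.normSq_apply]; simp; ring
  have hg0 : ∀ z : ℂ, 0 ≤ z.im → ‖z - x₀‖ ≤ d → 0 ≤ (g z).re := by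
    intro z hz hzd
    rw [hgre]
    have h1 : z.im ≤ d := by
      have := Complex.im_le_norm (z - x₀)
      simp at this; linarith
    have : 0 ≤ (z.re - x₀) ^ 2 - z.im ^ 2 + 2 * d * z.im := by nlinarith [sq_nonneg (z.re - x₀)]
    positivity
  have key := re_le_of_frontier_limsup hDo hbd (f := fun z => Φ z - g z) (C := 0)
    ((hΦ.mono hDH).sub hgd.differentiableOn) ?_
  · intro z hz1 hz2
    have := key z ⟨hz1, hz2⟩
    rw [Complex.sub_re, hgre] at this
    linarith
  · intro ζ hζ ε hε
    rw [hDo.frontier_eq] at hζ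
    obtain ⟨h1, h2⟩ := hcl hζ.1
    rcases h1.eq_or_lt with h1 | h1
    · have hζ' : ζ = (ζ.re : ℂ) := by apply Complex.ext <;> simp [← h1]
      have hx : |ζ.re - x₀| ≤ d := by
        rw [hζ', ← Complex.ofReal_sub, Complex.norm_real] at h2
        simpa using h2
      have := h0 ζ.re hx ε hε
      rw [← hζ'] at this
      filter_upwards [this.filter_mono (nhdsWithin_mono _ hDH), self_mem_nhdsWithin] with z hz hzD
      have := hg0 z hzD.1.le hzD.2.le
      rw [Complex.sub_re]; linarith
    · have h3 : ‖ζ - x₀‖ = d := le_antisymm h2 (not_lt.1 fun h => hζ.2 ⟨h1, h⟩)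
      have hcont : ContinuousAt (fun z => (Φ z - g z).re) ζ := by
        have := (hΦ.differentiableAt (isOpen_im_pos.mem_nhds h1)).continuousAt
        exact Complex.continuous_re.continuousAt.comp (this.sub hgd.continuous.continuousAt)
      have hval : (Φ ζ - g ζ).re ≤ 0 := by
        rw [Complex.sub_re, hgre]
        have h5 := hnsq ζ
        rw [h3] at h5
        have h6 : ζ.im ≤ d := by
          have := Complex.im_le_norm (ζ - x₀)
          simp at this; linarith
        have : d ^ 2 ≤ (ζ.re - x₀) ^ 2 - ζ.im ^ 2 + 2 * d * ζ.im := by nlinarith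
        have : C ≤ C / d ^ 2 * ((ζ.re - x₀) ^ 2 - ζ.im ^ 2 + 2 * d * ζ.im) := by
          calc C = C / d ^ 2 * d ^ 2 := by field_simp
            _ ≤ _ := by gcongr
        have := hb ζ h1 h2
        linarith
      have := hcont.eventually (gt_mem_nhds (show (Φ ζ - g ζ).re < 0 + ε by linarith))
      exact (this.filter_mono nhdsWithin_le_nhds).mono fun z hz => hz.le

/-- A gradient estimate, from the Borel–Carathéodory inequality. -/
theorem norm_deriv_le_of_abs_re_le {f : ℂ → ℂ} {c : ℂ} {ρ M : ℝ} (hρ : 0 < ρ) (hM : 0 < M)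
    (hf : DifferentiableOn ℂ f (Metric.ball c ρ))
    (hb : ∀ z ∈ Metric.ball c ρ, |(f z).re| ≤ M) : ‖deriv f c‖ ≤ 8 * M / ρ := by
  have hc : c ∈ Metric.ball c ρ := Metric.mem_ball_self hρ
  have hmap : Set.MapsTo (fun z => c + z) (Metric.ball 0 ρ) (Metric.ball c ρ) := by
    intro z hz; simpa [dist_eq_norm] using hz
  have h1 : ∀ z ∈ Metric.sphere c (ρ / 2), ‖f z - f c‖ ≤ 4 * M := by
    intro z hz
    have hz' : ‖z - c‖ = ρ / 2 := by simpa [dist_eq_norm] using hz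
    have := Complex.borelCaratheodory_zero (f := fun z => f (c + z) - f c) (M := 2 * M) (R := ρ)
      (z := z - c) (by positivity) ((hf.comp (by fun_prop) hmap).sub_const _) ?_ hρ
      (by simp [hz']; linarith) (by simp)
    · simp only [add_sub_cancel] at this
      rw [hz'] at this
      refine this.trans (le_of_eq ?_)
      field_simp; ring
    · intro w hw
      have e1 := hb _ (hmap hw)
      have e2 := hb c hc
      rw [abs_le] at e1 e2
      simp only [Set.mem_ofPred_eq, Complex.sub_re]
      linarith [e1.2, e2.1]
  have h2 := Complex.norm_deriv_le_of_forall_mem_sphere_norm_le (f := fun z => f z - f c) (c := c)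
    (R := ρ / 2) (C := 4 * M) (by positivity) ?_ h1
  · rw [deriv_sub_const] at h2
    refine h2.trans (le_of_eq ?_)
    field_simp; ring
  · refine DifferentiableOn.diffContOnCl ?_
    have : closure (Metric.ball c (ρ / 2)) ⊆ Metric.ball c ρ :=
      Metric.closure_ball_subset_closedBall.trans (Metric.closedBall_subset_ball (by linarith))
    exact (hf.mono this).sub_const _

/-- If the real part of `Ψ` is bounded near a real point and has vertical limits zero, it has the
unrestricted limit zero there. The averages of `Re Ψ` over horizontal segments of length `2e` are
difference quotients of a primitive `P`; they have unrestricted limits zero by dominated convergence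
and the Lipschitz bound on `Re P`. So the half-disc barrier applies to them, and it survives the limit
`e → 0`. -/
theorem tendsto_re_of_bounded_of_vertical_limits {P Ψ : ℂ → ℂ} {x₀ r C : ℝ} (hr : 0 < r)
    (hP : ∀ z : ℂ, 0 < z.im → HasDerivAt P (Ψ z) z)
    (hb : ∀ z : ℂ, 0 < z.im → ‖z - x₀‖ < r → |(Ψ z).re| ≤ C)
    (hv : ∀ x : ℝ, Tendsto (fun y : ℝ => (Ψ (x + y * Complex.I)).re) (𝓝[>] 0) (𝓝 0))
    (hΨ : ContinuousOn Ψ {z : ℂ | 0 < z.im}) :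
    Tendsto (fun z => (Ψ z).re) (𝓝[{z : ℂ | 0 < z.im}] (x₀ : ℂ)) (𝓝 0) := by
  set d := r / 8 with hd
  have hd0 : 0 < d := by positivity
  have hC : 0 ≤ C := by
    have := hb (x₀ + (d : ℝ) * Complex.I) (by simpa) (by
      simp only [add_sub_cancel_left, norm_mul, Complex.norm_real, Complex.norm_I, mul_one]
      rw [Real.norm_of_nonneg hd0.le]; linarith)
    exact (abs_nonneg _).trans this
  have hbox : ∀ x y : ℝ, |x - x₀| ≤ 3 * d → 0 < y → y ≤ d →
      |(Ψ (x + y * Complex.I)).re| ≤ C := by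
    intro x y hx hy hyd
    refine hb _ (by simpa) ?_
    have e : (x : ℂ) + y * Complex.I - x₀ = ((x - x₀ : ℝ) : ℂ) + y * Complex.I := by push_cast; ring
    rw [e]
    refine (norm_add_le _ _).trans_lt ?_
    simp only [norm_mul, Complex.norm_real, Complex.norm_I, mul_one, Real.norm_eq_abs, abs_of_pos hy]
    linarith
  -- `q` is Lipschitz in the first variable, uniformly in the second
  set q : ℝ → ℝ → ℝ := fun x y => (P (x + y * Complex.I)).re with hq
  have hqd : ∀ x y : ℝ, 0 < y → HasDerivAt (fun x => q x y) (Ψ (x + y * Complex.I)).re x := by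
    intro x y hy
    have h1 : HasDerivAt (fun t : ℂ => P (t + y * Complex.I)) (Ψ (x + y * Complex.I)) (x : ℂ) := by
      have := HasDerivAt.comp_add_const (x : ℂ) (y * Complex.I) (hP (x + y * Complex.I) (by simpa))
      exact this
    exact h1.real_of_complex
  have hlip : ∀ x x' y : ℝ, |x - x₀| ≤ 3 * d → |x' - x₀| ≤ 3 * d → 0 < y → y ≤ d →
      |q x' y - q x y| ≤ C * |x' - x| := by
    intro x x' y hx hx' hy hyd
    have hconv : Convex ℝ (Set.Icc (x₀ - 3 * d) (x₀ + 3 * d)) := convex_Icc _ _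
    have mem : ∀ t : ℝ, |t - x₀| ≤ 3 * d ↔ t ∈ Set.Icc (x₀ - 3 * d) (x₀ + 3 * d) := by
      intro t; rw [abs_le, Set.mem_Icc]; constructor <;> rintro ⟨h1, h2⟩ <;> constructor <;> linarith
    exact hconv.norm_image_sub_le_of_norm_hasDerivWithin_le
      (fun t _ => (hqd t y hy).hasDerivWithinAt)
      (fun t ht => hbox t y ((mem t).2 ht) hy hyd) ((mem x).1 hx) ((mem x').1 hx')
  -- the barrier for the averages over segments of length `2e`
  have hA : ∀ e : ℝ, 0 < e → e ≤ d → ∀ z : ℂ, 0 < z.im → ‖z - x₀‖ < d →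
      |((P (z + e) - P (z - e)) / (2 * e)).re|
        ≤ C / d ^ 2 * ((z.re - x₀) ^ 2 - z.im ^ 2 + 2 * d * z.im) := by
    intro e he hed
    set A : ℂ → ℂ := fun z => (P (z + e) - P (z - e)) / (2 * e) with hAdef
    have hAre : ∀ z, (A z).re = (q (z.re + e) z.im - q (z.re - e) z.im) / (2 * e) := by
      intro z
      have : ((2 : ℂ) * e) = ((2 * e : ℝ) : ℂ) := by push_cast; ring
      simp only [hAdef, hq]
      rw [this, Complex.div_ofReal_re, Complex.sub_re]
      congr 4
      · apply Complex.ext <;> simp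
      · apply Complex.ext <;> simp
    have hAd : DifferentiableOn ℂ A {z | 0 < z.im} := by
      intro z hz
      have h1 : DifferentiableAt ℂ P (z + e) := (hP (z + e) (by simpa using hz)).differentiableAt
      have h2 : DifferentiableAt ℂ P (z - e) := (hP (z - e) (by simpa using hz)).differentiableAt
      have h3 : DifferentiableAt ℂ (fun z => P (z + e)) z :=
        DifferentiableAt.comp z h1 (by fun_prop)
      have h4 : DifferentiableAt ℂ (fun z => P (z - e)) z :=
        DifferentiableAt.comp z h2 (by fun_prop)
      exact ((h3.sub h4).div_const _).differentiableWithinAt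
    have hz12 : ∀ z : ℂ, 0 < z.im → ‖z - x₀‖ ≤ d → |z.re - x₀| ≤ d ∧ z.im ≤ d := by
      intro z hz hzd
      have e1 := Complex.abs_re_le_norm (z - x₀)
      have e2 := Complex.im_le_norm (z - x₀)
      simp at e1 e2
      exact ⟨by linarith, by linarith⟩
    have habs : ∀ z : ℂ, 0 < z.im → ‖z - x₀‖ ≤ d → |(A z).re| ≤ C := by
      intro z hz hzd
      obtain ⟨e1, e2⟩ := hz12 z hz hzd
      rw [abs_le] at e1
      rw [hAre, abs_div, abs_of_pos (show 0 < 2 * e by linarith), div_le_iff₀ (by linarith)]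
      have := hlip (z.re - e) (z.re + e) z.im (by rw [abs_le]; constructor <;> linarith)
        (by rw [abs_le]; constructor <;> linarith) hz e2
      rwa [show z.re + e - (z.re - e) = 2 * e by ring, abs_of_pos (show 0 < 2 * e by linarith)] at this
    have hpt : ∀ x : ℝ, |x - x₀| ≤ d →
        Tendsto (fun y : ℝ => q (x + e) y - q (x - e) y) (𝓝[>] 0) (𝓝 0) := by
      intro x hx
      rw [abs_le] at hx
      have h1 : Tendsto (fun y : ℝ => ∫ s in (x - e)..(x + e), (Ψ (s + y * Complex.I)).re)
          (𝓝[>] 0) (𝓝 (∫ s in (x - e)..(x + e), (0 : ℝ))) := by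
        refine intervalIntegral.tendsto_integral_filter_of_dominated_convergence (fun _ => C) ?_ ?_ ?_ ?_
        · filter_upwards [self_mem_nhdsWithin] with y hy
          have : Continuous fun s : ℝ => (Ψ (s + y * Complex.I)).re := by
            refine Complex.continuous_re.comp (hΨ.comp_continuous (by fun_prop) fun s => ?_)
            simpa using hy
          exact this.aestronglyMeasurable
        · filter_upwards [self_mem_nhdsWithin, Ioo_mem_nhdsGT hd0] with y hy hyd
          refine Filter.Eventually.of_forall fun s hs => ?_
          rw [Set.uIoc_of_le (by linarith)] at hs
          exact hbox s y (by rw [abs_le]; constructor <;> linarith [hs.1, hs.2]) hy hyd.2.le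
        · exact intervalIntegrable_const
        · exact Filter.Eventually.of_forall fun s _ => hv s
      rw [intervalIntegral.integral_zero] at h1
      refine h1.congr' ?_
      filter_upwards [self_mem_nhdsWithin] with y hy
      refine intervalIntegral.integral_eq_sub_of_hasDerivAt (fun s _ => hqd s y hy) ?_
      have : Continuous fun s : ℝ => (Ψ (s + y * Complex.I)).re := by
        refine Complex.continuous_re.comp (hΨ.comp_continuous (by fun_prop) fun s => ?_)
        simpa using hy
      exact this.intervalIntegrable _ _
    have hlim : ∀ x : ℝ, |x - x₀| ≤ d → ∀ ε > 0, ∀ᶠ z in 𝓝[{z : ℂ | 0 < z.im}] (x : ℂ),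
        |(A z).re| ≤ ε := by
      intro x hx ε hε
      have him : Tendsto (fun z : ℂ => z.im) (𝓝[{z : ℂ | 0 < z.im}] (x : ℂ)) (𝓝[>] 0) := by
        refine tendsto_nhdsWithin_iff.2 ⟨?_, self_mem_nhdsWithin⟩
        simpa using (Complex.continuous_im.tendsto (x : ℂ)).mono_left nhdsWithin_le_nhds
      have t1 := ((hpt x hx).comp him).abs
      have t2 : Tendsto (fun z : ℂ => 2 * (C * |z.re - x|)) (𝓝[{z : ℂ | 0 < z.im}] (x : ℂ)) (𝓝 0) := by
        have : Continuous fun z : ℂ => 2 * (C * |z.re - x|) := by fun_prop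
        simpa using (this.tendsto (x : ℂ)).mono_left nhdsWithin_le_nhds
      have t3 := t1.add t2
      rw [abs_zero, add_zero] at t3
      have hre2 : ∀ᶠ z : ℂ in 𝓝[{z : ℂ | 0 < z.im}] (x : ℂ), |z.re - x₀| < d + d / 2 := by
        have : Continuous fun z : ℂ => |z.re - x₀| := by fun_prop
        refine (((this.tendsto (x : ℂ)).mono_left nhdsWithin_le_nhds).eventually (gt_mem_nhds ?_))
        simp; linarith
      have hmul : 0 < ε * (2 * e) := by positivity
      have hre3 : ∀ᶠ z : ℂ in 𝓝[{z : ℂ | 0 < z.im}] (x : ℂ), z.im < d :=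
        (him.mono_right nhdsWithin_le_nhds).eventually (gt_mem_nhds hd0)
      filter_upwards [t3.eventually (gt_mem_nhds hmul), hre2, hre3, self_mem_nhdsWithin]
        with z h1 h2 h3 h4
      rw [hAre, abs_div, abs_of_pos (show 0 < 2 * e by linarith), div_le_iff₀ (by linarith)]
      rw [abs_lt] at h2
      have hx' := abs_le.1 hx
      have l1 := hlip (x + e) (z.re + e) z.im (by rw [abs_le]; constructor <;> linarith)
        (by rw [abs_le]; constructor <;> linarith) h4 h3.le
      have l2 := hlip (x - e) (z.re - e) z.im (by rw [abs_le]; constructor <;> linarith)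
        (by rw [abs_le]; constructor <;> linarith) h4 h3.le
      rw [show z.re + e - (x + e) = z.re - x by ring] at l1
      rw [show z.re - e - (x - e) = z.re - x by ring] at l2
      simp only [Function.comp] at h1
      have tri : |q (z.re + e) z.im - q (z.re - e) z.im| ≤ |q (x + e) z.im - q (x - e) z.im|
          + |q (z.re + e) z.im - q (x + e) z.im| + |q (z.re - e) z.im - q (x - e) z.im| := by
        rw [show q (z.re + e) z.im - q (z.re - e) z.im = (q (x + e) z.im - q (x - e) z.im)
          + (q (z.re + e) z.im - q (x + e) z.im) - (q (z.re - e) z.im - q (x - e) z.im) by ring]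
        exact (abs_sub _ _).trans (by gcongr; exact abs_add_le _ _)
      linarith
    intro z hz hzd
    have b1 := re_le_half_disc_barrier hd0 hC hAd (fun z hz hzd => (abs_le.1 (habs z hz hzd)).2)
      (fun x hx ε hε => (hlim x hx ε hε).mono fun z hz => (abs_le.1 hz).2) z hz hzd
    have b2 := re_le_half_disc_barrier (Φ := fun z => - A z) hd0 hC hAd.neg
      (fun z hz hzd => by have := (abs_le.1 (habs z hz hzd)).1; simp; linarith)
      (fun x hx ε hε => (hlim x hx ε hε).mono fun z hz => by
        have := (abs_le.1 hz).1; simp; linarith) z hz hzd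
    rw [Complex.neg_re] at b2
    exact abs_le.2 ⟨by linarith, b1⟩
  have hfin : ∀ z : ℂ, 0 < z.im → ‖z - x₀‖ < d →
      |(Ψ z).re| ≤ C / d ^ 2 * ((z.re - x₀) ^ 2 - z.im ^ 2 + 2 * d * z.im) := by
    intro z hz hzd
    have hder : HasDerivAt (fun t : ℂ => P (z + t) - P (z - t)) (2 * Ψ z) 0 := by
      have h1 : HasDerivAt (fun t : ℂ => P (z + t)) (Ψ z) 0 :=
        HasDerivAt.comp_const_add z 0 (by simpa using hP z hz)
      have h2 : HasDerivAt (fun t : ℂ => P (z - t)) (-Ψ z) 0 :=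
        HasDerivAt.comp_const_sub z 0 (by simpa using hP z hz)
      have := h1.sub h2
      rwa [show Ψ z - -Ψ z = 2 * Ψ z by ring] at this
    have h3 := (hder.comp_ofReal (z := 0)).tendsto_slope_zero_right
    have h4 : Tendsto (fun e : ℝ => |((P (z + e) - P (z - e)) / (2 * e)).re|) (𝓝[>] 0)
        (𝓝 |(Ψ z).re|) := by
      have h5 := (h3.const_mul (1 / 2 : ℂ))
      have h6 := ((Complex.continuous_re.tendsto _).comp h5).abs
      rw [show (1 / 2 : ℂ) * (2 * Ψ z) = Ψ z by ring] at h6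
      refine h6.congr' ?_
      filter_upwards [self_mem_nhdsWithin] with e he
      have he' : (e : ℂ) ≠ 0 := Complex.ofReal_ne_zero.2 (ne_of_gt he)
      have hX : (1 / 2 : ℂ) * (e⁻¹ • (P (z + ((0 + e : ℝ) : ℂ)) - P (z - ((0 + e : ℝ) : ℂ))
          - (P (z + ((0 : ℝ) : ℂ)) - P (z - ((0 : ℝ) : ℂ))))) = (P (z + e) - P (z - e)) / (2 * e) := by
        rw [zero_add, Complex.ofReal_zero, add_zero, sub_zero, sub_self, sub_zero, Complex.real_smul,
          Complex.ofReal_inv]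
        field_simp
      simp only [Function.comp]
      rw [hX]
    refine le_of_tendsto h4 ?_
    filter_upwards [self_mem_nhdsWithin, Ioo_mem_nhdsGT hd0] with e he hed
    exact hA e he hed.2.le z hz hzd
  rw [tendsto_zero_iff_abs_tendsto_zero]
  have hub : Tendsto (fun z : ℂ => C / d ^ 2 * ((z.re - x₀) ^ 2 - z.im ^ 2 + 2 * d * z.im))
      (𝓝[{z : ℂ | 0 < z.im}] (x₀ : ℂ)) (𝓝 0) := by
    have : Continuous fun z : ℂ => C / d ^ 2 * ((z.re - x₀) ^ 2 - z.im ^ 2 + 2 * d * z.im) := by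
      fun_prop
    simpa using (this.tendsto (x₀ : ℂ)).mono_left nhdsWithin_le_nhds
  refine squeeze_zero' (Eventually.of_forall fun z => abs_nonneg _) ?_ hub
  have : Metric.ball (x₀ : ℂ) d ∈ 𝓝[{z : ℂ | 0 < z.im}] (x₀ : ℂ) :=
    mem_nhdsWithin_of_mem_nhds (Metric.ball_mem_nhds _ hd0)
  filter_upwards [this, self_mem_nhdsWithin] with z hz hzi
  exact hfin z hzi (by simpa [dist_eq_norm] using hz)

/-! ### Reflection and Borel–Carathéodory bounds -/

/-- A continuous function which is holomorphic off the real axis is holomorphic: in Morera's theorem,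
rectangles are cut along the axis. -/
theorem differentiableOn_ball_of_continuous_of_im_ne_zero {f : ℂ → ℂ} {c : ℂ} {r : ℝ}
    (hf : Continuous f) (hd : ∀ z ∈ Metric.ball c r, z.im ≠ 0 → DifferentiableAt ℂ f z) :
    DifferentiableOn ℂ f (Metric.ball c r) := by
  suffices h : Complex.IsConservativeOn f (Metric.ball c r) from
    (h.isExactOn_ball hf.continuousOn).differentiableOn Metric.isOpen_ball
  intro z w hzw
  rw [← add_eq_zero_iff_eq_neg, Complex.wedgeIntegral_add_wedgeIntegral_eq]
  -- the integral over the boundary of the rectangle between the heights `a` and `b`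
  set N : ℝ → ℝ → ℂ := fun a b =>
      (∫ x : ℝ in z.re..w.re, f (x + a * Complex.I)) -
      (∫ x : ℝ in z.re..w.re, f (x + b * Complex.I)) +
      Complex.I • (∫ y : ℝ in a..b, f (w.re + y * Complex.I)) -
      Complex.I • (∫ y : ℝ in a..b, f (z.re + y * Complex.I)) with hN
  have hadd : ∀ a b c, N a c = N a b + N b c := by
    intro a b c
    simp only [hN]
    rw [← intervalIntegral.integral_add_adjacent_intervals (a := a) (b := b) (c := c)
      (f := fun y : ℝ => f (w.re + y * Complex.I))
      (Continuous.intervalIntegrable (by fun_prop) _ _)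
      (Continuous.intervalIntegrable (by fun_prop) _ _),
      ← intervalIntegral.integral_add_adjacent_intervals (a := a) (b := b) (c := c)
      (f := fun y : ℝ => f (z.re + y * Complex.I))
      (Continuous.intervalIntegrable (by fun_prop) _ _)
      (Continuous.intervalIntegrable (by fun_prop) _ _)]
    simp only [smul_add]; ring
  have hside : ∀ a b : ℝ, a ∈ Set.uIcc z.im w.im → b ∈ Set.uIcc z.im w.im →
      (0 ∉ Set.Ioo (min a b) (max a b)) → N a b = 0 := by
    intro a b ha hb h0
    have := Complex.integral_boundary_rect_eq_zero_of_continuousOn_of_differentiableOn f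
      (⟨z.re, a⟩ : ℂ) (⟨w.re, b⟩ : ℂ) hf.continuousOn ?_
    · simpa [hN] using this
    intro ζ hζ
    obtain ⟨h1, h2⟩ := hζ
    simp only [Set.mem_preimage] at h1 h2
    refine (hd ζ (hzw ?_) ?_).differentiableWithinAt
    · refine ⟨?_, ?_⟩
      · exact Set.Ioo_subset_Icc_self h1
      · exact Set.uIcc_subset_uIcc ha hb (Set.Ioo_subset_Icc_self h2)
    · intro h; rw [h] at h2; exact h0 h2
  change N z.im w.im = 0
  by_cases h : (0 : ℝ) ∈ Set.uIcc z.im w.im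
  · rw [hadd z.im 0 w.im, hside _ _ Set.left_mem_uIcc h, hside _ _ h Set.right_mem_uIcc, add_zero]
    · intro hh; rcases le_total 0 w.im with h' | h' <;> simp [h'] at hh
    · intro hh; rcases le_total 0 z.im with h' | h' <;> simp [h'] at hh
  · exact hside _ _ Set.left_mem_uIcc Set.right_mem_uIcc fun hh => h (Set.Ioo_subset_Icc_self hh)

theorem neBot_nhdsWithin_im_pos (x : ℝ) : (𝓝[{z : ℂ | 0 < z.im}] (x : ℂ)).NeBot := by
  rw [← mem_closure_iff_nhdsWithin_neBot]
  rw [Metric.mem_closure_iff]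
  intro ε hε
  refine ⟨x + (ε / 2 : ℝ) * Complex.I, by simpa, ?_⟩
  rw [dist_eq_norm]
  simp only [sub_add_cancel_left, norm_neg, norm_mul, Complex.norm_real, Complex.norm_I, mul_one,
    Real.norm_eq_abs]
  rw [abs_of_pos] <;> linarith

/-- Schwarz reflection near a real point. By the half-disc barrier `|Re Φ| = O(y)`, so the derivative
of `Φ` is bounded and `Φ` extends continuously to the real axis. -/
theorem exists_local_reflection {Φ : ℂ → ℂ} {x r : ℝ} (hr : 0 < r)
    (hΦ : DifferentiableOn ℂ Φ {z | 0 < z.im})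
    (h0 : ∀ t : ℝ, |t - x| < r →
      Tendsto (fun z => (Φ z).re) (𝓝[{z : ℂ | 0 < z.im}] (t : ℂ)) (𝓝 0)) :
    ∃ ρ > 0, ∃ f : ℂ → ℂ, DifferentiableOn ℂ f (Metric.ball (x : ℂ) ρ) ∧
      (∀ z ∈ Metric.ball (x : ℂ) ρ, 0 < z.im → f z = Φ z) ∧
      (∀ z ∈ Metric.ball (x : ℂ) ρ, z.im < 0 → f z = - (starRingEnd ℂ) (Φ ((starRingEnd ℂ) z))) ∧
      (∀ t : ℝ, (t : ℂ) ∈ Metric.ball (x : ℂ) ρ →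
        Tendsto Φ (𝓝[{z : ℂ | 0 < z.im}] (t : ℂ)) (𝓝 (f t)) ∧ (f t).re = 0) := by
  obtain ⟨s, hs, hsr, hb⟩ : ∃ s > 0, s < r ∧ ∀ z : ℂ, 0 < z.im → ‖z - x‖ < s → |(Φ z).re| ≤ 1 := by
    have := (h0 x (by simpa)).abs
    rw [abs_zero] at this
    have := this.eventually (gt_mem_nhds one_pos)
    rw [eventually_nhdsWithin_iff, Metric.eventually_nhds_iff] at this
    obtain ⟨s, hs, h⟩ := this
    refine ⟨min s (r / 2), lt_min hs (by linarith), (min_le_right _ _).trans_lt (by linarith),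
      fun z hz hzs => (h ?_ hz).le⟩
    rw [dist_eq_norm]; exact hzs.trans_le (min_le_left _ _)
  set d := s / 2 with hd
  have hd0 : 0 < d := by positivity
  have hlin : ∀ z : ℂ, 0 < z.im → ‖z - x‖ < s / 4 → |(Φ z).re| ≤ 2 / d * z.im := by
    intro z hz hzs
    have hre : |z.re - x| < s / 4 := by
      have := Complex.abs_re_le_norm (z - x)
      simp at this; linarith
    have him : z.im < s / 4 := by
      have := Complex.im_le_norm (z - x)
      simp at this; linarith
    have hzz : ‖z - (z.re : ℂ)‖ = z.im := by
      have : z - (z.re : ℂ) = z.im * Complex.I := by apply Complex.ext <;> simp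
      rw [this]; simp [abs_of_pos hz]
    have hball : ∀ w : ℂ, ‖w - z.re‖ ≤ d → ‖w - x‖ < s := by
      intro w hw
      have : w - x = (w - z.re) + ((z.re - x : ℝ) : ℂ) := by push_cast; ring
      rw [this]
      refine (norm_add_le _ _).trans_lt ?_
      rw [Complex.norm_real, Real.norm_eq_abs]; linarith
    have hlim : ∀ t : ℝ, |t - z.re| ≤ d → ∀ ε > 0, ∀ᶠ z in 𝓝[{z : ℂ | 0 < z.im}] (t : ℂ),
        |(Φ z).re| ≤ ε := by
      intro t ht ε hε
      have htx : |t - x| < r := by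
        have : |t - x| ≤ |t - z.re| + |z.re - x| := abs_sub_le _ _ _
        linarith
      have := (h0 t htx).abs
      rw [abs_zero] at this
      exact (this.eventually (gt_mem_nhds hε)).mono fun z hz => hz.le
    have hzd : ‖z - (z.re : ℂ)‖ < d := by rw [hzz]; linarith
    have b1 := re_le_half_disc_barrier hd0 zero_le_one hΦ
      (fun w hw hwd => (abs_le.1 (hb w hw (hball w hwd))).2)
      (fun t ht ε hε => (hlim t ht ε hε).mono fun z hz => (abs_le.1 hz).2) z hz hzd
    have b2 := re_le_half_disc_barrier (Φ := fun z => - Φ z) hd0 zero_le_one hΦ.neg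
      (fun w hw hwd => by have := (abs_le.1 (hb w hw (hball w hwd))).1; simp; linarith)
      (fun t ht ε hε => (hlim t ht ε hε).mono fun z hz => by
        have := (abs_le.1 hz).1; simp; linarith) z hz hzd
    have hle : 1 / d ^ 2 * ((z.re - z.re) ^ 2 - z.im ^ 2 + 2 * d * z.im) ≤ 2 / d * z.im := by
      have : 1 / d ^ 2 * ((z.re - z.re) ^ 2 - z.im ^ 2 + 2 * d * z.im)
        = 2 / d * z.im - z.im ^ 2 / d ^ 2 := by field_simp; ring
      rw [this]
      have : 0 ≤ z.im ^ 2 / d ^ 2 := by positivity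
      linarith
    rw [Complex.neg_re] at b2
    exact abs_le.2 ⟨by linarith, by linarith⟩
  set ρ := s / 8 with hρ
  have hρ0 : 0 < ρ := by positivity
  set U : Set ℂ := Metric.ball (x : ℂ) ρ ∩ {z | 0 < z.im} with hU
  have hUo : IsOpen U := Metric.isOpen_ball.inter isOpen_im_pos
  have hUc : Convex ℝ U := (convex_ball _ _).inter (convex_halfSpace_im_gt 0)
  have hder : ∀ z ∈ U, ‖deriv Φ z‖ ≤ 32 / d := by
    intro z hz
    obtain ⟨hz1, hz2⟩ := hz
    have hz2 : 0 < z.im := hz2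
    have hzx : ‖z - x‖ < ρ := by simpa [dist_eq_norm] using hz1
    have him : z.im < ρ := by
      have := Complex.im_le_norm (z - x)
      simp at this; linarith
    have hwim : ∀ w ∈ Metric.ball z z.im, 0 < w.im ∧ w.im ≤ 2 * z.im := by
      intro w hw
      have h1 : ‖w - z‖ < z.im := by simpa [dist_eq_norm] using hw
      have h2 := Complex.abs_im_le_norm (w - z)
      rw [Complex.sub_im, abs_le] at h2
      exact ⟨by linarith [h2.1], by linarith [h2.2]⟩
    have := norm_deriv_le_of_abs_re_le (f := Φ) (c := z) (ρ := z.im) (M := 2 / d * (2 * z.im)) hz2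
      (by positivity) (hΦ.mono fun w hw => (hwim w hw).1) ?_
    · refine this.trans (le_of_eq ?_)
      field_simp; ring
    · intro w hw
      obtain ⟨h1, h2⟩ := hwim w hw
      refine (hlin w h1 ?_).trans (by gcongr)
      have h3 : ‖w - z‖ < z.im := by simpa [dist_eq_norm] using hw
      have : w - x = (w - z) + (z - x) := by ring
      rw [this]
      refine (norm_add_le _ _).trans_lt ?_
      linarith
  have hΦU : ∀ z ∈ U, DifferentiableAt ℂ Φ z := fun z hz =>
    hΦ.differentiableAt (isOpen_im_pos.mem_nhds hz.2)
  have hLip : LipschitzOnWith (Real.toNNReal (32 / d)) Φ U := by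
    refine hUc.lipschitzOnWith_of_nnnorm_deriv_le hΦU fun z hz => ?_
    rw [← NNReal.coe_le_coe, coe_nnnorm, Real.coe_toNNReal _ (by positivity)]
    exact hder z hz
  obtain ⟨g, hg, hgeq⟩ := hLip.extend_finite_dimension
  have hgc : Continuous g := hg.continuous
  have htend : ∀ t : ℝ, (t : ℂ) ∈ Metric.ball (x : ℂ) ρ →
      Tendsto Φ (𝓝[{z : ℂ | 0 < z.im}] (t : ℂ)) (𝓝 (g t)) ∧ (g t).re = 0 := by
    intro t ht
    have h1 : Tendsto Φ (𝓝[{z : ℂ | 0 < z.im}] (t : ℂ)) (𝓝 (g t)) := by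
      refine ((hgc.tendsto (t : ℂ)).mono_left nhdsWithin_le_nhds).congr' ?_
      filter_upwards [self_mem_nhdsWithin,
        mem_nhdsWithin_of_mem_nhds (Metric.isOpen_ball.mem_nhds ht)] with z hz1 hz2
      exact (hgeq ⟨hz2, hz1⟩).symm
    refine ⟨h1, ?_⟩
    have := neBot_nhdsWithin_im_pos t
    refine tendsto_nhds_unique ((Complex.continuous_re.tendsto _).comp h1) (h0 t ?_)
    have : ‖(t : ℂ) - x‖ < ρ := by simpa [dist_eq_norm] using ht
    rw [← Complex.ofReal_sub, Complex.norm_real, Real.norm_eq_abs] at this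
    linarith
  -- the correction term `2 Re g` makes the extension continuous on the whole plane; it vanishes on
  -- the real points of the disc
  set f : ℂ → ℂ := fun z => if 0 ≤ z.im then g z else
    - (starRingEnd ℂ) (g ((starRingEnd ℂ) z)) + 2 * ((g (z.re : ℂ)).re : ℂ) with hf
  have hfc : Continuous f := by
    refine Continuous.if_le hgc ?_ continuous_const Complex.continuous_im ?_
    · have h1 : Continuous fun z : ℂ => (starRingEnd ℂ) (g ((starRingEnd ℂ) z)) :=
        Complex.continuous_conj.comp (hgc.comp Complex.continuous_conj)
      have h2 : Continuous fun z : ℂ => ((g (z.re : ℂ)).re : ℂ) := by fun_prop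
      exact h1.neg.add (continuous_const.mul h2)
    · intro z hz
      have hz' : z = (z.re : ℂ) := by apply Complex.ext <;> simp [← hz]
      rw [hz']
      apply Complex.ext <;> simp
      ring
  have hreal : ∀ z ∈ Metric.ball (x : ℂ) ρ, (z.re : ℂ) ∈ Metric.ball (x : ℂ) ρ := by
    intro z hz
    have h1 : ‖z - x‖ < ρ := by simpa [dist_eq_norm] using hz
    rw [Metric.mem_ball, dist_eq_norm, ← Complex.ofReal_sub, Complex.norm_real]
    refine lt_of_le_of_lt ?_ h1
    simpa using Complex.abs_re_le_norm (z - x)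
  have hconjball : ∀ z ∈ Metric.ball (x : ℂ) ρ, (starRingEnd ℂ) z ∈ Metric.ball (x : ℂ) ρ := by
    intro z hz
    rw [Metric.mem_ball, dist_eq_norm] at hz ⊢
    rw [← Complex.norm_conj]; simpa using hz
  have hfup : ∀ z ∈ Metric.ball (x : ℂ) ρ, 0 < z.im → f z = Φ z := by
    intro z hz hzi
    simp only [hf, hzi.le, if_true]
    exact (hgeq ⟨hz, hzi⟩).symm
  have hflow : ∀ z ∈ Metric.ball (x : ℂ) ρ, z.im < 0 →
      f z = - (starRingEnd ℂ) (Φ ((starRingEnd ℂ) z)) := by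
    intro z hz hzi
    simp only [hf, not_le.2 hzi, if_false]
    rw [(htend z.re (hreal z hz)).2, hgeq ⟨hconjball z hz, by simpa using hzi⟩]
    simp
  refine ⟨ρ, hρ0, f, ?_, hfup, hflow, ?_⟩
  · refine differentiableOn_ball_of_continuous_of_im_ne_zero hfc fun z hz hzi => ?_
    rcases lt_or_gt_of_ne hzi with h | h
    · have h1 : DifferentiableAt ℂ Φ ((starRingEnd ℂ) z) :=
        hΦ.differentiableAt (isOpen_im_pos.mem_nhds (by simpa using h))
      have h2 : DifferentiableAt ℂ (fun z => - (starRingEnd ℂ) (Φ ((starRingEnd ℂ) z))) z := by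
        have := (h1.hasDerivAt.conj_conj).differentiableAt
        simpa [Function.comp_def] using this.neg
      refine h2.congr_of_eventuallyEq ?_
      filter_upwards [Metric.isOpen_ball.mem_nhds hz,
        (isOpen_lt Complex.continuous_im continuous_const).mem_nhds h] with w hw1 hw2
      exact hflow w hw1 hw2
    · refine (hΦ.differentiableAt (isOpen_im_pos.mem_nhds h)).congr_of_eventuallyEq ?_
      filter_upwards [Metric.isOpen_ball.mem_nhds hz, isOpen_im_pos.mem_nhds h] with w hw1 hw2
      exact hfup w hw1 hw2
  · intro t ht
    have : f t = g t := by simp [hf]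
    rw [this]
    exact htend t ht

/-- Schwarz reflection across `(0, δ)`. At real points outside `(0, δ)` the value of `X` is
irrelevant. -/
theorem exists_reflection {Φ : ℂ → ℂ} {δ : ℝ}
    (hΦ : DifferentiableOn ℂ Φ {z | 0 < z.im})
    (h0 : ∀ t : ℝ, 0 < t → t < δ →
      Tendsto (fun z => (Φ z).re) (𝓝[{z : ℂ | 0 < z.im}] (t : ℂ)) (𝓝 0)) :
    ∃ X : ℂ → ℂ, (∀ z : ℂ, (z.im ≠ 0 ∨ (0 < z.re ∧ z.re < δ)) → DifferentiableAt ℂ X z) ∧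
      (∀ z : ℂ, 0 < z.im → X z = Φ z) ∧
      (∀ z : ℂ, z.im ≠ 0 → X ((starRingEnd ℂ) z) = - (starRingEnd ℂ) (X z)) ∧
      (∀ t : ℝ, 0 < t → t < δ → (X t).re = 0) := by
  classical
  set X : ℂ → ℂ := fun z => if 0 < z.im then Φ z else if z.im < 0 then
    - (starRingEnd ℂ) (Φ ((starRingEnd ℂ) z)) else limUnder (𝓝[{z : ℂ | 0 < z.im}] z) Φ with hX
  have hup : ∀ z : ℂ, 0 < z.im → X z = Φ z := fun z hz => by simp only [hX, if_pos hz]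
  have hlow : ∀ z : ℂ, z.im < 0 → X z = - (starRingEnd ℂ) (Φ ((starRingEnd ℂ) z)) := fun z hz => by
    simp only [hX, if_neg (not_lt.2 hz.le), if_pos hz]
  have hloc : ∀ t : ℝ, 0 < t → t < δ → DifferentiableAt ℂ X t ∧ (X t).re = 0 := by
    intro t ht1 ht2
    obtain ⟨ρ, hρ, f, hf1, hf2, hf3, hf4⟩ := exists_local_reflection (x := t) (r := min t (δ - t))
      (lt_min ht1 (by linarith)) hΦ fun s hs => by
        have h1 := hs.trans_le (min_le_left _ _)
        have h2 := hs.trans_le (min_le_right _ _)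
        rw [abs_lt] at h1 h2
        exact h0 s (by linarith) (by linarith)
    have hXf : ∀ z ∈ Metric.ball (t : ℂ) ρ, X z = f z := by
      intro z hz
      rcases lt_trichotomy z.im 0 with h | h | h
      · rw [hlow z h, hf3 z hz h]
      · have hz' : z = (z.re : ℂ) := by apply Complex.ext <;> simp [h]
        rw [hz'] at hz ⊢
        have := neBot_nhdsWithin_im_pos z.re
        have := (hf4 z.re hz).1.limUnder_eq
        simp only [hX, Complex.ofReal_im, lt_irrefl, if_false]
        exact this
      · rw [hup z h, hf2 z hz h]
    refine ⟨?_, ?_⟩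
    · refine (hf1.differentiableAt (Metric.ball_mem_nhds _ hρ)).congr_of_eventuallyEq ?_
      filter_upwards [Metric.ball_mem_nhds _ hρ] with z hz using hXf z hz
    · rw [hXf t (Metric.mem_ball_self hρ)]
      exact (hf4 t (Metric.mem_ball_self hρ)).2
  refine ⟨X, ?_, hup, ?_, fun t h1 h2 => (hloc t h1 h2).2⟩
  · intro z hz
    rcases lt_trichotomy z.im 0 with h | h | h
    · have h1 : DifferentiableAt ℂ Φ ((starRingEnd ℂ) z) :=
        hΦ.differentiableAt (isOpen_im_pos.mem_nhds (by simpa using h))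
      have h2 : DifferentiableAt ℂ (fun z => - (starRingEnd ℂ) (Φ ((starRingEnd ℂ) z))) z := by
        have := (h1.hasDerivAt.conj_conj).differentiableAt
        simpa [Function.comp_def] using this.neg
      refine h2.congr_of_eventuallyEq ?_
      filter_upwards [(isOpen_lt Complex.continuous_im continuous_const).mem_nhds h] with w hw
      exact hlow w hw
    · have hz' : z = (z.re : ℂ) := by apply Complex.ext <;> simp [h]
      have := hz.resolve_left (by simp [h])
      rw [hz']
      exact (hloc z.re this.1 this.2).1
    · refine (hΦ.differentiableAt (isOpen_im_pos.mem_nhds h)).congr_of_eventuallyEq ?_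
      filter_upwards [isOpen_im_pos.mem_nhds h] with w hw
      exact hup w hw
  · intro z hz
    rcases lt_or_gt_of_ne hz with h | h
    · rw [hup _ (by simpa using h), hlow z h]; simp
    · rw [hlow _ (by simpa using h), hup z h]; simp

/-- The Borel–Carathéodory inequality in discs tangent to the line `Im w = Im z / 4`; the constant
`K` depends on `Φ` through its values at height `δ`. -/
theorem exists_norm_and_norm_deriv_le_of_re_le {Φ : ℂ → ℂ} {δ : ℝ} (hδ : 0 < δ)
    (hΦ : DifferentiableOn ℂ Φ {z | 0 < z.im}) :
    ∃ K : ℝ, 0 < K ∧ ∀ z : ℂ, 0 < z.im → |z.re| ≤ δ → z.im ≤ δ → ∀ m : ℝ, 0 ≤ m →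
      (∀ w : ℂ, z.im / 4 ≤ w.im → ‖w‖ ≤ 4 * δ → (Φ w).re ≤ m) →
      ‖Φ z‖ ≤ K * (m + 1) / z.im ∧ ‖deriv Φ z‖ ≤ K * (m + 1) / z.im ^ 2 := by
  obtain ⟨K₀, hK₀⟩ : ∃ K₀, ∀ x ∈ Set.Icc (-δ) δ, ‖Φ ((x : ℝ) + δ * Complex.I)‖ ≤ K₀ := by
    refine isCompact_Icc.exists_bound_of_continuousOn (f := fun x : ℝ => Φ (x + δ * Complex.I)) ?_
    refine (hΦ.continuousOn.comp_continuous (by fun_prop) fun x => ?_).continuousOn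
    simpa
  have hK₀0 : 0 ≤ K₀ := (norm_nonneg _).trans (hK₀ 0 ⟨by linarith, hδ.le⟩)
  refine ⟨16 * δ * (1 + K₀), by positivity, fun z hz hzre hzim m hm hb => ?_⟩
  -- the centre is at height `δ`, where `Φ` is bounded independently of `z`
  set c : ℂ := z.re + δ * Complex.I with hc
  set R : ℝ := δ - z.im / 4 with hR
  have hRpos : 0 < R := by simp only [hR]; linarith
  have hcball : ∀ w ∈ Metric.ball (0 : ℂ) R, z.im / 4 ≤ (c + w).im ∧ ‖c + w‖ ≤ 4 * δ := by
    intro w hw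
    have hw' : ‖w‖ < R := by simpa using hw
    have h2 := Complex.abs_im_le_norm w
    rw [abs_le] at h2
    refine ⟨?_, ?_⟩
    · simp [hc]; linarith [h2.1]
    · have h3 : ‖c‖ ≤ δ + δ := by
        refine (norm_add_le _ _).trans ?_
        simp only [norm_mul, Complex.norm_real, Complex.norm_I, mul_one, Real.norm_eq_abs,
          abs_of_pos hδ]
        linarith
      refine (norm_add_le _ _).trans ?_
      linarith
  have hsub : ∀ w ∈ Metric.ball (0 : ℂ) R, 0 < (c + w).im := fun w hw =>
    lt_of_lt_of_le (by linarith) (hcball w hw).1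
  have hbd : ∀ ζ ∈ Metric.closedBall z (z.im / 2), ‖Φ ζ‖ ≤ 8 * δ * (1 + K₀) * (m + 1) / z.im := by
    intro ζ hζ
    have hζ' : ‖ζ - z‖ ≤ z.im / 2 := by simpa [dist_eq_norm] using hζ
    have hzc : ‖z - c‖ = δ - z.im := by
      have : z - c = ((z.im - δ : ℝ) : ℂ) * Complex.I := by
        apply Complex.ext <;> simp [hc]
      rw [this]
      simp only [norm_mul, Complex.norm_real, Complex.norm_I, mul_one, Real.norm_eq_abs]
      rw [abs_of_nonpos (by linarith)]; ring
    have hζc : ‖ζ - c‖ ≤ δ - z.im / 2 := by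
      have : ζ - c = (ζ - z) + (z - c) := by ring
      rw [this]
      refine (norm_add_le _ _).trans ?_
      linarith
    have hmem : ζ - c ∈ Metric.ball (0 : ℂ) R := by
      simp only [Metric.mem_ball, dist_zero_right, hR]; linarith
    have hBC := Complex.borelCaratheodory (f := fun w => Φ (c + w)) (M := m + 1) (R := R)
      (z := ζ - c) (by linarith) ((hΦ.comp (by fun_prop) fun w hw => hsub w hw))
      (fun w hw => by
        have := hb (c + w) (hcball w hw).1 (hcball w hw).2
        simp only [Set.mem_ofPred_eq]; linarith) hRpos hmem
    simp only [add_sub_cancel, add_zero] at hBC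
    refine hBC.trans ?_
    have h1 : z.im / 4 ≤ R - ‖ζ - c‖ := by simp only [hR]; linarith
    have h2 : ‖ζ - c‖ ≤ δ := by linarith
    have h3 : ‖Φ c‖ ≤ K₀ := hK₀ z.re (by rw [Set.mem_Icc]; exact abs_le.1 hzre)
    have h4 : R ≤ δ := by simp only [hR]; linarith
    calc 2 * (m + 1) * ‖ζ - c‖ / (R - ‖ζ - c‖) + ‖Φ c‖ * (R + ‖ζ - c‖) / (R - ‖ζ - c‖)
        ≤ 2 * (m + 1) * δ / (z.im / 4) + K₀ * (δ + δ) / (z.im / 4) := by gcongr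
      _ = 8 * δ * ((m + 1) + K₀) / z.im := by field_simp; ring
      _ ≤ 8 * δ * (1 + K₀) * (m + 1) / z.im := by
          have h5 : (m + 1) + K₀ ≤ (1 + K₀) * (m + 1) := by nlinarith [mul_nonneg hK₀0 hm]
          rw [show 8 * δ * (1 + K₀) * (m + 1) = 8 * δ * ((1 + K₀) * (m + 1)) by ring]
          gcongr
  refine ⟨?_, ?_⟩
  · refine (hbd z (Metric.mem_closedBall_self (by positivity))).trans ?_
    gcongr
    norm_num
  · have := Complex.norm_deriv_le_of_forall_mem_sphere_norm_le (f := Φ) (c := z)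
      (R := z.im / 2) (C := 8 * δ * (1 + K₀) * (m + 1) / z.im) (by positivity) ?_
      (fun ζ hζ => hbd ζ (Metric.sphere_subset_closedBall hζ))
    · refine this.trans (le_of_eq ?_)
      field_simp; ring
    · refine DifferentiableOn.diffContOnCl (hΦ.mono ?_)
      intro w hw
      have hw' := Metric.closure_ball_subset_closedBall hw
      have h1 : ‖w - z‖ ≤ z.im / 2 := by simpa [dist_eq_norm] using hw'
      have h2 := Complex.abs_im_le_norm (w - z)
      rw [Complex.sub_im, abs_le] at h2
      simp only [Set.mem_ofPred_eq]; linarith [h2.1]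

/-! ### Phragmén–Lindelöf estimates near a real segment -/

theorem re_cpow_ofReal {w : ℂ} (hw : w ≠ 0) (r : ℝ) :
    (w ^ (r : ℂ)).re = ‖w‖ ^ r * Real.cos (r * w.arg) := by
  rw [Complex.cpow_def_of_ne_zero hw, Complex.exp_re, Complex.re_mul_ofReal, Complex.im_mul_ofReal,
    Complex.log_re, Complex.log_im, Real.rpow_def_of_pos (norm_pos_iff.2 hw), mul_comm w.arg]

theorem im_cpow_ofReal {w : ℂ} (hw : w ≠ 0) (r : ℝ) :
    (w ^ (r : ℂ)).im = ‖w‖ ^ r * Real.sin (r * w.arg) := by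
  rw [Complex.cpow_def_of_ne_zero hw, Complex.exp_im, Complex.re_mul_ofReal, Complex.im_mul_ofReal,
    Complex.log_re, Complex.log_im, Real.rpow_def_of_pos (norm_pos_iff.2 hw), mul_comm w.arg]

theorem abs_arg_le_abs_im_div_re {q : ℂ} (hq : 0 < q.re) : |q.arg| ≤ |q.im| / q.re := by
  have h1 : |q.arg| < Real.pi / 2 := Complex.abs_arg_lt_pi_div_two_iff.2 (Or.inl hq)
  have h2 : |q.arg| ≤ Real.tan |q.arg| := Real.le_tan (abs_nonneg _) h1
  refine h2.trans (le_of_eq ?_)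
  have h3 := Complex.tan_arg q
  rcases abs_cases q.arg with ⟨h, h'⟩ | ⟨h, h'⟩
  · rw [h, h3, abs_of_nonneg (Complex.arg_nonneg_iff.1 h')]
  · rw [h, Real.tan_neg, h3, abs_of_neg (Complex.arg_neg_iff.1 h'), neg_div]

/-- In the sector `α |Im q| ≤ Re q` the argument of `q ^ (-α)` is at most `1 < π / 3`. -/
theorem half_norm_rpow_le_re_cpow {q : ℂ} {α : ℝ} (hα : 0 ≤ α) (hq : 0 < q.re)
    (h : α * |q.im| ≤ q.re) : ‖q‖ ^ (-α) / 2 ≤ (q ^ ((-α : ℝ) : ℂ)).re := by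
  have hq0 : q ≠ 0 := fun h => by simp [h] at hq
  rw [re_cpow_ofReal hq0, neg_mul, Real.cos_neg, div_eq_mul_inv]
  have h1 : |α * q.arg| ≤ 1 := by
    rw [abs_mul, abs_of_nonneg hα]
    calc α * |q.arg| ≤ α * (|q.im| / q.re) := by gcongr; exact abs_arg_le_abs_im_div_re hq
      _ = α * |q.im| / q.re := by ring
      _ ≤ 1 := by rwa [div_le_one hq]
  have h2 : Real.cos (Real.pi / 3) ≤ Real.cos (α * q.arg) := by
    rw [← Real.cos_abs (α * q.arg)]
    exact Real.cos_le_cos_of_nonneg_of_le_pi (abs_nonneg _) (by linarith [Real.pi_pos])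
      (h1.trans (by linarith [Real.pi_gt_three]))
  rw [Real.cos_pi_div_three] at h2
  gcongr
  linarith

/-- A growth bound in terms of the distance to the real axis, in a rhombus with diagonal `[a, b]` (cut
by an open set `T`), gives one in terms of the distances to `a` and `b`: compare with the exponential
of `(z - a) ^ (-α) + (b - z) ^ (-α)`, which dominates the given bound on the sides. -/
theorem norm_le_of_growth_on_rhombus {E : ℂ → ℂ} {α ε a b : ℝ} (hα : 1 ≤ α) (hε : 0 ≤ ε)
    (hab : a < b) {T : Set ℂ} (hT : IsOpen T)
    (hE : ∀ z : ℂ, α * |z.im| ≤ z.re - a → α * |z.im| ≤ b - z.re → DifferentiableAt ℂ E z)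
    (hfr : ∀ z : ℂ, α * |z.im| ≤ z.re - a → α * |z.im| ≤ b - z.re → z ∈ frontier T → ‖E z‖ ≤ 1)
    (hg : ∀ z : ℂ, α * |z.im| ≤ z.re - a → α * |z.im| ≤ b - z.re → z ∈ closure T → z.im ≠ 0 →
      ‖E z‖ ≤ Real.exp (ε * |z.im| ^ (-α))) :
    ∀ z ∈ T, α * |z.im| < z.re - a → α * |z.im| < b - z.re →
      ‖E z‖ ≤ Real.exp (2 * (α + 1) ^ α * ε * (‖z - a‖ ^ (-α) + ‖b - z‖ ^ (-α))) := by
  have hα0 : 0 < α := by linarith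
  set D : Set ℂ := {z | α * |z.im| < z.re - a ∧ α * |z.im| < b - z.re} ∩ T with hD
  have hc1 : Continuous fun z : ℂ => α * |z.im| := by fun_prop
  have hc2 : Continuous fun z : ℂ => z.re - a := by fun_prop
  have hc3 : Continuous fun z : ℂ => b - z.re := by fun_prop
  have hDo : IsOpen D := ((isOpen_lt hc1 hc2).inter (isOpen_lt hc1 hc3)).inter hT
  have hcl : closure D ⊆ {z | α * |z.im| ≤ z.re - a ∧ α * |z.im| ≤ b - z.re} :=
    closure_minimal (fun z hz => ⟨hz.1.1.le, hz.1.2.le⟩)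
      ((isClosed_le hc1 hc2).inter (isClosed_le hc1 hc3))
  have hclT : closure D ⊆ closure T := closure_mono Set.inter_subset_right
  have him0 : ∀ z : ℂ, 0 ≤ α * |z.im| := fun z => by positivity
  have hbd : Bornology.IsBounded D := by
    refine (Metric.isBounded_closedBall (x := (0 : ℂ)) (r := (|a| + |b|) + (b - a))).subset ?_
    intro z hz
    obtain ⟨⟨h1, h2⟩, -⟩ := hz
    rw [mem_closedBall_zero_iff]
    refine (Complex.norm_le_abs_re_add_abs_im z).trans ?_
    have h3 := him0 z
    have h4 : |z.im| ≤ α * |z.im| := le_mul_of_one_le_left (abs_nonneg _) hα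
    have h5 : |z.re| ≤ |a| + |b| := by
      rw [abs_le]
      constructor <;> linarith [neg_abs_le a, le_abs_self b, abs_nonneg a, abs_nonneg b]
    linarith
  set κ : ℝ := 2 * (α + 1) ^ α * ε with hκ
  have hκ0 : 0 ≤ κ := by positivity
  set g : ℂ → ℂ := fun z => (κ : ℂ) * ((z - a) ^ ((-α : ℝ) : ℂ) + (b - z) ^ ((-α : ℝ) : ℂ)) with hgdef
  have hg1 : ∀ z : ℂ, α * |z.im| ≤ z.re - a → a < z.re →
      ‖z - a‖ ^ (-α) / 2 ≤ ((z - a) ^ ((-α : ℝ) : ℂ)).re := fun z hz hza =>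
    half_norm_rpow_le_re_cpow hα0.le (by simpa using hza) (by simpa using hz)
  have hg2 : ∀ z : ℂ, α * |z.im| ≤ b - z.re → z.re < b →
      ‖b - z‖ ^ (-α) / 2 ≤ ((b - z) ^ ((-α : ℝ) : ℂ)).re := fun z hz hza =>
    half_norm_rpow_le_re_cpow hα0.le (by simpa using hza) (by simpa using hz)
  have hgre : ∀ z, (g z).re = κ * (((z - a) ^ ((-α : ℝ) : ℂ)).re + ((b - z) ^ ((-α : ℝ) : ℂ)).re) := by
    intro z; simp only [hgdef, Complex.re_ofReal_mul, Complex.add_re]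
  have hgd : ∀ z : ℂ, a < z.re → z.re < b → DifferentiableAt ℂ g z := by
    intro z h1 h2
    have e1 : z - a ∈ Complex.slitPlane := Or.inl (by simpa using h1)
    have e2 : b - z ∈ Complex.slitPlane := Or.inl (by simpa using h2)
    have d1 : DifferentiableAt ℂ (fun z : ℂ => (z - a) ^ ((-α : ℝ) : ℂ)) z :=
      DifferentiableAt.cpow (by fun_prop) (by fun_prop) e1
    have d2 : DifferentiableAt ℂ (fun z : ℂ => (b - z) ^ ((-α : ℝ) : ℂ)) z :=
      DifferentiableAt.cpow (by fun_prop) (by fun_prop) e2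
    exact (d1.add d2).const_mul _
  have hgpos : ∀ z : ℂ, α * |z.im| ≤ z.re - a → α * |z.im| ≤ b - z.re → a < z.re → z.re < b →
      0 ≤ (g z).re := by
    intro z h1 h2 h3 h4
    rw [hgre]
    have e1 : 0 ≤ ‖z - a‖ ^ (-α) / 2 := by positivity
    have e2 : 0 ≤ ‖b - z‖ ^ (-α) / 2 := by positivity
    have := hg1 z h1 h3
    have := hg2 z h2 h4
    exact mul_nonneg hκ0 (by linarith)
  have hside : ∀ (q : ℂ), q ≠ 0 → α * |q.im| = q.re → ε * |q.im| ^ (-α) ≤ κ * (‖q‖ ^ (-α) / 2) := by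
    intro q hq h
    have him : 0 < |q.im| := by
      rw [abs_pos]; intro h0; apply hq
      apply Complex.ext
      · rw [h0] at h; simpa using h.symm
      · exact h0
    have hn : ‖q‖ ≤ (α + 1) * |q.im| := by
      refine (Complex.norm_le_abs_re_add_abs_im q).trans ?_
      rw [← h, abs_mul, abs_abs, abs_of_pos hα0]; linarith
    have h2 : ((α + 1) * |q.im|) ^ (-α) ≤ ‖q‖ ^ (-α) :=
      Real.rpow_le_rpow_of_nonpos (norm_pos_iff.2 hq) hn (by linarith)
    rw [Real.mul_rpow (by linarith) him.le, Real.rpow_neg (by linarith)] at h2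
    have h3 : 0 < (α + 1) ^ α := by positivity
    calc ε * |q.im| ^ (-α) = κ * ((((α + 1) ^ α)⁻¹ * |q.im| ^ (-α)) / 2) := by
          rw [hκ]; field_simp
      _ ≤ _ := by gcongr
  have hDre : ∀ z ∈ D, a < z.re ∧ z.re < b := by
    intro z hz
    have := him0 z
    exact ⟨by linarith [hz.1.1], by linarith [hz.1.2]⟩
  have hEd : ∀ z ∈ D, DifferentiableAt ℂ E z := fun z hz => hE z hz.1.1.le hz.1.2.le
  have key := norm_le_of_frontier_limsup_off_finset hDo hbd
    (f := fun z => E z * Complex.exp (-(g z))) (C := 1) ?_ one_pos {(a : ℂ), (b : ℂ)} ?_ ?_ ?_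
  · intro z hzT h1 h2
    have hzD : z ∈ D := ⟨⟨h1, h2⟩, hzT⟩
    have := key z hzD
    rw [norm_mul, Complex.norm_exp, Complex.neg_re, Real.exp_neg, ← div_eq_mul_inv,
      div_le_one (Real.exp_pos _)] at this
    refine this.trans (Real.exp_le_exp.2 ?_)
    rw [hgre]
    have e1 := Complex.re_le_norm ((z - a) ^ ((-α : ℝ) : ℂ))
    have e2 := Complex.re_le_norm ((b - z) ^ ((-α : ℝ) : ℂ))
    rw [Complex.norm_cpow_real] at e1 e2
    gcongr
  · intro z hz
    obtain ⟨h1, h2⟩ := hDre z hz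
    exact ((hEd z hz).mul (hgd z h1 h2).neg.cexp).differentiableWithinAt
  · intro ζ hζ hζS η hη
    rw [hDo.frontier_eq] at hζ
    obtain ⟨h1, h2⟩ := hcl hζ.1
    have h3 : a < ζ.re := by
      refine lt_of_le_of_ne (by linarith [him0 ζ]) fun h => hζS ?_
      have : ζ = a := by
        apply Complex.ext
        · simp [h]
        · have : α * |ζ.im| ≤ 0 := by linarith
          have : |ζ.im| ≤ 0 := by nlinarith [abs_nonneg ζ.im]
          simpa using this
      simp [this]
    have h4 : ζ.re < b := by
      refine lt_of_le_of_ne (by linarith [him0 ζ]) fun h => hζS ?_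
      have : ζ = b := by
        apply Complex.ext
        · simp [h]
        · have : α * |ζ.im| ≤ 0 := by linarith
          have : |ζ.im| ≤ 0 := by nlinarith [abs_nonneg ζ.im]
          simpa using this
      simp [this]
    have hgp := hgpos ζ h1 h2 h3 h4
    have hval : ‖E ζ * Complex.exp (-(g ζ))‖ ≤ 1 := by
      rw [norm_mul, Complex.norm_exp, Complex.neg_re, Real.exp_neg, ← div_eq_mul_inv,
        div_le_one (Real.exp_pos _)]
      by_cases hζT : ζ ∈ T
      · have hor : α * |ζ.im| = ζ.re - a ∨ α * |ζ.im| = b - ζ.re := by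
          by_contra! hne
          exact hζ.2 ⟨⟨lt_of_le_of_ne h1 hne.1, lt_of_le_of_ne h2 hne.2⟩, hζT⟩
        have him : ζ.im ≠ 0 := by
          intro h0
          rw [h0] at hor
          simp at hor
          rcases hor with h | h <;> linarith
        refine (hg ζ h1 h2 (hclT hζ.1) him).trans (Real.exp_le_exp.2 ?_)
        have e1 := hg1 ζ h1 h3
        have e2 := hg2 ζ h2 h4
        have p1 : 0 ≤ ‖ζ - a‖ ^ (-α) / 2 := by positivity
        have p2 : 0 ≤ ‖b - ζ‖ ^ (-α) / 2 := by positivity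
        rw [hgre]
        rcases hor with h | h
        · have := hside (ζ - a) (fun h => by
            have := congrArg Complex.re h; simp at this; linarith) (by simpa using h)
          simp only [Complex.sub_im, Complex.ofReal_im, sub_zero] at this
          refine this.trans ?_
          gcongr
          linarith
        · have := hside (b - ζ) (fun h => by
            have := congrArg Complex.re h; simp at this; linarith) (by simpa using h)
          simp only [Complex.sub_im, Complex.ofReal_im, zero_sub, abs_neg] at this
          refine this.trans ?_
          gcongr
          linarith
      · refine (hfr ζ h1 h2 ?_).trans (Real.one_le_exp hgp)
        rw [hT.frontier_eq]
        exact ⟨hclT hζ.1, hζT⟩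
    have hcont : ContinuousAt (fun z => ‖E z * Complex.exp (-(g z))‖) ζ :=
      ((hE ζ h1 h2).mul (hgd ζ h3 h4).neg.cexp).continuousAt.norm
    have := hcont.eventually (gt_mem_nhds (show ‖E ζ * Complex.exp (-(g ζ))‖ < 1 + η by linarith))
    exact (this.filter_mono nhdsWithin_le_nhds).mono fun z hz => hz.le
  · intro ζ hζ
    have hEc : DifferentiableAt ℂ E ζ := by
      simp only [Finset.mem_insert, Finset.mem_singleton] at hζ
      rcases hζ with rfl | rfl
      · exact hE _ (by simp) (by simp; linarith)
      · exact hE _ (by simp; linarith) (by simp)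
    refine ⟨‖E ζ‖ + 1, ?_⟩
    have := (hEc.continuousAt.norm).eventually (gt_mem_nhds (show ‖E ζ‖ < ‖E ζ‖ + 1 by linarith))
    filter_upwards [this.filter_mono nhdsWithin_le_nhds, self_mem_nhdsWithin] with z hz hzD
    obtain ⟨h3, h4⟩ := hDre z hzD
    have := hgpos z hzD.1.1.le hzD.1.2.le h3 h4
    rw [norm_mul, Complex.norm_exp, Complex.neg_re]
    have : Real.exp (-(g z).re) ≤ 1 := Real.exp_le_one_iff.2 (by linarith)
    calc _ ≤ ‖E z‖ * 1 := by gcongr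
      _ ≤ _ := by linarith
  · intro ζ hζ hζD
    obtain ⟨h3, h4⟩ := hDre ζ hζD
    simp only [Finset.mem_insert, Finset.mem_singleton] at hζ
    rcases hζ with rfl | rfl <;> simp at h3 h4

theorem neg_abs_im_le_re_of_abs_arg_le {z : ℂ} (h : |z.arg| ≤ 3 * Real.pi / 4) :
    -|z.im| ≤ z.re := by
  have hpi := Real.pi_pos
  rcases le_total |z.arg| (Real.pi / 2) with h1 | h1
  · have := Complex.abs_arg_le_pi_div_two_iff.1 h1
    linarith [abs_nonneg z.im]
  · have e1 : Real.cos (3 * Real.pi / 4) ≤ Real.cos |z.arg| :=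
      Real.cos_le_cos_of_nonneg_of_le_pi (abs_nonneg _) (by linarith) h
    have e2 : Real.cos (Real.pi / 4) ≤ Real.cos (|z.arg| - Real.pi / 2) :=
      Real.cos_le_cos_of_nonneg_of_le_pi (by linarith) (by linarith) (by linarith)
    rw [Real.cos_sub_pi_div_two] at e2
    rw [show 3 * Real.pi / 4 = Real.pi - Real.pi / 4 by ring, Real.cos_pi_sub, Real.cos_abs] at e1
    have e3 : Real.sin |z.arg| ≤ |Real.sin z.arg| := by
      rcases abs_choice z.arg with h | h <;> rw [h]
      · exact le_abs_self _
      · rw [Real.sin_neg]; exact neg_le_abs _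
    have r1 := Complex.norm_mul_cos_arg z
    have r2 := Complex.norm_mul_sin_arg z
    rw [← r1, ← r2, abs_mul, abs_norm]
    have := norm_nonneg z
    nlinarith

/-- For a function holomorphic across `(0, δ)`, growth measured by the distance to the real axis is
growth measured by the distance to `0`. The set `T` is the plane or the upper half-plane; its frontier
must be harmless. -/
theorem norm_le_exp_norm_rpow_of_growth {E : ℂ → ℂ} {α δ : ℝ} (hα : 1 ≤ α) (hδ : 0 < δ)
    {T : Set ℂ} (hT : IsOpen T)
    (hE : ∀ z : ℂ, (z.im ≠ 0 ∨ (0 < z.re ∧ z.re < δ)) → DifferentiableAt ℂ E z)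
    (hfr : ∀ z ∈ frontier T, 0 < z.re → z.re < δ → ‖E z‖ ≤ 1)
    (hg : ∀ ε > 0, ∃ ρ > 0, ∀ z ∈ closure T, z.im ≠ 0 → ‖z‖ < ρ →
      ‖E z‖ ≤ Real.exp (ε * |z.im| ^ (-α))) :
    ∀ ε > 0, ∃ ρ > 0, ∀ z ∈ T, z ≠ 0 → |z.arg| ≤ 3 * Real.pi / 4 → ‖z‖ < ρ →
      ‖E z‖ ≤ Real.exp (ε * ‖z‖ ^ (-α)) := by
  intro ε hε
  have hα0 : 0 < α := by linarith
  set K : ℝ := 4 * (α + 1) ^ α * 4 ^ α + (2 * α + 1) ^ α with hK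
  have hK1 : 0 < 4 * (α + 1) ^ α * (4 : ℝ) ^ α := by positivity
  have hK2 : 0 < (2 * α + 1) ^ α := by positivity
  have hK0 : 0 < K := by positivity
  obtain ⟨ρ, hρ, h⟩ := hg (ε / K) (by positivity)
  refine ⟨min (ρ / 4) (δ / 4), by positivity, fun z hzT hz0 hzarg hzρ => ?_⟩
  have hzρ1 := hzρ.trans_le (min_le_left _ _)
  have hzρ2 := hzρ.trans_le (min_le_right _ _)
  have hre := neg_abs_im_le_re_of_abs_arg_le hzarg
  have hnz : 0 < ‖z‖ := norm_pos_iff.2 hz0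
  have hnorm := Complex.norm_le_abs_re_add_abs_im z
  have hpow : 0 < ‖z‖ ^ (-α) := by positivity
  -- near the real axis the rhombus with diagonal `[Re z / 2, 3 Re z / 2]` is used; elsewhere
  -- `|z|` and `|Im z|` are comparable
  by_cases hcase : α * |z.im| < z.re / 2
  · have hx : 0 < z.re := by
      have : 0 ≤ α * |z.im| := by positivity
      linarith
    have hxn : z.re ≤ ‖z‖ := Complex.re_le_norm z
    have hgeom : ∀ w : ℂ, α * |w.im| ≤ w.re - z.re / 2 → α * |w.im| ≤ 3 * z.re / 2 - w.re →
        0 < w.re ∧ w.re < δ ∧ ‖w‖ < ρ := by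
      intro w h1 h2
      have h3 : 0 ≤ α * |w.im| := by positivity
      have h4 : |w.im| ≤ α * |w.im| := le_mul_of_one_le_left (abs_nonneg _) hα
      have h5 : 0 < w.re := by linarith
      refine ⟨h5, by linarith, ?_⟩
      refine (Complex.norm_le_abs_re_add_abs_im w).trans_lt ?_
      rw [abs_of_pos h5]
      linarith
    have key := norm_le_of_growth_on_rhombus (E := E) hα (show 0 ≤ ε / K by positivity)
      (a := z.re / 2) (b := 3 * z.re / 2) (by linarith) hT
      (fun w h1 h2 => hE w (Or.inr ⟨(hgeom w h1 h2).1, (hgeom w h1 h2).2.1⟩))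
      (fun w h1 h2 hw => hfr w hw (hgeom w h1 h2).1 (hgeom w h1 h2).2.1)
      (fun w h1 h2 hw hw0 => h w hw hw0 (hgeom w h1 h2).2.2) z hzT (by linarith) (by linarith)
    refine key.trans (Real.exp_le_exp.2 ?_)
    have hzn : ‖z‖ ≤ 2 * z.re := by
      rw [abs_of_pos hx] at hnorm
      have : |z.im| ≤ α * |z.im| := le_mul_of_one_le_left (abs_nonneg _) hα
      linarith
    have hb : ∀ q : ℂ, z.re / 2 ≤ q.re → ‖q‖ ^ (-α) ≤ 4 ^ α * ‖z‖ ^ (-α) := by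
      intro q hq
      have h1 : ‖z‖ / 4 ≤ ‖q‖ := by
        have := Complex.re_le_norm q
        linarith
      calc ‖q‖ ^ (-α) ≤ (‖z‖ / 4) ^ (-α) :=
            Real.rpow_le_rpow_of_nonpos (by positivity) h1 (by linarith)
        _ = 4 ^ α * ‖z‖ ^ (-α) := by
            rw [Real.div_rpow hnz.le (by norm_num), Real.rpow_neg (by norm_num : (0:ℝ) ≤ 4)]
            field_simp
    have b1 := hb (z - (z.re / 2 : ℝ)) (by simp; linarith)
    have b2 := hb ((3 * z.re / 2 : ℝ) - z) (by simp; linarith)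
    calc 2 * (α + 1) ^ α * (ε / K) * (‖z - (z.re / 2 : ℝ)‖ ^ (-α) + ‖(3 * z.re / 2 : ℝ) - z‖ ^ (-α))
        ≤ 2 * (α + 1) ^ α * (ε / K) * (4 ^ α * ‖z‖ ^ (-α) + 4 ^ α * ‖z‖ ^ (-α)) := by gcongr
      _ = (ε / K) * (4 * (α + 1) ^ α * 4 ^ α) * ‖z‖ ^ (-α) := by ring
      _ ≤ (ε / K) * K * ‖z‖ ^ (-α) := by gcongr; linarith
      _ = ε * ‖z‖ ^ (-α) := by field_simp
  · have hn : ‖z‖ ≤ (2 * α + 1) * |z.im| := by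
      have : |z.re| ≤ 2 * α * |z.im| := by
        rw [abs_le]
        have : |z.im| ≤ α * |z.im| := le_mul_of_one_le_left (abs_nonneg _) hα
        constructor <;> nlinarith [abs_nonneg z.im]
      linarith
    have him : 0 < |z.im| := by
      by_contra! h0
      have : |z.im| = 0 := le_antisymm h0 (abs_nonneg _)
      rw [this, mul_zero] at hn
      linarith
    refine (h z (subset_closure hzT) (abs_pos.1 him) (by linarith)).trans (Real.exp_le_exp.2 ?_)
    have h2 : ((2 * α + 1) * |z.im|) ^ (-α) ≤ ‖z‖ ^ (-α) :=
      Real.rpow_le_rpow_of_nonpos hnz hn (by linarith)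
    rw [Real.mul_rpow (by linarith) him.le, Real.rpow_neg (by linarith)] at h2
    have h3 : |z.im| ^ (-α) ≤ (2 * α + 1) ^ α * ‖z‖ ^ (-α) := by
      rwa [inv_mul_le_iff₀ hK2] at h2
    calc ε / K * |z.im| ^ (-α) ≤ ε / K * ((2 * α + 1) ^ α * ‖z‖ ^ (-α)) := by gcongr
      _ ≤ ε / K * (K * ‖z‖ ^ (-α)) := by gcongr; linarith
      _ = ε * ‖z‖ ^ (-α) := by field_simp

/-! ### Phragmén–Lindelöf principles in a half-plane and in a quadrant -/

/-- Zero exponential type and `o(|w|)` on the boundary give `o(|w|)` in the half-plane, by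
`norm_le_of_zero_exponential_type` for `f w / (w + K)`. -/
theorem exists_norm_le_mul_norm_add {f : ℂ → ℂ} {R : ℝ}
    (hf : ∀ w : ℂ, 0 ≤ w.re → R ≤ ‖w‖ → DifferentiableAt ℂ f w)
    (hb : ∀ ε > 0, ∃ R', ∀ w : ℂ, w.re = 0 → R' ≤ ‖w‖ → ‖f w‖ ≤ ε * ‖w‖)
    (hg : ∀ ε > 0, ∃ R', ∀ w : ℂ, 0 < w.re → R' ≤ ‖w‖ → ‖f w‖ ≤ Real.exp (ε * ‖w‖)) :
    ∀ ε > 0, ∃ K, ∀ w : ℂ, 0 ≤ w.re → R ≤ ‖w‖ → ‖f w‖ ≤ ε * (‖w‖ + K) := by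
  intro ε hε
  obtain ⟨R', hR'⟩ := hb (ε / 2) (by positivity)
  set R₁ := max R R'
  have hcpt : IsCompact ({w : ℂ | 0 ≤ w.re ∧ R ≤ ‖w‖} ∩ Metric.closedBall 0 R₁) :=
    (isCompact_closedBall _ _).inter_left ((isClosed_le continuous_const Complex.continuous_re).inter
      (isClosed_le continuous_const continuous_norm))
  obtain ⟨B, hB⟩ := hcpt.exists_bound_of_continuousOn (f := f) fun w hw =>
    (hf w hw.1.1 hw.1.2).continuousAt.continuousWithinAt
  set B' := max B 0
  have hB' : ∀ w : ℂ, 0 ≤ w.re → R ≤ ‖w‖ → ‖w‖ ≤ R₁ → ‖f w‖ ≤ B' := fun w h1 h2 h3 =>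
    (hB w ⟨⟨h1, h2⟩, by simpa using h3⟩).trans (le_max_left _ _)
  have hB'0 : 0 ≤ B' := le_max_right _ _
  set K : ℝ := B' / (ε / 2) + 1 with hK
  have hK1 : 1 ≤ K := by
    have : 0 ≤ B' / (ε / 2) := by positivity
    linarith
  have hKB : B' ≤ ε / 2 * K := by
    rw [hK, mul_add, mul_div_cancel₀ _ (by positivity)]; linarith
  have hwK : ∀ w : ℂ, 0 ≤ w.re → ‖w‖ ≤ ‖w + K‖ ∧ K ≤ ‖w + K‖ := by
    intro w hw
    constructor
    · rw [← sq_le_sq₀ (norm_nonneg _) (norm_nonneg _), Complex.sq_norm, Complex.sq_norm,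
        Complex.normSq_apply, Complex.normSq_apply]
      simp; nlinarith
    · have := Complex.re_le_norm (w + K)
      simp at this; linarith
  have hne : ∀ w : ℂ, 0 ≤ w.re → w + K ≠ 0 := fun w hw => by
    rw [← norm_pos_iff]; linarith [(hwK w hw).2]
  have hbound : ∀ w : ℂ, 0 ≤ w.re → ‖f w‖ ≤ ε / 2 * ‖w‖ + B' → ‖f w / (w + K)‖ ≤ ε := by
    intro w hw h
    obtain ⟨h1, h2⟩ := hwK w hw
    rw [norm_div, div_le_iff₀ (norm_pos_iff.2 (hne w hw))]
    nlinarith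
  have hd : ∀ w : ℂ, 0 ≤ w.re → R ≤ ‖w‖ → DifferentiableAt ℂ (fun w => f w / (w + K)) w :=
    fun w h1 h2 => (hf w h1 h2).div (by fun_prop) (hne w h1)
  have key := norm_le_of_zero_exponential_type (f := fun w => f w / (w + K)) (R := R) hε
    (fun w hw => (hd w hw.1.le hw.2.le).differentiableWithinAt)
    (fun w hw => (hd w hw.1 hw.2).continuousAt.continuousWithinAt)
    (fun w h1 h2 => by
      refine hbound w h1.ge ?_
      rcases le_total ‖w‖ R₁ with h3 | h3
      · have := hB' w h1.ge h2 h3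
        have : 0 ≤ ε / 2 * ‖w‖ := by positivity
        linarith
      · have := hR' w h1 ((le_max_right _ _).trans h3)
        linarith)
    (fun w h1 h2 => by
      refine hbound w h1 ?_
      have := hB' w h1 h2.ge (h2.le.trans (le_max_left _ _))
      have : 0 ≤ ε / 2 * ‖w‖ := by positivity
      linarith)
    (fun η hη => by
      obtain ⟨R₂, hR₂⟩ := hg η hη
      refine ⟨R₂, fun w h1 h2 => ?_⟩
      rw [norm_div]
      exact (div_le_self (norm_nonneg _) (hK1.trans (hwK w h1.le).2)).trans (hR₂ w h1 h2))
  refine ⟨K, fun w h1 h2 => ?_⟩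
  have hle : ‖f w / (w + K)‖ ≤ ε := by
    rcases h1.eq_or_lt with h1 | h1
    · refine hbound w h1.le ?_
      rcases le_total ‖w‖ R₁ with h3 | h3
      · have := hB' w h1.le h2 h3
        have : 0 ≤ ε / 2 * ‖w‖ := by positivity
        linarith
      · have := hR' w h1.symm ((le_max_right _ _).trans h3)
        linarith
    · rcases h2.eq_or_lt with h2 | h2
      · refine hbound w h1.le ?_
        have := hB' w h1.le h2.le (h2.ge.trans (le_max_left _ _))
        have : 0 ≤ ε / 2 * ‖w‖ := by positivity
        linarith
      · exact key w h1 h2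
  rw [norm_div, div_le_iff₀ (norm_pos_iff.2 (hne w h1))] at hle
  refine hle.trans ?_
  have : ‖w + K‖ ≤ ‖w‖ + K := by
    refine (norm_add_le _ _).trans ?_
    rw [Complex.norm_real, Real.norm_of_nonneg (by linarith)]
  gcongr

/-- A derivative which is `o(|w|)` in the fourth quadrant gives `o(|w| ^ 2)` there, by integration
from the nearer one of the two sides. -/
theorem abs_re_le_mul_sq_of_deriv {χ : ℂ → ℂ} {R : ℝ}
    (hχ : ∀ w : ℂ, 0 ≤ w.re → R ≤ ‖w‖ → DifferentiableAt ℂ χ w)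
    (h1 : ∀ t : ℝ, R ≤ t → (χ t).re = 0)
    (h2 : ∀ w : ℂ, w.re = 0 → w.im < 0 → R ≤ ‖w‖ → |(χ w).re| ≤ 1)
    (hd : ∀ ε > 0, ∃ K, ∀ w : ℂ, 0 ≤ w.re → R ≤ ‖w‖ → ‖deriv χ w‖ ≤ ε * (‖w‖ + K)) :
    ∀ ε > 0, ∃ R', ∀ w : ℂ, 0 < w.re → w.im < 0 → R' ≤ ‖w‖ → |(χ w).re| ≤ ε * ‖w‖ ^ 2 := by
  intro ε hε
  obtain ⟨K, hK⟩ := hd (ε / 2) (by positivity)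
  -- variation of `χ` along a segment staying outside the disc of radius `R`
  have hseg : ∀ w v : ℂ, (∀ s ∈ segment ℝ v w, 0 ≤ s.re ∧ R ≤ ‖s‖ ∧ ‖s‖ ≤ ‖w‖) → ‖w - v‖ ≤ ‖w‖ →
      |(χ w).re| ≤ |(χ v).re| + ε / 2 * (‖w‖ + K) * ‖w‖ := by
    intro w v hs hwv
    have := (convex_segment (𝕜 := ℝ) v w).norm_image_sub_le_of_norm_deriv_le (f := χ)
      (C := ε / 2 * (‖w‖ + K)) (fun s hs' => hχ s (hs s hs').1 (hs s hs').2.1)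
      (fun s hs' => (hK s (hs s hs').1 (hs s hs').2.1).trans (by
        gcongr; exact (hs s hs').2.2)) (left_mem_segment ℝ v w) (right_mem_segment ℝ v w)
    have hwm := hs w (right_mem_segment ℝ v w)
    have hpos : 0 ≤ ε / 2 * (‖w‖ + K) := (norm_nonneg _).trans (hK w hwm.1 hwm.2.1)
    have h3 := Complex.abs_re_le_norm (χ w - χ v)
    rw [Complex.sub_re] at h3
    have h4 : |(χ w).re| ≤ |(χ v).re| + |(χ w).re - (χ v).re| := by
      have := abs_add_le (χ v).re ((χ w).re - (χ v).re)
      simpa using this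
    have h5 : ε / 2 * (‖w‖ + K) * ‖w - v‖ ≤ ε / 2 * (‖w‖ + K) * ‖w‖ := by gcongr
    linarith
  obtain ⟨R₁, hR₁⟩ : ∃ R₁ : ℝ, ∀ t ≥ R₁, 1 + ε / 2 * (t + K) * t ≤ ε * t ^ 2 := by
    refine ⟨max 1 (K + 2 / ε), fun t ht => ?_⟩
    have a1 : 1 ≤ t := (le_max_left _ _).trans ht
    have a2 : K + 2 / ε ≤ t := (le_max_right _ _).trans ht
    have a3 : ε / 2 * (t - K) * t ≥ 1 := by
      have : 1 ≤ ε / 2 * (t - K) := by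
        calc (1 : ℝ) = ε / 2 * (2 / ε) := by field_simp
          _ ≤ _ := by gcongr; linarith
      nlinarith
    nlinarith
  refine ⟨max (2 * R) R₁, fun w hw1 hw2 hw3 => ?_⟩
  have hw4 : 2 * R ≤ ‖w‖ := (le_max_left _ _).trans hw3
  have hnorm := Complex.norm_le_abs_re_add_abs_im w
  rw [abs_of_pos hw1, abs_of_neg hw2] at hnorm
  have hmono : ∀ s : ℂ, |s.re| ≤ |w.re| → |s.im| ≤ |w.im| → ‖s‖ ≤ ‖w‖ := by
    intro s e1 e2
    rw [← sq_le_sq₀ (norm_nonneg _) (norm_nonneg _), Complex.sq_norm, Complex.sq_norm,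
        Complex.normSq_apply, Complex.normSq_apply]
    nlinarith [sq_le_sq.2 e1, sq_le_sq.2 e2]
  refine le_trans ?_ (hR₁ ‖w‖ ((le_max_right _ _).trans hw3))
  have hsegcoord : ∀ v s : ℂ, s ∈ segment ℝ v w → ∃ t ∈ Set.Icc (0 : ℝ) 1,
      s.re = v.re + t * (w.re - v.re) ∧ s.im = v.im + t * (w.im - v.im) := by
    intro v s hs
    rw [segment_eq_image'] at hs
    obtain ⟨t, ht, rfl⟩ := hs
    exact ⟨t, ht, by simp, by simp⟩
  rcases le_total (-w.im) w.re with hc | hc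
  · have := hseg w (w.re : ℂ) ?_ ?_
    · rw [h1 w.re (by linarith), abs_zero] at this
      linarith
    · intro s hs
      obtain ⟨t, ⟨ht0, ht1⟩, e1, e2⟩ := hsegcoord _ s hs
      simp only [Complex.ofReal_re, Complex.ofReal_im, sub_self, mul_zero, add_zero, zero_add,
        sub_zero] at e1 e2
      refine ⟨by rw [e1]; exact hw1.le, ?_, hmono s (by rw [e1]) ?_⟩
      · have := Complex.re_le_norm s
        rw [e1] at this; linarith
      · rw [e2, abs_mul, abs_of_nonneg ht0]
        exact mul_le_of_le_one_left (abs_nonneg _) ht1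
    · refine hmono _ ?_ ?_ <;> simp
  · have := hseg w (w.im * Complex.I) ?_ ?_
    · have h6 := h2 (w.im * Complex.I) (by simp) (by simpa) (by
        simp only [norm_mul, Complex.norm_real, Complex.norm_I, mul_one, Real.norm_eq_abs]
        rw [abs_of_neg hw2]; linarith)
      linarith
    · intro s hs
      obtain ⟨t, ⟨ht0, ht1⟩, e1, e2⟩ := hsegcoord _ s hs
      simp only [Complex.re_ofReal_mul, Complex.im_ofReal_mul, Complex.I_re, Complex.I_im, mul_one,
        sub_self, mul_zero, add_zero, zero_add, sub_zero] at e1 e2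
      refine ⟨by rw [e1]; positivity, ?_, hmono s ?_ (by rw [e2])⟩
      · have := Complex.abs_im_le_norm s
        rw [e2, abs_of_neg hw2] at this; linarith
      · rw [e1, abs_mul, abs_of_nonneg ht0]
        exact mul_le_of_le_one_left (abs_nonneg _) ht1
    · refine hmono _ ?_ ?_ <;> simp

/-- The branch of `s ↦ √(-i s)` mapping the right half-plane onto the fourth quadrant. -/
noncomputable def quadrantRoot (s : ℂ) : ℂ :=
  Complex.exp (-(Real.pi / 4 : ℝ) * Complex.I) * s ^ ((1 / 2 : ℝ) : ℂ)

theorem quadrantRoot_polar {s : ℂ} (hs : s ≠ 0) :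
    (quadrantRoot s).re = ‖s‖ ^ (1 / 2 : ℝ) * Real.cos (s.arg / 2 - Real.pi / 4) ∧
    (quadrantRoot s).im = ‖s‖ ^ (1 / 2 : ℝ) * Real.sin (s.arg / 2 - Real.pi / 4) ∧
    ‖quadrantRoot s‖ ^ 2 = ‖s‖ := by
  have e : (-(Real.pi / 4 : ℝ) * Complex.I : ℂ) = ((-(Real.pi / 4) : ℝ) : ℂ) * Complex.I := by
    push_cast; ring
  refine ⟨?_, ?_, ?_⟩
  · rw [quadrantRoot, e, Complex.mul_re, Complex.exp_ofReal_mul_I_re, Complex.exp_ofReal_mul_I_im,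
      re_cpow_ofReal hs, im_cpow_ofReal hs,
      show s.arg / 2 - Real.pi / 4 = -(Real.pi / 4) + 1 / 2 * s.arg by ring, Real.cos_add]
    ring
  · rw [quadrantRoot, e, Complex.mul_im, Complex.exp_ofReal_mul_I_re, Complex.exp_ofReal_mul_I_im,
      re_cpow_ofReal hs, im_cpow_ofReal hs,
      show s.arg / 2 - Real.pi / 4 = -(Real.pi / 4) + 1 / 2 * s.arg by ring, Real.sin_add]
    ring
  · rw [quadrantRoot, norm_mul, e, Complex.norm_exp_ofReal_mul_I, one_mul, Complex.norm_cpow_real,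
      ← Real.sqrt_eq_rpow, Real.sq_sqrt (norm_nonneg _)]

theorem quadrantRoot_mul_sq {w : ℂ} (h1 : 0 < w.re) (h2 : w.im < 0) :
    quadrantRoot (Complex.I * w ^ 2) = w := by
  have hw : w ≠ 0 := fun h => by simp [h] at h1
  have hs : Complex.I * w ^ 2 ≠ 0 := by simp [hw]
  obtain ⟨hre, him, -⟩ := quadrantRoot_polar hs
  set s := Complex.I * w ^ 2 with hsdef
  have hsre : 0 < s.re := by
    simp [hsdef, pow_two]; nlinarith
  have harg := abs_lt.1 (Complex.abs_arg_lt_pi_div_two_iff.2 (Or.inl hsre))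
  have hpos : 0 < (quadrantRoot s).re := by
    rw [hre]
    refine mul_pos (by positivity) (Real.cos_pos_of_mem_Ioo ⟨?_, ?_⟩) <;>
      linarith [harg.1, harg.2, Real.pi_pos]
  have hsq : quadrantRoot s ^ 2 = w ^ 2 := by
    have e1 : (s ^ ((1 / 2 : ℝ) : ℂ)) ^ 2 = s := by
      rw [← Complex.cpow_nat_mul]
      norm_num
    rw [quadrantRoot, mul_pow, e1, ← Complex.exp_nat_mul]
    have : ((2 : ℕ) : ℂ) * (-(Real.pi / 4 : ℝ) * Complex.I) = -(Real.pi / 2 * Complex.I) := by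
      push_cast; ring
    rw [this, Complex.exp_neg, Complex.exp_pi_div_two_mul_I, hsdef]
    field_simp
  rcases sq_eq_sq_iff_eq_or_eq_neg.1 hsq with h | h
  · exact h
  · rw [h, Complex.neg_re] at hpos; linarith

/-- A Phragmén–Lindelöf principle of critical order in the fourth quadrant, carried over from the
half-plane by `s = i w ^ 2`. -/
theorem exists_re_le_of_quadrant {χ : ℂ → ℂ} {R : ℝ} (hR : 0 < R)
    (hχ : ∀ w : ℂ, 0 ≤ w.re → R ≤ ‖w‖ → DifferentiableAt ℂ χ w)
    (h1 : ∀ t : ℝ, R ≤ t → (χ t).re ≤ 1)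
    (h2 : ∀ w : ℂ, w.re = 0 → w.im < 0 → R ≤ ‖w‖ → (χ w).re ≤ 1)
    (hg : ∀ ε > 0, ∃ R', ∀ w : ℂ, 0 < w.re → w.im < 0 → R' ≤ ‖w‖ → (χ w).re ≤ ε * ‖w‖ ^ 2) :
    ∃ C, ∀ w : ℂ, 0 < w.re → w.im < 0 → R < ‖w‖ → (χ w).re ≤ C := by
  have hpi := Real.pi_pos
  have hdom : ∀ s : ℂ, 0 ≤ s.re → R ^ 2 ≤ ‖s‖ →
      s ≠ 0 ∧ 0 ≤ (quadrantRoot s).re ∧ R ≤ ‖quadrantRoot s‖ := by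
    intro s hs1 hs2
    have hs0 : s ≠ 0 := by
      rw [← norm_pos_iff]; exact lt_of_lt_of_le (by positivity) hs2
    obtain ⟨hre, him, hn⟩ := quadrantRoot_polar hs0
    refine ⟨hs0, ?_, ?_⟩
    · have harg := abs_le.1 (Complex.abs_arg_le_pi_div_two_iff.2 hs1)
      rw [hre]
      exact mul_nonneg (by positivity)
        (Real.cos_nonneg_of_mem_Icc ⟨by linarith [harg.1], by linarith [harg.2]⟩)
    · rw [← hn] at hs2
      exact (sq_le_sq₀ hR.le (norm_nonneg _)).1 hs2
  have hroot : ∀ s : ℂ, 0 ≤ s.re → s ≠ 0 → DifferentiableAt ℂ quadrantRoot s := by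
    intro s hs hs0
    have : s ∈ Complex.slitPlane := by
      rw [Complex.mem_slitPlane_iff]
      rcases hs.lt_or_eq with h | h
      · exact Or.inl h
      · exact Or.inr fun h' => hs0 (Complex.ext h.symm h')
    exact (DifferentiableAt.cpow (f := fun s : ℂ => s) (by fun_prop) (by fun_prop) this).const_mul _
  set f : ℂ → ℂ := fun s => Complex.exp (χ (quadrantRoot s)) with hf
  have hfd : ∀ s : ℂ, 0 ≤ s.re → R ^ 2 ≤ ‖s‖ → DifferentiableAt ℂ f s := by
    intro s hs1 hs2
    obtain ⟨hs0, h3, h4⟩ := hdom s hs1 hs2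
    exact (DifferentiableAt.comp s (hχ _ h3 h4) (hroot s hs1 hs0)).cexp
  have hcpt : IsCompact ({s : ℂ | 0 ≤ s.re} ∩ Metric.sphere 0 (R ^ 2)) :=
    (isCompact_sphere _ _).inter_left (isClosed_le continuous_const Complex.continuous_re)
  obtain ⟨B, hB⟩ := hcpt.exists_bound_of_continuousOn (f := f) fun s hs =>
    (hfd s hs.1 (by have := hs.2; simp at this; exact this.ge)).continuousAt.continuousWithinAt
  set C := max B (Real.exp 1) with hC
  have hC0 : 0 < C := lt_of_lt_of_le (Real.exp_pos 1) (le_max_right _ _)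
  have key := norm_le_of_zero_exponential_type (f := f) (R := R ^ 2) hC0
    (fun s hs => (hfd s hs.1.le hs.2.le).differentiableWithinAt)
    (fun s hs => (hfd s hs.1 hs.2).continuousAt.continuousWithinAt) ?_
    (fun s h3 h4 => (hB s ⟨h3, by simpa using h4⟩).trans (le_max_left _ _)) ?_
  · refine ⟨Real.log C, fun w hw1 hw2 hw3 => ?_⟩
    have hsre : 0 < (Complex.I * w ^ 2).re := by
      simp [pow_two]; nlinarith
    have := key (Complex.I * w ^ 2) hsre (by
      rw [norm_mul, Complex.norm_I, one_mul, norm_pow]; gcongr)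
    simp only [hf] at this
    rw [quadrantRoot_mul_sq hw1 hw2, Complex.norm_exp] at this
    exact (Real.le_log_iff_exp_le hC0).2 this
  · intro s hs1 hs2
    obtain ⟨hs0, h3, h4⟩ := hdom s hs1.ge hs2
    obtain ⟨hre, him, hn⟩ := quadrantRoot_polar hs0
    refine le_trans ?_ (le_max_right _ _)
    rw [hf, Complex.norm_exp]
    refine Real.exp_le_exp.2 ?_
    have hspos : 0 < ‖s‖ ^ (1 / 2 : ℝ) := by have := norm_pos_iff.2 hs0; positivity
    have hsim : s.im ≠ 0 := fun h => hs0 (Complex.ext hs1 h)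
    rcases lt_or_gt_of_ne hsim with h | h
    · have harg : s.arg = -(Real.pi / 2) := Complex.arg_eq_neg_pi_div_two_iff.2 ⟨hs1, h⟩
      refine h2 _ ?_ ?_ h4
      · rw [hre, harg, show -(Real.pi / 2) / 2 - Real.pi / 4 = -(Real.pi / 2) by ring, Real.cos_neg,
          Real.cos_pi_div_two, mul_zero]
      · rw [him, harg, show -(Real.pi / 2) / 2 - Real.pi / 4 = -(Real.pi / 2) by ring, Real.sin_neg,
          Real.sin_pi_div_two]
        linarith
    · have harg : s.arg = Real.pi / 2 := Complex.arg_eq_pi_div_two_iff.2 ⟨hs1, h⟩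
      have him0 : (quadrantRoot s).im = 0 := by
        rw [him, harg, show Real.pi / 2 / 2 - Real.pi / 4 = 0 by ring, Real.sin_zero, mul_zero]
      have e : quadrantRoot s = ((quadrantRoot s).re : ℂ) := Complex.ext (by simp) (by simp [him0])
      rw [e]
      refine h1 _ ?_
      rw [e, Complex.norm_real, Real.norm_of_nonneg h3] at h4
      exact h4
  · intro ε hε
    obtain ⟨R', hR'⟩ := hg ε hε
    refine ⟨max (R ^ 2) (R' ^ 2), fun s hs1 hs2 => ?_⟩
    obtain ⟨hs0, h3, h4⟩ := hdom s hs1.le ((le_max_left _ _).trans hs2)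
    obtain ⟨hre, him, hn⟩ := quadrantRoot_polar hs0
    have hspos : 0 < ‖s‖ ^ (1 / 2 : ℝ) := by have := norm_pos_iff.2 hs0; positivity
    have harg := abs_lt.1 (Complex.abs_arg_lt_pi_div_two_iff.2 (Or.inl hs1))
    rw [hf, Complex.norm_exp, ← hn]
    refine Real.exp_le_exp.2 (hR' _ ?_ ?_ ?_)
    · rw [hre]
      refine mul_pos hspos (Real.cos_pos_of_mem_Ioo ⟨?_, ?_⟩) <;> linarith [harg.1, harg.2]
    · rw [him]
      refine mul_neg_of_pos_of_neg hspos (Real.sin_neg_of_neg_of_neg_pi_lt ?_ ?_) <;>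
        linarith [harg.1, harg.2]
    · have : R' ^ 2 ≤ ‖quadrantRoot s‖ ^ 2 := by rw [hn]; exact (le_max_right _ _).trans hs2
      exact (le_abs_self _).trans (abs_le_of_sq_le_sq this (norm_nonneg _))

/-! ### Corners in the coordinate `w = z ^ (-α)` -/

theorem arg_cpow_ofReal {w : ℂ} (hw : w ≠ 0) {r : ℝ} (h1 : -Real.pi < r * w.arg)
    (h2 : r * w.arg ≤ Real.pi) : (w ^ (r : ℂ)).arg = r * w.arg := by
  have e : (Complex.log w * r).im = r * w.arg := by
    rw [Complex.im_mul_ofReal, Complex.log_im, mul_comm]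
  rw [← Complex.log_im, Complex.cpow_def_of_ne_zero hw, Complex.log_exp (by rw [e]; exact h1)
    (by rw [e]; exact h2), e]

/-- The principal branch of `w ↦ w ^ (-1 / α)`, the inverse of `z ↦ z ^ (-α)` near the positive axis.
It exchanges `0` and `∞`, and the upper and lower half-planes near the positive axis. -/
noncomputable def invRoot (α : ℝ) (w : ℂ) : ℂ := w ^ ((-(1 / α) : ℝ) : ℂ)

theorem norm_invRoot (α : ℝ) (w : ℂ) : ‖invRoot α w‖ = ‖w‖ ^ (-(1 / α)) :=
  Complex.norm_cpow_real _ _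

theorem norm_invRoot_rpow {α : ℝ} (hα : 1 ≤ α) (w : ℂ) : ‖invRoot α w‖ ^ (-α) = ‖w‖ := by
  have : α ≠ 0 := by linarith
  rw [norm_invRoot, ← Real.rpow_mul (norm_nonneg _)]
  rw [show -(1 / α) * -α = 1 by field_simp, Real.rpow_one]

theorem arg_invRoot {α : ℝ} (hα : 1 ≤ α) {w : ℂ} (hw : w ∈ Complex.slitPlane) :
    (invRoot α w).arg = -(1 / α) * w.arg := by
  have hα0 : 0 < α := by linarith
  have h1 : w.arg < Real.pi :=
    lt_of_le_of_ne (Complex.arg_le_pi w) (Complex.mem_slitPlane_iff_arg.1 hw).1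
  have h2 := Complex.neg_pi_lt_arg w
  have h3 : 1 / α ≤ 1 := by rw [div_le_one hα0]; exact hα
  have h4 : 0 < 1 / α := by positivity
  have h5 := Real.pi_pos
  refine arg_cpow_ofReal (Complex.slitPlane_ne_zero hw) ?_ ?_
  · have : 1 / α * w.arg < 1 / α * Real.pi := by gcongr
    nlinarith
  · have : 1 / α * -Real.pi ≤ 1 / α * w.arg := by gcongr
    nlinarith

theorem invRoot_ne_zero (α : ℝ) {w : ℂ} (hw : w ≠ 0) : invRoot α w ≠ 0 := by
  rw [← norm_pos_iff, norm_invRoot]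
  have := norm_pos_iff.2 hw
  positivity

theorem exists_norm_invRoot_lt {α : ℝ} (hα : 1 ≤ α) {ρ : ℝ} (hρ : 0 < ρ) :
    ∃ R > 0, ∀ w : ℂ, R ≤ ‖w‖ → ‖invRoot α w‖ < ρ := by
  have hα0 : 0 < 1 / α := by positivity
  have h := (tendsto_rpow_neg_atTop hα0).eventually (gt_mem_nhds hρ)
  obtain ⟨R, hR⟩ := eventually_atTop.1 h
  refine ⟨max R 1, by positivity, fun w hw => ?_⟩
  rw [norm_invRoot]
  exact hR _ ((le_max_left _ _).trans hw)

/-- Small values of `invRoot α` lie in the domain of a function reflected across `(0, δ)`. -/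
theorem invRoot_mem_domain {α δ : ℝ} (hα : 1 ≤ α) {w : ℂ} (hw : w ∈ Complex.slitPlane)
    (h : ‖invRoot α w‖ < δ) :
    (invRoot α w).im ≠ 0 ∨ (0 < (invRoot α w).re ∧ (invRoot α w).re < δ) := by
  by_cases him : (invRoot α w).im = 0
  · right
    refine ⟨?_, (Complex.re_le_norm _).trans_lt h⟩
    have hne := invRoot_ne_zero α (Complex.slitPlane_ne_zero hw)
    by_contra! hle
    have hlt : (invRoot α w).re < 0 := lt_of_le_of_ne hle fun h0 => hne (Complex.ext h0 him)
    have harg := Complex.arg_eq_pi_iff.2 ⟨hlt, him⟩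
    rw [arg_invRoot hα hw] at harg
    have h1 := Complex.neg_pi_lt_arg w
    have h3 : 1 / α ≤ 1 := by rw [div_le_one (by linarith)]; exact hα
    have h4 : 0 < 1 / α := by positivity
    have : 1 / α * -Real.pi < 1 / α * w.arg := by gcongr
    nlinarith [Real.pi_pos]
  · exact Or.inl him

theorem hasDerivAt_invRoot (α : ℝ) {w : ℂ} (hw : w ∈ Complex.slitPlane) :
    HasDerivAt (invRoot α)
      (((-(1 / α) : ℝ) : ℂ) * w ^ ((-(1 / α) - 1 : ℝ) : ℂ)) w := by
  have := (hasDerivAt_id w).cpow_const (c := ((-(1 / α) : ℝ) : ℂ)) hw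
  simp only [id, mul_one] at this
  rw [show ((-(1 / α) - 1 : ℝ) : ℂ) = ((-(1 / α) : ℝ) : ℂ) - 1 by push_cast; ring]
  exact this

theorem invRoot_cpow {α : ℝ} (hα : 1 ≤ α) {z : ℂ} (hz : z ≠ 0) (h : |α * z.arg| < Real.pi) :
    invRoot α (z ^ ((-α : ℝ) : ℂ)) = z := by
  have hα0 : α ≠ 0 := by linarith
  rw [abs_lt] at h
  have e : (Complex.log z * ((-α : ℝ) : ℂ)).im = -(α * z.arg) := by
    rw [Complex.im_mul_ofReal, Complex.log_im]; ring
  rw [invRoot, Complex.cpow_def_of_ne_zero hz, Complex.cpow_def_of_ne_zero (Complex.exp_ne_zero _),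
    Complex.log_exp (by rw [e]; linarith [h.2]) (by rw [e]; linarith [h.1])]
  rw [mul_assoc, ← Complex.ofReal_mul, show -α * -(1 / α) = 1 by field_simp]
  simp [Complex.exp_log hz]

theorem abs_arg_le_of_neg_le_re {w : ℂ} {s : ℝ} (h1 : -s ≤ w.re) (h2 : 2 * s < ‖w‖) :
    |w.arg| ≤ 3 * Real.pi / 4 := by
  by_contra! hlt
  have hpi := Real.pi_pos
  have h3 : Real.cos |w.arg| < Real.cos (3 * Real.pi / 4) :=
    Real.cos_lt_cos_of_nonneg_of_le_pi (by positivity) (Complex.abs_arg_le_pi w) hlt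
  rw [show 3 * Real.pi / 4 = Real.pi - Real.pi / 4 by ring, Real.cos_pi_sub, Real.cos_abs,
    Real.cos_pi_div_four] at h3
  have h4 := Complex.norm_mul_cos_arg w
  have h5 : (1 : ℝ) < √2 := by rw [Real.lt_sqrt] <;> norm_num
  have h6 : Real.cos w.arg ≤ -(1 / 2) := by linarith
  have h7 := norm_nonneg w
  nlinarith

theorem mem_slitPlane_of_abs_arg_le {w : ℂ} (hw : w ≠ 0) (h : |w.arg| ≤ 3 * Real.pi / 4) :
    w ∈ Complex.slitPlane := by
  rw [Complex.mem_slitPlane_iff_arg]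
  refine ⟨fun h' => ?_, hw⟩
  rw [h', abs_of_pos Real.pi_pos] at h
  linarith [Real.pi_pos]

/-- The quadrant principle in the sector `0 < arg z < π / (2α)`; `w = z ^ (-α)` ranges over the fourth
quadrant. -/
theorem exists_re_le_of_sector {X : ℂ → ℂ} {α δ : ℝ} (hα : 1 ≤ α) (hδ : 0 < δ)
    (hX : ∀ z : ℂ, (z.im ≠ 0 ∨ (0 < z.re ∧ z.re < δ)) → DifferentiableAt ℂ X z)
    (hX0 : ∀ t : ℝ, 0 < t → t < δ → (X t).re = 0)
    (h2 : ∃ R, ∀ w : ℂ, w.re = 0 → w.im < 0 → R ≤ ‖w‖ → (X (invRoot α w)).re ≤ 1)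
    (hg : ∀ ε > 0, ∃ R', ∀ w : ℂ, 0 < w.re → w.im < 0 → R' ≤ ‖w‖ →
      (X (invRoot α w)).re ≤ ε * ‖w‖ ^ 2) :
    ∃ C, ∃ ρ > 0, ∀ z : ℂ, 0 < z.arg → α * z.arg < Real.pi / 2 → ‖z‖ < ρ → (X z).re ≤ C := by
  have hα0 : 0 < α := by linarith
  have hpi := Real.pi_pos
  obtain ⟨R₀, hR₀, hsmall⟩ := exists_norm_invRoot_lt hα hδ
  obtain ⟨R₁, hR₁⟩ := h2
  set R := max R₀ R₁
  have hR : 0 < R := lt_of_lt_of_le hR₀ (le_max_left _ _)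
  have hslit : ∀ w : ℂ, 0 ≤ w.re → R ≤ ‖w‖ → w ∈ Complex.slitPlane := by
    intro w hw1 hw2
    have hw0 : w ≠ 0 := by rw [← norm_pos_iff]; linarith
    refine mem_slitPlane_of_abs_arg_le hw0 ?_
    have := Complex.abs_arg_le_pi_div_two_iff.2 hw1
    linarith
  obtain ⟨C, hC⟩ := exists_re_le_of_quadrant (χ := fun w => X (invRoot α w)) hR
    (fun w hw1 hw2 => DifferentiableAt.comp w
      (hX _ (invRoot_mem_domain hα (hslit w hw1 hw2) (hsmall w ((le_max_left _ _).trans hw2))))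
      (hasDerivAt_invRoot α (hslit w hw1 hw2)).differentiableAt)
    (fun t ht => by
      have ht0 : 0 < t := hR.trans_le ht
      have e : invRoot α (t : ℂ) = ((t ^ (-(1 / α)) : ℝ) : ℂ) := by
        rw [invRoot, Complex.ofReal_cpow ht0.le]
      have h3 := hsmall (t : ℂ) (by
        rw [Complex.norm_real, Real.norm_of_nonneg ht0.le]; exact (le_max_left _ _).trans ht)
      have h4 : 0 < t ^ (-(1 / α)) := by positivity
      rw [e, Complex.norm_real, Real.norm_of_nonneg h4.le] at h3
      rw [e, hX0 _ h4 h3]; exact zero_le_one)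
    (fun w h3 h4 h5 => hR₁ w h3 h4 ((le_max_right _ _).trans h5)) hg
  refine ⟨C, (R + 1) ^ (-(1 / α)), by positivity, fun z hz1 hz2 hz3 => ?_⟩
  have hz0 : z ≠ 0 := fun h => by simp [h] at hz1
  have hnz := norm_pos_iff.2 hz0
  have hw0 : z ^ ((-α : ℝ) : ℂ) ≠ 0 := by
    rw [← norm_pos_iff, Complex.norm_cpow_real]; positivity
  have h3 : |α * z.arg| < Real.pi := by rw [abs_of_pos (by positivity)]; linarith
  have hz' := invRoot_cpow hα hz0 h3
  have hpos : 0 < ‖z‖ ^ (-α) := by positivity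
  have := hC (z ^ ((-α : ℝ) : ℂ)) ?_ ?_ ?_
  · simpa only [hz'] using this
  · rw [re_cpow_ofReal hz0, neg_mul, Real.cos_neg]
    exact mul_pos hpos (Real.cos_pos_of_mem_Ioo ⟨by nlinarith, hz2⟩)
  · rw [im_cpow_ofReal hz0, neg_mul, Real.sin_neg]
    have : 0 < Real.sin (α * z.arg) := Real.sin_pos_of_pos_of_lt_pi (by positivity) (by linarith)
    nlinarith
  · rw [Complex.norm_cpow_real]
    have h5 : R < R + 1 := by linarith
    refine h5.trans_le ?_
    have h6 : ((R + 1) ^ (-(1 / α))) ^ (-α) ≤ ‖z‖ ^ (-α) :=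
      Real.rpow_le_rpow_of_nonpos hnz hz3.le (by linarith)
    rw [← Real.rpow_mul (by linarith), show -(1 / α) * -α = 1 by field_simp, Real.rpow_one] at h6
    exact h6

/-- The corner bound for radial limits. -/
theorem exists_re_le_of_radial_corner {Φ : ℂ → ℂ} {δ : ℝ} (hδ : 0 < δ)
    (hΦ : DifferentiableOn ℂ Φ {z | 0 < z.im})
    (h0 : ∀ t : ℝ, 0 < t → t < δ →
      Tendsto (fun z => (Φ z).re) (𝓝[{z : ℂ | 0 < z.im}] (t : ℂ)) (𝓝 0))
    (hr : ∃ ρ > 0, ∀ z : ℂ, z.re = 0 → 0 < z.im → ‖z‖ < ρ → (Φ z).re ≤ 1)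
    (hg : ∀ ε > 0, ∃ ρ > 0, ∀ z : ℂ, 0 < z.im → ‖z‖ < ρ → (Φ z).re ≤ ε * z.im ^ (-2 : ℝ)) :
    ∃ C, ∃ ρ > 0, ∀ z : ℂ, 0 < z.re → 0 < z.im → ‖z‖ < ρ → (Φ z).re ≤ C := by
  obtain ⟨X, hX, hXup, -, hX0⟩ := exists_reflection hΦ h0
  have hpi := Real.pi_pos
  have hclH : closure {z : ℂ | 0 < z.im} ⊆ {z : ℂ | 0 ≤ z.im} :=
    closure_minimal (fun z (hz : 0 < z.im) => hz.le) (isClosed_le continuous_const Complex.continuous_im)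
  have hgrowth := norm_le_exp_norm_rpow_of_growth (E := fun z => Complex.exp (X z)) (α := 2)
    (by norm_num) hδ isOpen_im_pos (fun z hz => (hX z hz).cexp)
    (fun z hz h1 h2 => by
      rw [isOpen_im_pos.frontier_eq] at hz
      have him : z.im = 0 := le_antisymm (not_lt.1 hz.2) (hclH hz.1)
      have e : z = (z.re : ℂ) := Complex.ext rfl him
      rw [Complex.norm_exp, e, hX0 _ h1 h2, Real.exp_zero])
    (fun ε hε => by
      obtain ⟨ρ, hρ, h⟩ := hg ε hε
      refine ⟨ρ, hρ, fun z hz hz0 hzρ => ?_⟩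
      have him : 0 < z.im := lt_of_le_of_ne (hclH hz) (Ne.symm hz0)
      rw [Complex.norm_exp, hXup z him, abs_of_pos him]
      exact Real.exp_le_exp.2 (h z him hzρ))
  -- `w ↦ 1 / w` maps the fourth quadrant onto the first
  have hψ : ∀ w : ℂ, w.im < 0 → 0 ≤ w.re → (invRoot 1 w).arg = -w.arg ∧ w.arg < 0 ∧
      -(Real.pi / 2) ≤ w.arg ∧ 0 < (invRoot 1 w).im := by
    intro w h1 h2
    have hw : w ∈ Complex.slitPlane := Or.inr h1.ne
    have e := arg_invRoot le_rfl hw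
    have e2 := Complex.arg_neg_iff.2 h1
    have e3 := abs_le.1 (Complex.abs_arg_le_pi_div_two_iff.2 h2)
    have e' : (invRoot 1 w).arg = -w.arg := by rw [e]; norm_num
    refine ⟨e', e2, e3.1, ?_⟩
    rw [← Complex.norm_mul_sin_arg, e']
    refine mul_pos (norm_pos_iff.2 (invRoot_ne_zero 1 (Complex.slitPlane_ne_zero hw))) ?_
    exact Real.sin_pos_of_pos_of_lt_pi (by linarith) (by linarith)
  obtain ⟨C, ρ, hρ, hC⟩ := exists_re_le_of_sector le_rfl hδ hX hX0 (by
      obtain ⟨ρ, hρ, h⟩ := hr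
      obtain ⟨R, -, hR⟩ := exists_norm_invRoot_lt le_rfl hρ
      refine ⟨R, fun w hw1 hw2 hw3 => ?_⟩
      obtain ⟨e1, e2, e3, e4⟩ := hψ w hw2 hw1.ge
      rw [hXup _ e4]
      refine h _ ?_ e4 (hR w hw3)
      rw [← Complex.norm_mul_cos_arg, e1, Complex.arg_eq_neg_pi_div_two_iff.2 ⟨hw1, hw2⟩, neg_neg,
        Real.cos_pi_div_two, mul_zero])
    (fun ε hε => by
      obtain ⟨ρ, hρ, h⟩ := hgrowth ε hε
      obtain ⟨R, -, hR⟩ := exists_norm_invRoot_lt le_rfl hρ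
      refine ⟨R, fun w hw1 hw2 hw3 => ?_⟩
      obtain ⟨e1, e2, e3, e4⟩ := hψ w hw2 hw1.le
      have := h _ e4 (fun h => by rw [h] at e4; simp at e4) (by
        rw [e1, abs_neg, abs_of_neg e2]; linarith) (hR w hw3)
      rw [Complex.norm_exp, Real.exp_le_exp] at this
      refine this.trans (le_of_eq ?_)
      have e5 := norm_invRoot_rpow le_rfl w
      have e6 : ‖invRoot 1 w‖ ^ (-2 : ℝ) = (‖invRoot 1 w‖ ^ (-1 : ℝ)) ^ 2 := by
        rw [← Real.rpow_natCast, ← Real.rpow_mul (norm_nonneg _)]; norm_num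
      rw [e6, e5])
  refine ⟨C, ρ, hρ, fun z h1 h2 h3 => ?_⟩
  rw [← hXup z h2]
  have h4 := (abs_lt.1 (Complex.abs_arg_lt_pi_div_two_iff.2 (Or.inl h1))).2
  have h5 : 0 ≤ z.arg := Complex.arg_nonneg_iff.2 h2.le
  refine hC z (lt_of_le_of_ne h5 fun h => ?_) (by linarith) h3
  have := (Complex.arg_eq_zero_iff.1 h.symm).2
  linarith

/-- A corner bound from information on one line: if the derivative of `χ w = X (w ^ (-1 / α))` is
`o(|w|)` on the line `Re w = -s` and the derivative of `X` has zero growth of order `α`, then `χ'` is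
`o(|w|)` to the right of that line, hence `Re χ = o(|w| ^ 2)`, and the quadrant principle applies to
`χ` and `-χ`. -/
theorem exists_abs_re_le_of_deriv_isLittleO {X : ℂ → ℂ} {α δ s : ℝ} (hα : 1 ≤ α) (hδ : 0 < δ)
    (hs : 0 ≤ s)
    (hX : ∀ z : ℂ, (z.im ≠ 0 ∨ (0 < z.re ∧ z.re < δ)) → DifferentiableAt ℂ X z)
    (hX0 : ∀ t : ℝ, 0 < t → t < δ → (X t).re = 0)
    (hE : ∀ ε > 0, ∃ ρ > 0, ∀ z : ℂ, z.im ≠ 0 → ‖z‖ < ρ →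
      ‖deriv X z‖ ≤ Real.exp (ε * |z.im| ^ (-α)))
    (h2 : ∃ R, ∀ w : ℂ, w.re = 0 → w.im < 0 → R ≤ ‖w‖ → |(X (invRoot α w)).re| ≤ 1)
    (hb : ∀ ε > 0, ∃ R', ∀ w : ℂ, w.re = -s → R' ≤ ‖w‖ →
      ‖deriv (fun w => X (invRoot α w)) w‖ ≤ ε * ‖w‖) :
    ∃ C, ∃ ρ > 0, ∀ z : ℂ, 0 < z.arg → α * z.arg < Real.pi / 2 → ‖z‖ < ρ → |(X z).re| ≤ C := by
  have hα0 : 0 < α := by linarith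
  have hpi := Real.pi_pos
  set χ : ℂ → ℂ := fun w => X (invRoot α w) with hχ
  have hSo : IsOpen {z : ℂ | z.im ≠ 0 ∨ (0 < z.re ∧ z.re < δ)} := by
    refine IsOpen.union ?_ ?_
    · exact isOpen_ne_fun Complex.continuous_im continuous_const
    · exact (isOpen_lt continuous_const Complex.continuous_re).inter
        (isOpen_lt Complex.continuous_re continuous_const)
  have hXd : DifferentiableOn ℂ X {z : ℂ | z.im ≠ 0 ∨ (0 < z.re ∧ z.re < δ)} :=
    fun z hz => (hX z hz).differentiableWithinAt
  have hEd : ∀ z : ℂ, (z.im ≠ 0 ∨ (0 < z.re ∧ z.re < δ)) → DifferentiableAt ℂ (deriv X) z :=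
    fun z hz => (hXd.deriv hSo).differentiableAt (hSo.mem_nhds hz)
  have hgrowth := norm_le_exp_norm_rpow_of_growth (E := deriv X) hα hδ isOpen_univ hEd
    (by simp) (fun ε hε => by
      obtain ⟨ρ, hρ, h⟩ := hE ε hε
      exact ⟨ρ, hρ, fun z _ => h z⟩)
  obtain ⟨R₀, hR₀, hsmall⟩ := exists_norm_invRoot_lt hα hδ
  obtain ⟨R₂, h2⟩ := h2
  -- the estimates below live in the region `-(s + 1) ≤ Re w`, a neighbourhood of `-s ≤ Re w`
  set R := max (max R₀ R₂) (2 * s + 3)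
  have hR0R : R₀ ≤ R := (le_max_left _ _).trans (le_max_left _ _)
  have hR2R : R₂ ≤ R := (le_max_right _ _).trans (le_max_left _ _)
  have hR : 0 < R := lt_of_lt_of_le hR₀ hR0R
  have hR1 : 2 * s + 3 ≤ R := le_max_right _ _
  have hgeom : ∀ w : ℂ, -(s + 1) ≤ w.re → R ≤ ‖w‖ → |w.arg| ≤ 3 * Real.pi / 4 ∧
      w ∈ Complex.slitPlane ∧
      ((invRoot α w).im ≠ 0 ∨ (0 < (invRoot α w).re ∧ (invRoot α w).re < δ)) := by
    intro w h1 h3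
    have harg := abs_arg_le_of_neg_le_re h1 (by linarith)
    have hw0 : w ≠ 0 := by rw [← norm_pos_iff]; linarith
    have hsl := mem_slitPlane_of_abs_arg_le hw0 harg
    exact ⟨harg, hsl, invRoot_mem_domain hα hsl (hsmall w (hR0R.trans h3))⟩
  have hχd : ∀ w : ℂ, -(s + 1) ≤ w.re → R ≤ ‖w‖ → HasDerivAt χ (deriv X (invRoot α w) *
      (((-(1 / α) : ℝ) : ℂ) * w ^ ((-(1 / α) - 1 : ℝ) : ℂ))) w := by
    intro w h1 h3
    obtain ⟨-, hsl, hdom⟩ := hgeom w h1 h3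
    exact HasDerivAt.comp w (hX _ hdom).hasDerivAt (hasDerivAt_invRoot α hsl)
  have hχ'd : ∀ w : ℂ, -(s + 1) < w.re → R < ‖w‖ → DifferentiableAt ℂ (deriv χ) w := by
    intro w h1 h3
    have ho : IsOpen {w : ℂ | -(s + 1) < w.re ∧ R < ‖w‖} :=
      (isOpen_lt continuous_const Complex.continuous_re).inter
        (isOpen_lt continuous_const continuous_norm)
    have : DifferentiableOn ℂ χ {w : ℂ | -(s + 1) < w.re ∧ R < ‖w‖} := fun w hw =>
      (hχd w hw.1.le hw.2.le).differentiableAt.differentiableWithinAt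
    exact (this.deriv ho).differentiableAt (ho.mem_nhds ⟨h1, h3⟩)
  have hχ'g : ∀ ε > 0, ∃ R', ∀ w : ℂ, -s ≤ w.re → R' ≤ ‖w‖ →
      ‖deriv χ w‖ ≤ Real.exp (ε * ‖w‖) := by
    intro ε hε
    obtain ⟨ρ, hρ, h⟩ := hgrowth ε hε
    obtain ⟨R₃, -, hR₃⟩ := exists_norm_invRoot_lt hα hρ
    refine ⟨max R₃ (max R 1), fun w hw1 hw2 => ?_⟩
    have hwR₃ : R₃ ≤ ‖w‖ := (le_max_left _ _).trans hw2
    have hwR : R ≤ ‖w‖ := (le_max_left _ _).trans ((le_max_right _ _).trans hw2)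
    have hw1' : 1 ≤ ‖w‖ := (le_max_right _ _).trans ((le_max_right _ _).trans hw2)
    obtain ⟨harg, hsl, hdom⟩ := hgeom w (by linarith) hwR
    have h3 : 1 / α ≤ 1 := by rw [div_le_one hα0]; exact hα
    have h4 : 0 < 1 / α := by positivity
    have e1 := h (invRoot α w) trivial (invRoot_ne_zero α (Complex.slitPlane_ne_zero hsl)) (by
      rw [arg_invRoot hα hsl, abs_mul, abs_neg, abs_of_pos h4]
      exact (mul_le_of_le_one_left (abs_nonneg _) h3).trans harg) (hR₃ w hwR₃)
    rw [norm_invRoot_rpow hα] at e1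
    rw [(hχd w (by linarith) hwR).deriv, norm_mul, norm_mul, Complex.norm_real, norm_neg,
      Real.norm_of_nonneg h4.le, Complex.norm_cpow_real]
    have e2 : ‖w‖ ^ (-(1 / α) - 1) ≤ 1 := Real.rpow_le_one_of_one_le_of_nonpos hw1' (by linarith)
    have e3 : 1 / α * ‖w‖ ^ (-(1 / α) - 1) ≤ 1 * 1 := by gcongr
    calc _ ≤ Real.exp (ε * ‖w‖) * (1 * 1) := by gcongr
      _ = _ := by ring
  have hshift : ∀ τ : ℂ, ‖τ - s‖ ≤ ‖τ‖ + s ∧ ‖τ‖ - s ≤ ‖τ - s‖ := by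
    intro τ
    have e : ‖(s : ℂ)‖ = s := by rw [Complex.norm_real, Real.norm_of_nonneg hs]
    constructor
    · have := norm_sub_le τ (s : ℂ); rwa [e] at this
    · have := norm_sub_norm_le τ (s : ℂ); rwa [e] at this
  have hlin := exists_norm_le_mul_norm_add (f := fun τ => deriv χ (τ - s)) (R := R + s + 1)
    (fun τ h1 h3 => DifferentiableAt.comp τ (hχ'd (τ - s) (by simp; linarith)
      (by linarith [(hshift τ).2])) (differentiableAt_id.sub_const (s : ℂ)))
    (fun ε hε => by
      obtain ⟨R', hR'⟩ := hb (ε / 2) (by positivity)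
      refine ⟨max (R' + s) s, fun τ h1 h3 => ?_⟩
      have a1 : R' + s ≤ ‖τ‖ := (le_max_left _ _).trans h3
      have a2 : s ≤ ‖τ‖ := (le_max_right _ _).trans h3
      refine (hR' (τ - s) (by simp [h1]) (by linarith [(hshift τ).2])).trans ?_
      calc ε / 2 * ‖τ - s‖ ≤ ε / 2 * (‖τ‖ + ‖τ‖) := by gcongr; linarith [(hshift τ).1]
        _ = ε * ‖τ‖ := by ring)
    (fun ε hε => by
      obtain ⟨R', hR'⟩ := hχ'g (ε / 2) (by positivity)
      refine ⟨max (R' + s) s, fun τ h1 h3 => ?_⟩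
      have a1 : R' + s ≤ ‖τ‖ := (le_max_left _ _).trans h3
      have a2 : s ≤ ‖τ‖ := (le_max_right _ _).trans h3
      refine (hR' (τ - s) (by simp; linarith) (by linarith [(hshift τ).2])).trans ?_
      refine Real.exp_le_exp.2 ?_
      calc ε / 2 * ‖τ - s‖ ≤ ε / 2 * (‖τ‖ + ‖τ‖) := by gcongr; linarith [(hshift τ).1]
        _ = ε * ‖τ‖ := by ring)
  have hsq := abs_re_le_mul_sq_of_deriv (χ := χ) (R := R + s + 1 + s)
    (fun w h1 h3 => (hχd w (by linarith) (by linarith)).differentiableAt)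
    (fun t ht => by
      have ht0 : 0 < t := by linarith
      have e : invRoot α (t : ℂ) = ((t ^ (-(1 / α)) : ℝ) : ℂ) := by
        rw [invRoot, Complex.ofReal_cpow ht0.le]
      have h3 := hsmall (t : ℂ) (by
        rw [Complex.norm_real, Real.norm_of_nonneg ht0.le]; linarith)
      have h4 : 0 < t ^ (-(1 / α)) := by positivity
      rw [e, Complex.norm_real, Real.norm_of_nonneg h4.le] at h3
      simp only [hχ]
      rw [e, hX0 _ h4 h3])
    (fun w h1 h3 h4 => h2 w h1 h3 (by linarith))
    (fun ε hε => by
      obtain ⟨K, hK⟩ := hlin ε hε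
      refine ⟨s + K, fun w h1 h3 => ?_⟩
      have h4 := hshift (w + s)
      rw [add_sub_cancel_right] at h4
      have h5 : ‖w‖ - s ≤ ‖w + s‖ := by
        have := norm_sub_le (w + s) (s : ℂ)
        rw [add_sub_cancel_right, Complex.norm_real, Real.norm_of_nonneg hs] at this
        linarith
      have := hK (w + s) (by simp; linarith) (by linarith)
      rw [add_sub_cancel_right] at this
      have h6 : ‖w + s‖ + K ≤ ‖w‖ + (s + K) := by
        have := norm_add_le w (s : ℂ)
        rw [Complex.norm_real, Real.norm_of_nonneg hs] at this
        linarith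
      exact this.trans (mul_le_mul_of_nonneg_left h6 hε.le))
  obtain ⟨C₁, ρ₁, hρ₁, hC₁⟩ := exists_re_le_of_sector hα hδ hX hX0
    ⟨R₂, fun w h1 h3 h4 => (abs_le.1 (h2 w h1 h3 h4)).2⟩
    (fun ε hε => by
      obtain ⟨R', h⟩ := hsq ε hε
      exact ⟨R', fun w h1 h3 h4 => (abs_le.1 (h w h1 h3 h4)).2⟩)
  obtain ⟨C₂, ρ₂, hρ₂, hC₂⟩ := exists_re_le_of_sector (X := fun z => -X z) hα hδ
    (fun z hz => (hX z hz).neg) (fun t h1 h3 => by simp [hX0 t h1 h3])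
    ⟨R₂, fun w h1 h3 h4 => by have := (abs_le.1 (h2 w h1 h3 h4)).1; simp; linarith⟩
    (fun ε hε => by
      obtain ⟨R', h⟩ := hsq ε hε
      exact ⟨R', fun w h1 h3 h4 => by
        have := (abs_le.1 (h w h1 h3 h4)).1
        simp only [hχ] at this
        simp; linarith⟩)
  refine ⟨max C₁ C₂, min ρ₁ ρ₂, lt_min hρ₁ hρ₂, fun z h1 h3 h4 => ?_⟩
  have b1 := (hC₁ z h1 h3 (h4.trans_le (min_le_left _ _))).trans (le_max_left _ C₂)
  have b2 := (hC₂ z h1 h3 (h4.trans_le (min_le_right _ _))).trans (le_max_right C₁ _)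
  rw [Complex.neg_re] at b2
  exact abs_le.2 ⟨by linarith, b1⟩

/-! ### Cubic and conical corners -/

/-- Powers of `1 / y` are absorbed by `exp (c y ^ (-a))`. -/
theorem eventually_div_sq_le_exp {a c : ℝ} (ha : 0 < a) (hc : 0 < c) (K : ℝ) :
    ∀ᶠ y : ℝ in 𝓝[>] 0, K / y ^ 2 ≤ Real.exp (c * y ^ (-a)) := by
  have h1 := (isLittleO_rpow_exp_pos_mul_atTop (2 / a) hc).bound
    (show 0 < 1 / (|K| + 1) by positivity)
  have h2 : Tendsto (fun y : ℝ => y ^ (-a)) (𝓝[>] 0) atTop := tendsto_rpow_neg_nhdsGT_zero (by linarith)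
  filter_upwards [h2.eventually h1, self_mem_nhdsWithin] with y hy hy0
  have hy0 : 0 < y := hy0
  rw [← Real.rpow_mul hy0.le, show -a * (2 / a) = -2 by field_simp, Real.norm_of_nonneg (by positivity),
    Real.norm_of_nonneg (Real.exp_pos _).le, Real.rpow_neg hy0.le] at hy
  have e : y ^ (2 : ℝ) = y ^ 2 := by norm_cast
  rw [e, one_div, ← div_eq_inv_mul, le_div_iff₀ (by positivity)] at hy
  refine le_trans ?_ hy
  rw [div_eq_inv_mul]
  gcongr
  linarith [le_abs_self K]

/-- The Borel–Carathéodory bound for the derivative of a function reflected across `(0, δ)`. -/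
theorem exists_norm_deriv_le_of_re_le {Φ X : ℂ → ℂ}
    (hΦ : DifferentiableOn ℂ Φ {z | 0 < z.im})
    (hX : ∀ z : ℂ, z.im ≠ 0 → DifferentiableAt ℂ X z)
    (hXup : ∀ z : ℂ, 0 < z.im → X z = Φ z)
    (hXc : ∀ z : ℂ, z.im ≠ 0 → X ((starRingEnd ℂ) z) = - (starRingEnd ℂ) (X z))
    {N : ℝ → ℝ} (hN : ∀ y, 0 < y → 0 ≤ N y) (hN' : ∀ y y', 0 < y → y ≤ y' → N y' ≤ N y)
    {ρ : ℝ} (hρ : 0 < ρ) (hb : ∀ z : ℂ, 0 < z.im → ‖z‖ < ρ → (Φ z).re ≤ N z.im) :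
    ∃ K > 0, ∃ ρ' > 0, ∀ z : ℂ, z.im ≠ 0 → ‖z‖ < ρ' →
      ‖deriv X z‖ ≤ K * (N (|z.im| / 4) + 1) / |z.im| ^ 2 := by
  obtain ⟨K, hK, h⟩ := exists_norm_and_norm_deriv_le_of_re_le (δ := ρ / 8) (by positivity) hΦ
  refine ⟨K, hK, ρ / 8, by positivity, ?_⟩
  have up : ∀ z : ℂ, 0 < z.im → ‖z‖ < ρ / 8 → ‖deriv X z‖ ≤ K * (N (z.im / 4) + 1) / z.im ^ 2 := by
    intro z hz hzρ
    have e : deriv X z = deriv Φ z := by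
      refine Filter.EventuallyEq.deriv_eq ?_
      filter_upwards [isOpen_im_pos.mem_nhds hz] with w hw using hXup w hw
    rw [e]
    refine (h z hz ((Complex.abs_re_le_norm z).trans hzρ.le) ((Complex.im_le_norm z).trans hzρ.le)
      _ (hN _ (by positivity)) fun w hw1 hw2 => ?_).2
    exact (hb w (by linarith) (by linarith)).trans (hN' _ _ (by positivity) hw1)
  intro z hz hzρ
  rcases lt_or_gt_of_ne hz with h' | h'
  · have e1 : HasDerivAt X (-(starRingEnd ℂ) (deriv X ((starRingEnd ℂ) z))) z := by
      have h1 := (hX ((starRingEnd ℂ) z) (by simpa using hz)).hasDerivAt.conj_conj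
      rw [Complex.conj_conj] at h1
      refine h1.neg.congr_of_eventuallyEq ?_
      filter_upwards [(isOpen_lt Complex.continuous_im continuous_const).mem_nhds h'] with w hw
      have := hXc ((starRingEnd ℂ) w) (by simpa using (ne_of_lt hw))
      rw [Complex.conj_conj] at this
      simpa using this
    rw [e1.deriv, norm_neg, Complex.norm_conj, abs_of_neg h']
    have := up ((starRingEnd ℂ) z) (by simpa using h') (by rwa [Complex.norm_conj])
    simpa using this
  · rw [abs_of_pos h']; exact up z h' hzρ

theorem abs_re_le_of_reflection {Φ X : ℂ → ℂ} {ρ η : ℝ} {h : ℝ → ℝ}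
    (hXup : ∀ z : ℂ, 0 < z.im → X z = Φ z)
    (hXc : ∀ z : ℂ, z.im ≠ 0 → X ((starRingEnd ℂ) z) = - (starRingEnd ℂ) (X z))
    (hΩ : ∀ z : ℂ, 0 < z.im → |z.re| ≤ h z.im → ‖z‖ < ρ → |(Φ z).re| ≤ η) :
    ∀ z : ℂ, z.im ≠ 0 → |z.re| ≤ h |z.im| → ‖z‖ < ρ → |(X z).re| ≤ η := by
  intro z hz h1 h2
  rcases lt_or_gt_of_ne hz with h' | h'
  · have e := hXc ((starRingEnd ℂ) z) (by simpa using hz)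
    rw [Complex.conj_conj] at e
    rw [e, hXup _ (by simpa using h')]
    have := hΩ ((starRingEnd ℂ) z) (by simpa using h') (by simpa [abs_of_neg h'] using h1)
      (by rwa [Complex.norm_conj])
    simpa using this
  · rw [hXup z h']
    exact hΩ z h' (by rwa [abs_of_pos h'] at h1) h2

/-- Exponential growth of the real part passes to the derivative of the reflected function; `ε`
absorbs the polynomial factors. -/
theorem norm_deriv_le_exp_of_re_le_exp {Φ X : ℂ → ℂ} {α : ℝ} (hα : 1 ≤ α)
    (hΦ : DifferentiableOn ℂ Φ {z | 0 < z.im})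
    (hX : ∀ z : ℂ, z.im ≠ 0 → DifferentiableAt ℂ X z)
    (hXup : ∀ z : ℂ, 0 < z.im → X z = Φ z)
    (hXc : ∀ z : ℂ, z.im ≠ 0 → X ((starRingEnd ℂ) z) = - (starRingEnd ℂ) (X z))
    (hg : ∀ ε > 0, ∃ ρ > 0, ∀ z : ℂ, 0 < z.im → ‖z‖ < ρ →
      (Φ z).re ≤ Real.exp (ε * z.im ^ (-α))) :
    ∀ ε > 0, ∃ ρ > 0, ∀ z : ℂ, z.im ≠ 0 → ‖z‖ < ρ →
      ‖deriv X z‖ ≤ Real.exp (ε * |z.im| ^ (-α)) := by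
  intro ε hε
  have hα0 : 0 < α := by linarith
  have h4 : (0 : ℝ) < 4 ^ α := by positivity
  set c : ℝ := ε / (2 * 4 ^ α) with hc
  have hc0 : 0 < c := by positivity
  obtain ⟨ρ, hρ, h⟩ := hg c hc0
  obtain ⟨K, hK, ρ', hρ', h'⟩ := exists_norm_deriv_le_of_re_le hΦ hX hXup hXc
    (N := fun y => Real.exp (c * y ^ (-α))) (fun y _ => (Real.exp_pos _).le)
    (fun y y' hy hyy => Real.exp_le_exp.2 (by
      have := Real.rpow_le_rpow_of_nonpos hy hyy (show -α ≤ 0 by linarith)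
      gcongr)) hρ h
  have hev := eventually_div_sq_le_exp hα0 (show 0 < ε / 2 by positivity) (2 * K)
  obtain ⟨y₀, hy₀, hy⟩ := mem_nhdsGT_iff_exists_Ioo_subset.1 hev
  refine ⟨min ρ' y₀, lt_min hρ' hy₀, fun z hz hzρ => ?_⟩
  refine (h' z hz (hzρ.trans_le (min_le_left _ _))).trans ?_
  have him : 0 < |z.im| := abs_pos.2 hz
  have h5 : 2 * K / |z.im| ^ 2 ≤ Real.exp (ε / 2 * |z.im| ^ (-α)) :=
    hy ⟨him, ((Complex.abs_im_le_norm z).trans_lt hzρ).trans_le (min_le_right _ _)⟩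
  have h6 : c * (|z.im| / 4) ^ (-α) = ε / 2 * |z.im| ^ (-α) := by
    rw [Real.div_rpow him.le (by norm_num), Real.rpow_neg (by norm_num : (0:ℝ) ≤ 4), hc]
    field_simp
  have h7 : 1 ≤ Real.exp (ε / 2 * |z.im| ^ (-α)) := Real.one_le_exp (by positivity)
  simp only [h6]
  calc K * (Real.exp (ε / 2 * |z.im| ^ (-α)) + 1) / |z.im| ^ 2
      ≤ K * (Real.exp (ε / 2 * |z.im| ^ (-α)) + Real.exp (ε / 2 * |z.im| ^ (-α))) / |z.im| ^ 2 := by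
        gcongr
    _ = 2 * K / |z.im| ^ 2 * Real.exp (ε / 2 * |z.im| ^ (-α)) := by ring
    _ ≤ Real.exp (ε / 2 * |z.im| ^ (-α)) * Real.exp (ε / 2 * |z.im| ^ (-α)) := by gcongr
    _ = Real.exp (ε * |z.im| ^ (-α)) := by rw [← Real.exp_add]; ring_nf

/-- The corner bound for limits zero along `|x| ≤ c y ^ 3`. -/
theorem exists_abs_re_le_of_cubic_corner {Φ : ℂ → ℂ} {δ c : ℝ} (hδ : 0 < δ) (hc : 0 < c)
    (hΦ : DifferentiableOn ℂ Φ {z | 0 < z.im})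
    (h0 : ∀ t : ℝ, 0 < t → t < δ →
      Tendsto (fun z => (Φ z).re) (𝓝[{z : ℂ | 0 < z.im}] (t : ℂ)) (𝓝 0))
    (hΩ : ∀ η > 0, ∃ ρ > 0, ∀ z : ℂ, 0 < z.im → |z.re| ≤ c * z.im ^ 3 → ‖z‖ < ρ → |(Φ z).re| ≤ η)
    (hg : ∀ ε > 0, ∃ ρ > 0, ∀ z : ℂ, 0 < z.im → ‖z‖ < ρ →
      (Φ z).re ≤ Real.exp (ε * z.im ^ (-1 : ℝ))) :
    ∃ C, ∃ ρ > 0, ∀ z : ℂ, 0 < z.re → 0 < z.im → ‖z‖ < ρ → |(Φ z).re| ≤ C := by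
  obtain ⟨X, hX, hXup, hXc, hX0⟩ := exists_reflection hΦ h0
  have hpi := Real.pi_pos
  -- points of the imaginary axis correspond to each other under `w ↦ 1 / w`
  have haxis : ∀ w : ℂ, w ≠ 0 → w.re = 0 → w ∈ Complex.slitPlane ∧ (invRoot 1 w).re = 0 ∧
      |(invRoot 1 w).im| = ‖invRoot 1 w‖ ∧ (invRoot 1 w).im ≠ 0 ∧
      (w.im < 0 → 0 < (invRoot 1 w).im) := by
    intro w hw0 hw
    have hwim : w.im ≠ 0 := fun h => hw0 (Complex.ext hw h)
    have hsl : w ∈ Complex.slitPlane := Or.inr hwim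
    have e : invRoot 1 w = w⁻¹ := by
      rw [invRoot]; norm_num [Complex.cpow_neg_one]
    have hre : (invRoot 1 w).re = 0 := by rw [e, Complex.inv_re, hw, zero_div]
    have him : (invRoot 1 w).im ≠ 0 := fun h => invRoot_ne_zero 1 hw0 (Complex.ext hre h)
    refine ⟨hsl, hre, Complex.abs_im_eq_norm.2 hre, him, fun hlt => ?_⟩
    rw [e, Complex.inv_im]
    exact div_pos (by linarith) (Complex.normSq_pos.2 hw0)
  obtain ⟨C, ρ, hρ, hC⟩ := exists_abs_re_le_of_deriv_isLittleO (s := 0) le_rfl hδ le_rfl hX hX0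
    (norm_deriv_le_exp_of_re_le_exp le_rfl hΦ (fun z hz => hX z (Or.inl hz)) hXup hXc hg) (by
      obtain ⟨ρ, hρ, h⟩ := hΩ 1 one_pos
      obtain ⟨R, hR, hR'⟩ := exists_norm_invRoot_lt le_rfl hρ
      refine ⟨R, fun w hw1 hw2 hw3 => ?_⟩
      have hw0 : w ≠ 0 := by rw [← norm_pos_iff]; linarith
      obtain ⟨e1, e2, e3, e4, e5⟩ := haxis w hw0 hw1
      rw [hXup _ (e5 hw2)]
      refine h _ (e5 hw2) ?_ (hR' w hw3)
      have := e5 hw2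
      rw [e2, abs_zero]; positivity)
    (by
      intro ε hε
      -- the disc of radius `c' |z| ^ 3` around a point of the imaginary axis lies in the region where
      -- `|Re X| ≤ η`, so the derivative of `X` is `O(η |z| ^ (-3))` and that of `X (1 / w)` is `O(η |w|)`
      set c' := min (c / 8) 1 with hc'
      have hc'0 : 0 < c' := lt_min (by positivity) one_pos
      set η := ε * c' / 8 with hη
      have hη0 : 0 < η := by positivity
      obtain ⟨ρ, hρ, h⟩ := hΩ η hη0
      have hXη := abs_re_le_of_reflection (h := fun t => c * t ^ 3) hXup hXc h
      obtain ⟨R, hR, hR'⟩ := exists_norm_invRoot_lt le_rfl (ρ := min (ρ / 2) (1 / 2))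
        (by positivity)
      refine ⟨R, fun w hw1 hw2 => ?_⟩
      have hw0 : w ≠ 0 := by rw [← norm_pos_iff]; linarith
      obtain ⟨e1, e2, e3, e4, e5⟩ := haxis w hw0 (by simpa using hw1)
      have hzs := hR' w hw2
      have hder := ((hX _ (Or.inl e4)).hasDerivAt.comp w (hasDerivAt_invRoot 1 e1)).deriv
      simp only [Function.comp_def] at hder
      rw [hder]
      set z := invRoot 1 w with hz
      set y := ‖z‖ with hy
      have hy0 : 0 < y := norm_pos_iff.2 (invRoot_ne_zero 1 hw0)
      have hyρ : y < ρ / 2 := hzs.trans_le (min_le_left _ _)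
      have hy1 : y < 1 / 2 := hzs.trans_le (min_le_right _ _)
      have hr : c' * y ^ 3 ≤ y / 2 := by
        have : y ^ 3 ≤ y / 2 := by nlinarith [sq_nonneg y]
        have h1 : c' ≤ 1 := min_le_right _ _
        have : c' * y ^ 3 ≤ 1 * y ^ 3 := by gcongr
        linarith
      have hball : ∀ v ∈ Metric.ball z (c' * y ^ 3), v.im ≠ 0 ∧ |(X v).re| ≤ η := by
        intro v hv
        have hv' : ‖v - z‖ < c' * y ^ 3 := by simpa [dist_eq_norm] using hv
        have b1 := Complex.abs_re_le_norm (v - z)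
        have b2 := Complex.abs_im_le_norm (v - z)
        rw [Complex.sub_re, e2, sub_zero] at b1
        rw [Complex.sub_im] at b2
        have b3 : y / 2 ≤ |v.im| := by
          have := abs_sub_abs_le_abs_sub z.im v.im
          rw [e3, abs_sub_comm] at this
          linarith
        have b4 : v.im ≠ 0 := by rw [← abs_pos]; linarith
        refine ⟨b4, hXη v b4 ?_ ?_⟩
        · have h1 : c' ≤ c / 8 := min_le_left _ _
          calc |v.re| ≤ c' * y ^ 3 := by linarith
            _ ≤ c / 8 * y ^ 3 := by gcongr
            _ = c * (y / 2) ^ 3 := by ring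
            _ ≤ c * |v.im| ^ 3 := by gcongr
        · have : v = (v - z) + z := by ring
          rw [this]
          refine (norm_add_le _ _).trans_lt ?_
          linarith
      have hdz := norm_deriv_le_of_abs_re_le (f := X) (c := z) (ρ := c' * y ^ 3) (M := η)
        (by positivity) hη0 (fun v hv => (hX v (Or.inl (hball v hv).1)).differentiableWithinAt)
        (fun v hv => (hball v hv).2)
      have hyw : ‖w‖ = y⁻¹ := by
        rw [hy, hz, norm_invRoot]
        norm_num [Real.rpow_neg_one]
      rw [norm_mul, norm_mul, Complex.norm_real, Complex.norm_cpow_real, hyw]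
      have : (y⁻¹ : ℝ) ^ (-(1 / 1) - 1 : ℝ) = y ^ 2 := by
        rw [show (-(1 / 1) - 1 : ℝ) = -(2 : ℕ) by norm_num, Real.rpow_neg (by positivity),
          Real.rpow_natCast, inv_pow, inv_inv]
      rw [this]
      norm_num
      calc ‖deriv X z‖ * y ^ 2 ≤ 8 * η / (c' * y ^ 3) * y ^ 2 := by gcongr
        _ = ε * y⁻¹ := by rw [hη]; field_simp)
  refine ⟨C, ρ, hρ, fun z h1 h2 h3 => ?_⟩
  rw [← hXup z h2]
  have h4 := (abs_lt.1 (Complex.abs_arg_lt_pi_div_two_iff.2 (Or.inl h1))).2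
  have h5 : 0 ≤ z.arg := Complex.arg_nonneg_iff.2 h2.le
  refine hC z (lt_of_le_of_ne h5 fun h => ?_) (by linarith) h3
  have := (Complex.arg_eq_zero_iff.1 h.symm).2
  linarith

/-- With `cot β = c`, the angles between `β` and `π - β` are those of the cone `|x| ≤ c y`. -/
theorem abs_cos_le_mul_sin {c β φ : ℝ} (hβ : Real.cos β = c * Real.sin β) (hc : 0 < c) (hβ0 : 0 ≤ β)
    (h1 : β ≤ φ) (h2 : φ ≤ Real.pi - β) : |Real.cos φ| ≤ c * Real.sin φ := by
  have hpi := Real.pi_pos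
  have e1 : |Real.cos φ| ≤ Real.cos β := by
    rw [abs_le]
    constructor
    · have := Real.cos_le_cos_of_nonneg_of_le_pi (show 0 ≤ φ by linarith)
        (show Real.pi - β ≤ Real.pi by linarith) h2
      rw [Real.cos_pi_sub] at this; linarith
    · exact Real.cos_le_cos_of_nonneg_of_le_pi hβ0 (by linarith) h1
  have e2 : Real.sin β ≤ Real.sin φ := by
    rw [← Real.cos_sub_pi_div_two φ, ← Real.cos_abs (φ - Real.pi / 2),
      ← Real.cos_pi_div_two_sub β]
    refine Real.cos_le_cos_of_nonneg_of_le_pi (abs_nonneg _) (by linarith) ?_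
    rw [abs_le]; constructor <;> linarith
  calc _ ≤ Real.cos β := e1
    _ = c * Real.sin β := hβ
    _ ≤ _ := by gcongr

/-- The corner bound for boundedness along `|x| ≤ c y`. With `β = arctan (1 / c)` the region between
the cone and the positive axis is `0 < arg z < β`, and `α = π / (2β)` opens it to a quadrant. Since
`α > 1`, the image under `w ↦ w ^ (-1 / α)` of a strip to the left of the imaginary axis still lies in
the cone, which gives derivative bounds on the line `Re w = -1`. -/
theorem exists_abs_re_le_of_conical_corner {Φ : ℂ → ℂ} {δ c : ℝ} (hδ : 0 < δ) (hc : 0 < c)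
    (hΦ : DifferentiableOn ℂ Φ {z | 0 < z.im})
    (h0 : ∀ t : ℝ, 0 < t → t < δ →
      Tendsto (fun z => (Φ z).re) (𝓝[{z : ℂ | 0 < z.im}] (t : ℂ)) (𝓝 0))
    (hΩ : ∃ ρ > 0, ∀ z : ℂ, 0 < z.im → |z.re| ≤ c * z.im → ‖z‖ < ρ → |(Φ z).re| ≤ 1)
    (hg : ∀ ε > 0, ∃ ρ > 0, ∀ z : ℂ, 0 < z.im → ‖z‖ < ρ →
      (Φ z).re ≤ Real.exp (ε * z.im ^ (-(Real.pi / (2 * Real.arctan (1 / c)))))) :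
    ∃ C, ∃ ρ > 0, ∀ z : ℂ, 0 < z.re → 0 < z.im → ‖z‖ < ρ → |(Φ z).re| ≤ C := by
  obtain ⟨X, hX, hXup, hXc, hX0⟩ := exists_reflection hΦ h0
  obtain ⟨ρ, hρ, hΩ⟩ := hΩ
  have hpi := Real.pi_pos
  set β := Real.arctan (1 / c) with hβdef
  have hβ0 : 0 < β := Real.arctan_pos.2 (by positivity)
  have hβ1 : β < Real.pi / 2 := Real.arctan_lt_pi_div_two _
  set α := Real.pi / (2 * β) with hαdef
  have hαβ : α * β = Real.pi / 2 := by rw [hαdef]; field_simp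
  have hα1 : 1 < α := by rw [hαdef, lt_div_iff₀ (by positivity)]; linarith
  have hα0 : 0 < α := by linarith
  have hcos : Real.cos β = c * Real.sin β := by
    have h1 : Real.tan β = 1 / c := Real.tan_arctan _
    have h2 : 0 < Real.cos β := Real.cos_pos_of_mem_Ioo ⟨by linarith, hβ1⟩
    rw [Real.tan_eq_sin_div_cos, div_eq_div_iff h2.ne' hc.ne'] at h1
    linarith
  have hXη := abs_re_le_of_reflection (h := fun t => c * t) hXup hXc hΩ
  have hcone : ∀ z : ℂ, β ≤ |z.arg| → |z.arg| ≤ Real.pi - β → z ≠ 0 →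
      |z.re| ≤ c * |z.im| ∧ z.im ≠ 0 := by
    intro z h1 h2 hz0
    have h3 := abs_cos_le_mul_sin hcos hc hβ0.le h1 h2
    rw [Real.cos_abs] at h3
    have h4 : Real.sin |z.arg| ≤ |Real.sin z.arg| := by
      rcases abs_choice z.arg with h | h <;> rw [h]
      · exact le_abs_self _
      · rw [Real.sin_neg]; exact neg_le_abs _
    refine ⟨?_, fun him => ?_⟩
    · rw [← Complex.norm_mul_cos_arg, ← Complex.norm_mul_sin_arg, abs_mul, abs_mul, abs_norm]
      calc _ ≤ ‖z‖ * (c * |Real.sin z.arg|) := by gcongr; exact h3.trans (by gcongr)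
        _ = _ := by ring
    · have h5 : 0 < Real.sin |z.arg| := Real.sin_pos_of_pos_of_lt_pi (by linarith) (by linarith)
      rw [← Complex.norm_mul_sin_arg] at him
      have h6 : Real.sin z.arg = 0 := by
        rcases mul_eq_zero.1 him with h | h
        · exact absurd (norm_eq_zero.1 h) hz0
        · exact h
      rw [h6, abs_zero] at h4; linarith
  -- the strip `-2 ≤ Re w ≤ 0` is mapped into the cone on which `Φ` is controlled
  obtain ⟨R, hR, hstrip⟩ : ∃ R > 2, ∀ w : ℂ, -2 ≤ w.re → w.re ≤ 0 → R ≤ ‖w‖ →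
      w ∈ Complex.slitPlane ∧ (invRoot α w).im ≠ 0 ∧ |(X (invRoot α w)).re| ≤ 1 := by
    obtain ⟨R₁, hR₁, h1⟩ := exists_norm_invRoot_lt hα1.le hρ
    set ζ := min ((α - 1) * Real.pi) (Real.pi / 2) with hζ
    have hζ0 : 0 < ζ := lt_min (mul_pos (by linarith) hpi) (by positivity)
    have hζ1 : ζ ≤ Real.pi / 2 := min_le_right _ _
    have hζ2 : ζ ≤ (α - 1) * Real.pi := min_le_left _ _
    have hsin : 0 < Real.sin ζ := Real.sin_pos_of_pos_of_lt_pi hζ0 (by linarith)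
    refine ⟨max R₁ (max 3 (3 / Real.sin ζ)), by
      exact lt_of_lt_of_le (by norm_num) ((le_max_left (3:ℝ) _).trans (le_max_right _ _)),
      fun w hw1 hw2 hw3 => ?_⟩
    have hwR₁ : R₁ ≤ ‖w‖ := (le_max_left _ _).trans hw3
    have hw3' : 3 ≤ ‖w‖ := (le_max_left _ _).trans ((le_max_right _ _).trans hw3)
    have hwζ : 3 / Real.sin ζ ≤ ‖w‖ := (le_max_right _ _).trans ((le_max_right _ _).trans hw3)
    rw [div_le_iff₀ hsin] at hwζ
    have hw0 : w ≠ 0 := by rw [← norm_pos_iff]; linarith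
    have hwim : w.im ≠ 0 := by
      intro h
      have := Complex.norm_le_abs_re_add_abs_im w
      rw [h, abs_zero, add_zero, abs_of_nonpos hw2] at this
      linarith
    have hsl : w ∈ Complex.slitPlane := Or.inr hwim
    have hz0 := invRoot_ne_zero α hw0
    have harg1 : Real.pi / 2 ≤ |w.arg| := by
      by_contra! hlt
      rcases Complex.abs_arg_lt_pi_div_two_iff.1 hlt with h | h
      · linarith
      · exact hw0 h
    have harg2 : |w.arg| ≤ Real.pi / 2 + ζ := by
      by_contra! hlt
      have h3 : Real.cos |w.arg| < Real.cos (Real.pi / 2 + ζ) :=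
        Real.cos_lt_cos_of_nonneg_of_le_pi (by positivity) (Complex.abs_arg_le_pi w) hlt
      rw [Real.cos_abs, add_comm, Real.cos_add_pi_div_two] at h3
      have h4 := Complex.norm_mul_cos_arg w
      have : ‖w‖ * Real.cos w.arg < ‖w‖ * -Real.sin ζ := by gcongr
      linarith
    have hzarg : |(invRoot α w).arg| = |w.arg| / α := by
      rw [arg_invRoot hα1.le hsl, abs_mul, abs_neg, abs_of_pos (by positivity)]; ring
    obtain ⟨g1, g2⟩ := hcone (invRoot α w) (by
      rw [hzarg, le_div_iff₀ hα0]; linarith) (by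
      rw [hzarg, div_le_iff₀ hα0]; nlinarith) hz0
    exact ⟨hsl, g2, hXη _ g2 g1 (h1 w hwR₁)⟩
  obtain ⟨C, ρ', hρ', hC⟩ := exists_abs_re_le_of_deriv_isLittleO (s := 1) hα1.le hδ zero_le_one hX hX0
    (norm_deriv_le_exp_of_re_le_exp hα1.le hΦ (fun z hz => hX z (Or.inl hz)) hXup hXc hg)
    ⟨R, fun w hw1 _ hw3 => (hstrip w (by linarith) hw1.le hw3).2.2⟩
    (by
      intro ε hε
      refine ⟨max (R + 1) (8 / ε), fun w hw1 hw2 => ?_⟩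
      have hwR : R + 1 ≤ ‖w‖ := (le_max_left _ _).trans hw2
      have hwε : 8 / ε ≤ ‖w‖ := (le_max_right _ _).trans hw2
      have hball : ∀ v ∈ Metric.ball w 1, -2 ≤ v.re ∧ v.re ≤ 0 ∧ R ≤ ‖v‖ := by
        intro v hv
        have hv' : ‖v - w‖ < 1 := by simpa [dist_eq_norm] using hv
        have b1 := Complex.abs_re_le_norm (v - w)
        rw [Complex.sub_re, hw1, abs_le] at b1
        have b2 := norm_sub_norm_le w v
        rw [norm_sub_rev] at b2
        exact ⟨by linarith [b1.1], by linarith [b1.2], by linarith⟩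
      have := norm_deriv_le_of_abs_re_le (f := fun w => X (invRoot α w)) (c := w) (ρ := 1) (M := 1)
        one_pos one_pos (fun v hv => by
          obtain ⟨b1, b2, b3⟩ := hball v hv
          obtain ⟨s1, s2, -⟩ := hstrip v b1 b2 b3
          exact (DifferentiableAt.comp v (hX _ (Or.inl s2))
            (hasDerivAt_invRoot α s1).differentiableAt).differentiableWithinAt)
        (fun v hv => by
          obtain ⟨b1, b2, b3⟩ := hball v hv
          exact (hstrip v b1 b2 b3).2.2)
      rw [div_le_iff₀ hε] at hwε
      linarith)
  refine ⟨max C 1, min ρ ρ', lt_min hρ hρ', fun z h1 h2 h3 => ?_⟩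
  have h4 := (abs_lt.1 (Complex.abs_arg_lt_pi_div_two_iff.2 (Or.inl h1))).2
  have h5 : 0 ≤ z.arg := Complex.arg_nonneg_iff.2 h2.le
  have hz0 : z ≠ 0 := fun h => by simp [h] at h1
  rcases lt_or_ge z.arg β with h6 | h6
  · rw [← hXup z h2]
    refine (hC z (lt_of_le_of_ne h5 fun h => ?_) ?_
      (h3.trans_le (min_le_right _ _))).trans (le_max_left _ _)
    · have := (Complex.arg_eq_zero_iff.1 h.symm).2
      linarith
    · rw [← hαβ]; gcongr
  · refine (hΩ z h2 ?_ (h3.trans_le (min_le_left _ _))).trans (le_max_right _ _)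
    have := (hcone z (by rwa [abs_of_nonneg h5]) (by rw [abs_of_nonneg h5]; linarith) hz0).1
    rwa [abs_of_pos h2] at this

/-! ### A Phragmén–Lindelöf principle in a cusp -/

/-- A lower bound for the comparison function in a cusp: the hypotheses make the imaginary part of
`q ^ (-m) / (m κ)` at most `1` in absolute value, so that its exponential has argument at most
`1 < π / 3`. -/
theorem half_exp_le_re_exp_cpow {m κ : ℝ} (hm : 0 < m) (hκ : 0 < κ) {q : ℂ} (hq : 0 < q.re)
    (h : |q.im| ≤ κ * q.re ^ (m + 1)) (h1 : m * κ * q.re ^ m ≤ 1) (h2 : κ * q.re ^ m ≤ 1) :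
    Real.exp (1 / (m * κ) * 2 ^ (-m - 1) * q.re ^ (-m)) / 2 ≤
      (Complex.exp ((1 / (m * κ) : ℝ) * q ^ ((-m : ℝ) : ℂ))).re := by
  have hq0 : q ≠ 0 := fun h => by simp [h] at hq
  set A := 1 / (m * κ) with hA
  have hA0 : 0 < A := by positivity
  set t := q.re with ht
  have e : t ^ (m + 1) = t ^ m * t := by rw [Real.rpow_add hq, Real.rpow_one]
  have h3 : |q.im| ≤ κ * t ^ m * t := by rw [e] at h; linarith
  have hre := half_norm_rpow_le_re_cpow (α := m) hm.le hq (by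
    calc m * |q.im| ≤ m * (κ * t ^ m * t) := by gcongr
      _ = m * κ * t ^ m * t := by ring
      _ ≤ 1 * t := by gcongr
      _ = t := one_mul t)
  have hn : ‖q‖ ≤ 2 * t := by
    have := Complex.norm_le_abs_re_add_abs_im q
    rw [abs_of_pos hq] at this
    have h4 : κ * t ^ m * t ≤ 1 * t := by gcongr
    linarith
  have hn' : t ≤ ‖q‖ := Complex.re_le_norm q
  have hnm : 2 ^ (-m) * t ^ (-m) ≤ ‖q‖ ^ (-m) := by
    rw [← Real.mul_rpow (by norm_num) hq.le]
    exact Real.rpow_le_rpow_of_nonpos (norm_pos_iff.2 hq0) hn (by linarith)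
  have him : |A * (q ^ ((-m : ℝ) : ℂ)).im| ≤ 1 := by
    rw [im_cpow_ofReal hq0, abs_mul, abs_mul, abs_of_pos hA0,
      abs_of_nonneg (by positivity : 0 ≤ ‖q‖ ^ (-m))]
    have b1 : ‖q‖ ^ (-m) ≤ t ^ (-m) := Real.rpow_le_rpow_of_nonpos hq hn' (by linarith)
    have b2 : |Real.sin (-m * q.arg)| ≤ m * (κ * t ^ m) := by
      refine (Real.abs_sin_le_abs).trans ?_
      rw [abs_mul, abs_neg, abs_of_pos hm]
      gcongr
      refine (abs_arg_le_abs_im_div_re hq).trans ?_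
      rwa [div_le_iff₀ hq]
    calc A * (‖q‖ ^ (-m) * |Real.sin (-m * q.arg)|) ≤ A * (t ^ (-m) * (m * (κ * t ^ m))) := by gcongr
      _ = 1 := by rw [Real.rpow_neg hq.le, hA]; field_simp
  have hcos : 1 / 2 ≤ Real.cos (A * (q ^ ((-m : ℝ) : ℂ)).im) := by
    rw [← Real.cos_pi_div_three, ← Real.cos_abs (A * _)]
    exact Real.cos_le_cos_of_nonneg_of_le_pi (abs_nonneg _) (by linarith [Real.pi_pos])
      (him.trans (by linarith [Real.pi_gt_three]))
  rw [Complex.exp_re, Complex.re_ofReal_mul, Complex.im_ofReal_mul, div_eq_mul_inv]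
  have e2 : A * 2 ^ (-m - 1) * t ^ (-m) ≤ A * (q ^ ((-m : ℝ) : ℂ)).re := by
    have e3 : (2 : ℝ) ^ (-m - 1) = 2 ^ (-m) / 2 := by
      rw [Real.rpow_sub (by norm_num), Real.rpow_one]
    rw [e3, mul_assoc]
    gcongr
    linarith
  gcongr
  linarith

theorem re_exp_cpow_le {m A : ℝ} (hm : 0 < m) (hA : 0 ≤ A) {q : ℂ} (hq : 0 < q.re) :
    (Complex.exp ((A : ℝ) * q ^ ((-m : ℝ) : ℂ))).re ≤ Real.exp (A * q.re ^ (-m)) := by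
  refine (Complex.re_le_norm _).trans ?_
  rw [Complex.norm_exp, Complex.re_ofReal_mul]
  refine Real.exp_le_exp.2 ?_
  gcongr
  refine (Complex.re_le_norm _).trans ?_
  rw [Complex.norm_cpow_real]
  exact Real.rpow_le_rpow_of_nonpos hq (Complex.re_le_norm q) (by linarith)

/-- A Phragmén–Lindelöf principle in the cusp `|y| < κ₀ x ^ (m + 1)`, for growth below
`exp (exp (ε |y| ^ (-m / (m + 1))))`. On the curve `|y| = κ t ^ (m + 1)` this bound is
`exp (exp (const · ε t ^ (-m)))`, which is dominated by `exp (η Re g)` with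
`g = exp (A (z - ρ) ^ (-m))`. So the cusp is replaced by a smaller domain bounded near its vertex by
such a curve issuing from `ρ > 0`; then `ρ → 0` and `η → 0`. -/
theorem norm_le_of_double_exp_growth_on_cusp {f : ℂ → ℂ} {m κ₀ δ C x₁ : ℝ} (hm : 0 < m)
    (hκ₀ : 0 < κ₀) (hx₁ : 0 < x₁) (hxδ : x₁ < δ) (hC : 1 ≤ C)
    (hmκ : m * (κ₀ * 2 ^ (m + 1)) * x₁ ^ m ≤ 1) (hκx : κ₀ * 2 ^ (m + 1) * x₁ ^ m ≤ 1)
    (hf : ∀ z : ℂ, 0 < z.re → z.re < δ → DifferentiableAt ℂ f z)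
    (hside : ∀ z : ℂ, 0 < z.re → z.re ≤ x₁ → |z.im| = κ₀ * z.re ^ (m + 1) → ‖f z‖ ≤ C)
    (hend : ∀ z : ℂ, z.re = x₁ → |z.im| ≤ κ₀ * z.re ^ (m + 1) → ‖f z‖ ≤ C)
    (hg : ∀ ε > 0, ∃ ρ > 0, ∀ z : ℂ, z.im ≠ 0 → 0 < z.re → z.re < ρ →
      |z.im| ≤ κ₀ * z.re ^ (m + 1) → ‖f z‖ ≤ Real.exp (Real.exp (ε * |z.im| ^ (-(m / (m + 1)))))) :
    ∀ z : ℂ, 0 < z.re → z.re < x₁ → |z.im| < κ₀ * z.re ^ (m + 1) → ‖f z‖ ≤ C := by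
  set κ := κ₀ * 2 ^ (m + 1) with hκdef
  have hκ : 0 < κ := by positivity
  set A := 1 / (m * κ) with hA
  have hA0 : 0 < A := by positivity
  set B := A * 2 ^ (-m - 1) with hB
  have hB0 : 0 < B := by positivity
  -- the comparison function with its singularity at `ρ`
  set g : ℝ → ℂ → ℂ := fun ρ z => Complex.exp ((A : ℝ) * (z - ρ) ^ ((-m : ℝ) : ℂ)) with hgdef
  have hgd : ∀ ρ : ℝ, ∀ z : ℂ, ρ < z.re → DifferentiableAt ℂ (g ρ) z := by
    intro ρ z hz
    have : z - ρ ∈ Complex.slitPlane := Or.inl (by simpa using hz)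
    have d : DifferentiableAt ℂ (fun z : ℂ => (z - ρ) ^ ((-m : ℝ) : ℂ)) z :=
      DifferentiableAt.cpow (by fun_prop) (by fun_prop) this
    exact (d.const_mul _).cexp
  have hglow : ∀ ρ : ℝ, 0 < ρ → ∀ z : ℂ, ρ < z.re → z.re ≤ x₁ →
      |z.im| ≤ κ * (z.re - ρ) ^ (m + 1) →
      Real.exp (B * (z.re - ρ) ^ (-m)) / 2 ≤ (g ρ z).re := by
    intro ρ hρ z h1 h2 h3
    have hq : 0 < (z - ρ).re := by simpa using h1
    have hle : (z - ρ).re ^ m ≤ x₁ ^ m :=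
      Real.rpow_le_rpow hq.le (by simp; linarith) hm.le
    have := half_exp_le_re_exp_cpow hm hκ hq (by simpa using h3)
      ((by gcongr : m * κ * (z - ρ).re ^ m ≤ m * κ * x₁ ^ m).trans hmκ)
      ((by gcongr : κ * (z - ρ).re ^ m ≤ κ * x₁ ^ m).trans hκx)
    simpa only [Complex.sub_re, Complex.ofReal_re] using this
  have main : ∀ η > 0, ∀ᶠ ρ : ℝ in 𝓝[>] 0, ∀ z : ℂ, ρ < z.re → z.re < x₁ →
      |z.im| < κ₀ * z.re ^ (m + 1) → |z.im| < κ * (z.re - ρ) ^ (m + 1) →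
      ‖f z‖ ≤ C * Real.exp (η * (g ρ z).re) := by
    intro η hη
    -- with this `ε` the outer exponent of the growth bound on the new sides is `exp (B t ^ (-m) / 2)`,
    -- the square root of `exp (B t ^ (-m)) ≤ 2 Re g`
    set ε := B / 2 * κ ^ (m / (m + 1)) with hε
    obtain ⟨ρ₀, hρ₀, hgr⟩ := hg ε (by positivity)
    have hev := eventually_div_sq_le_exp hm (show 0 < B / 2 by positivity) 1
    obtain ⟨y₀, hy₀, hy⟩ := mem_nhdsGT_iff_exists_Ioo_subset.1 hev
    have hy₀ : 0 < y₀ := hy₀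
    have hη' : 0 < min (min (ρ₀ / 2) y₀) (min x₁ (min 1 (η / 2))) := by positivity
    filter_upwards [Ioo_mem_nhdsGT hη'] with ρ hρ
    obtain ⟨hρ, hρ'⟩ := hρ
    rw [lt_min_iff, lt_min_iff, lt_min_iff, lt_min_iff] at hρ'
    obtain ⟨⟨hρ1, hρ2⟩, hρ3, hρ4, hρ5⟩ := hρ'
    set D : Set ℂ := {z | (ρ < z.re ∧ z.re < x₁) ∧
      |z.im| < κ₀ * z.re ^ (m + 1) ∧ |z.im| < κ * (z.re - ρ) ^ (m + 1)} with hD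
    have hm1 : 0 ≤ m + 1 := by linarith
    have c0 : Continuous fun z : ℂ => |z.im| := by fun_prop
    have c1 : Continuous fun z : ℂ => κ₀ * z.re ^ (m + 1) :=
      continuous_const.mul (Complex.continuous_re.rpow_const fun _ => Or.inr hm1)
    have c2 : Continuous fun z : ℂ => κ * (z.re - ρ) ^ (m + 1) :=
      continuous_const.mul ((Complex.continuous_re.sub continuous_const).rpow_const
        fun _ => Or.inr hm1)
    have hDo : IsOpen D :=
      ((isOpen_lt continuous_const Complex.continuous_re).inter
        (isOpen_lt Complex.continuous_re continuous_const)).inter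
        ((isOpen_lt c0 c1).inter (isOpen_lt c0 c2))
    have hcl : closure D ⊆ {z | (ρ ≤ z.re ∧ z.re ≤ x₁) ∧
        |z.im| ≤ κ₀ * z.re ^ (m + 1) ∧ |z.im| ≤ κ * (z.re - ρ) ^ (m + 1)} :=
      closure_minimal (fun z hz => ⟨⟨hz.1.1.le, hz.1.2.le⟩, hz.2.1.le, hz.2.2.le⟩)
        (((isClosed_le continuous_const Complex.continuous_re).inter
        (isClosed_le Complex.continuous_re continuous_const)).inter
        ((isClosed_le c0 c1).inter (isClosed_le c0 c2)))
    have hbd : Bornology.IsBounded D := by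
      refine (Metric.isBounded_closedBall (x := (0 : ℂ)) (r := x₁ + κ₀ * x₁ ^ (m + 1))).subset ?_
      intro z hz
      rw [mem_closedBall_zero_iff]
      refine (Complex.norm_le_abs_re_add_abs_im z).trans ?_
      have h0 : 0 < z.re := hρ.trans hz.1.1
      rw [abs_of_pos h0]
      have : κ₀ * z.re ^ (m + 1) ≤ κ₀ * x₁ ^ (m + 1) := by
        have := hz.1.2.le
        gcongr
      linarith [hz.1.2, hz.2.1]
    have hgpos : ∀ z : ℂ, ρ < z.re → z.re ≤ x₁ → |z.im| ≤ κ * (z.re - ρ) ^ (m + 1) →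
        0 ≤ (g ρ z).re := fun z h1 h2 h3 =>
      le_trans (by positivity) (hglow ρ hρ z h1 h2 h3)
    have key := norm_le_of_frontier_limsup_off_finset hDo hbd
      (f := fun z => f z * Complex.exp (-((η : ℂ) * g ρ z))) (C := C) ?_ (by linarith) {(ρ : ℂ)}
      ?_ ?_ ?_
    · intro z h1 h2 h3 h4
      have := key z ⟨⟨h1, h2⟩, h3, h4⟩
      rw [norm_mul, Complex.norm_exp, Complex.neg_re, Complex.re_ofReal_mul, Real.exp_neg,
        ← div_eq_mul_inv, div_le_iff₀ (Real.exp_pos _)] at this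
      exact this
    · intro z hz
      exact ((hf z (hρ.trans hz.1.1) (hz.1.2.trans hxδ)).mul
        ((hgd ρ z hz.1.1).const_mul _).neg.cexp).differentiableWithinAt
    · intro ζ hζ hζS η' hη'
      rw [hDo.frontier_eq] at hζ
      obtain ⟨⟨h1, h2⟩, h3, h4⟩ := hcl hζ.1
      have h5 : ρ < ζ.re := by
        refine lt_of_le_of_ne h1 fun h => hζS ?_
        rw [← h, sub_self, Real.zero_rpow (by linarith), mul_zero] at h4
        have : ζ = ρ := Complex.ext (by simp [h]) (by simpa using h4)
        simp [this]
      have h6 : 0 < ζ.re := hρ.trans h5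
      have hval : ‖f ζ * Complex.exp (-((η : ℂ) * g ρ ζ))‖ ≤ C := by
        have hgp := hgpos ζ h5 h2 h4
        rw [norm_mul, Complex.norm_exp, Complex.neg_re, Complex.re_ofReal_mul, Real.exp_neg,
          ← div_eq_mul_inv, div_le_iff₀ (Real.exp_pos _)]
        have hone : C ≤ C * Real.exp (η * (g ρ ζ).re) :=
          le_mul_of_one_le_right (by linarith) (Real.one_le_exp (by positivity))
        rcases h2.eq_or_lt with h | hlt
        · exact (hend ζ h h3).trans hone
        rcases h3.eq_or_lt with h | hlt'
        · exact (hside ζ h6 h2 h).trans hone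
        have heq : |ζ.im| = κ * (ζ.re - ρ) ^ (m + 1) := by
          by_contra hne
          exact hζ.2 ⟨⟨h5, hlt⟩, hlt', lt_of_le_of_ne h4 hne⟩
        set t := ζ.re - ρ with ht
        have ht0 : 0 < t := by linarith
        -- the new side is inside the cusp only for `Re ζ < 2ρ`, because `κ = 2 ^ (m + 1) κ₀`
        have ht1 : t < ρ := by
          have h7 : κ₀ * (2 * t) ^ (m + 1) < κ₀ * ζ.re ^ (m + 1) := by
            rw [Real.mul_rpow (by norm_num) ht0.le, ← mul_assoc]
            linarith
          have := (Real.rpow_lt_rpow_iff (by positivity) h6.le (by linarith)).1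
            (lt_of_mul_lt_mul_left h7 hκ₀.le)
          linarith
        have him : ζ.im ≠ 0 := by
          rw [← abs_pos, heq]; positivity
        have e1 : ε * |ζ.im| ^ (-(m / (m + 1))) = B / 2 * t ^ (-m) := by
          rw [heq, Real.mul_rpow hκ.le (by positivity), ← Real.rpow_mul ht0.le,
            show (m + 1) * -(m / (m + 1)) = -m by field_simp, Real.rpow_neg hκ.le, hε]
          field_simp
        have e2 := hgr ζ him h6 (by linarith) h3
        rw [e1] at e2
        have e3 := hglow ρ hρ ζ h5 h2 h4
        have e4 : 1 / t ^ 2 ≤ Real.exp (B / 2 * t ^ (-m)) := hy ⟨ht0, by linarith⟩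
        have e5 : 2 / η ≤ 1 / t ^ 2 := by
          rw [div_le_div_iff₀ hη (by positivity)]
          nlinarith
        have e6 : Real.exp (B / 2 * t ^ (-m)) ≤ η * (g ρ ζ).re := by
          have e7 : Real.exp (B * t ^ (-m)) =
              Real.exp (B / 2 * t ^ (-m)) * Real.exp (B / 2 * t ^ (-m)) := by
            rw [← Real.exp_add]; ring_nf
          have e8 := e5.trans e4
          rw [div_le_iff₀ hη] at e8
          have p := Real.exp_pos (B / 2 * t ^ (-m))
          calc Real.exp (B / 2 * t ^ (-m)) = Real.exp (B / 2 * t ^ (-m)) * 2 / 2 := by ring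
            _ ≤ Real.exp (B / 2 * t ^ (-m)) * (Real.exp (B / 2 * t ^ (-m)) * η) / 2 := by gcongr
            _ = η * (Real.exp (B * t ^ (-m)) / 2) := by rw [e7]; ring
            _ ≤ _ := by gcongr
        calc ‖f ζ‖ ≤ 1 * Real.exp (η * (g ρ ζ).re) := by
              rw [one_mul]; exact e2.trans (Real.exp_le_exp.2 e6)
          _ ≤ _ := by gcongr
      have hcont : ContinuousAt (fun z => ‖f z * Complex.exp (-((η : ℂ) * g ρ z))‖) ζ :=
        ((hf ζ h6 (by linarith)).mul ((hgd ρ ζ h5).const_mul _).neg.cexp).continuousAt.norm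
      have := hcont.eventually (gt_mem_nhds (show ‖_‖ < C + η' by linarith))
      exact (this.filter_mono nhdsWithin_le_nhds).mono fun z hz => hz.le
    · intro ζ hζ
      rw [Finset.mem_singleton] at hζ
      subst hζ
      refine ⟨‖f ρ‖ + 1, ?_⟩
      have := ((hf ρ (by simpa) (by simp; linarith)).continuousAt.norm).eventually
        (gt_mem_nhds (show ‖f ρ‖ < ‖f ρ‖ + 1 by linarith))
      filter_upwards [this.filter_mono nhdsWithin_le_nhds, self_mem_nhdsWithin] with z hz hzD
      have := hgpos z hzD.1.1 hzD.1.2.le hzD.2.2.le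
      rw [norm_mul, Complex.norm_exp, Complex.neg_re, Complex.re_ofReal_mul]
      have : Real.exp (-(η * (g ρ z).re)) ≤ 1 :=
        Real.exp_le_one_iff.2 (neg_nonpos.2 (by positivity))
      calc _ ≤ ‖f z‖ * 1 := by gcongr
        _ ≤ _ := by linarith
    · intro ζ hζ hζD
      rw [Finset.mem_singleton] at hζ
      subst hζ
      exact absurd hζD.1.1 (by simp)
  intro z hz0 hz1 hz2
  have lim : Tendsto (fun η : ℝ => C * Real.exp (η * Real.exp (A * (z.re / 2) ^ (-m))))
      (𝓝[>] 0) (𝓝 (C * Real.exp (0 * Real.exp (A * (z.re / 2) ^ (-m))))) := by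
    have : Continuous fun η : ℝ => C * Real.exp (η * Real.exp (A * (z.re / 2) ^ (-m))) := by
      fun_prop
    exact (this.tendsto 0).mono_left nhdsWithin_le_nhds
  rw [zero_mul, Real.exp_zero, mul_one] at lim
  refine ge_of_tendsto lim ?_
  filter_upwards [self_mem_nhdsWithin] with η hη
  have hη : 0 < η := hη
  obtain ⟨ρ, h, hρ⟩ := ((main η hη).and (Ioo_mem_nhdsGT (show (0:ℝ) < z.re / 2 by linarith))).exists
  have hhalf : 0 < z.re / 2 := by linarith
  refine (h z (by linarith [hρ.2]) hz1 hz2 ?_).trans ?_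
  · refine hz2.trans_le ?_
    have e : κ₀ * z.re ^ (m + 1) = κ * (z.re / 2) ^ (m + 1) := by
      rw [Real.div_rpow hz0.le (by norm_num), hκdef]; field_simp
    rw [e]
    have : z.re / 2 ≤ z.re - ρ := by linarith [hρ.2]
    gcongr
  · have h1 : (g ρ z).re ≤ Real.exp (A * (z - ρ : ℂ).re ^ (-m)) :=
      re_exp_cpow_le hm hA0.le (by simp; linarith [hρ.2])
    have h2 : (z - ρ : ℂ).re ^ (-m) ≤ (z.re / 2) ^ (-m) :=
      Real.rpow_le_rpow_of_nonpos hhalf (by simp; linarith [hρ.2]) (by linarith)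
    have h3 : Real.exp (A * (z - ρ : ℂ).re ^ (-m)) ≤ Real.exp (A * (z.re / 2) ^ (-m)) := by
      gcongr
    have := h1.trans h3
    have hC0 : 0 ≤ C := by linarith
    gcongr

/-! ### Cusp corners -/

/-- Doubly exponential growth of the real part passes to the derivative of the reflected function;
`ε` absorbs the polynomial factors. -/
theorem norm_deriv_le_exp_exp_of_re_le_exp_exp {Φ X : ℂ → ℂ} {a : ℝ} (ha : 0 < a)
    (hΦ : DifferentiableOn ℂ Φ {z | 0 < z.im})
    (hX : ∀ z : ℂ, z.im ≠ 0 → DifferentiableAt ℂ X z)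
    (hXup : ∀ z : ℂ, 0 < z.im → X z = Φ z)
    (hXc : ∀ z : ℂ, z.im ≠ 0 → X ((starRingEnd ℂ) z) = - (starRingEnd ℂ) (X z))
    (hg : ∀ ε > 0, ∃ ρ > 0, ∀ z : ℂ, 0 < z.im → ‖z‖ < ρ →
      (Φ z).re ≤ Real.exp (Real.exp (ε * z.im ^ (-a)))) :
    ∀ ε > 0, ∃ ρ > 0, ∀ z : ℂ, z.im ≠ 0 → ‖z‖ < ρ →
      ‖deriv X z‖ ≤ Real.exp (Real.exp (ε * |z.im| ^ (-a))) := by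
  intro ε hε
  set c : ℝ := ε / (2 * 4 ^ a) with hc
  have hc0 : 0 < c := by positivity
  obtain ⟨ρ, hρ, h⟩ := hg c hc0
  obtain ⟨K, hK, ρ', hρ', h'⟩ := exists_norm_deriv_le_of_re_le hΦ hX hXup hXc
    (N := fun y => Real.exp (Real.exp (c * y ^ (-a)))) (fun y _ => (Real.exp_pos _).le)
    (fun y y' hy hyy => Real.exp_le_exp.2 (Real.exp_le_exp.2 (by
      have := Real.rpow_le_rpow_of_nonpos hy hyy (show -a ≤ 0 by linarith)
      gcongr))) hρ h
  have hev := eventually_div_sq_le_exp ha (show 0 < ε / 2 by positivity) (2 * K + 2)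
  obtain ⟨y₀, hy₀, hy⟩ := mem_nhdsGT_iff_exists_Ioo_subset.1 hev
  have hy₀ : 0 < y₀ := hy₀
  refine ⟨min ρ' (min y₀ 1), by positivity, fun z hz hzρ => ?_⟩
  rw [lt_min_iff, lt_min_iff] at hzρ
  obtain ⟨hz1, hz2, hz3⟩ := hzρ
  refine (h' z hz hz1).trans ?_
  have him : 0 < |z.im| := abs_pos.2 hz
  have him' := Complex.abs_im_le_norm z
  have h5 : (2 * K + 2) / |z.im| ^ 2 ≤ Real.exp (ε / 2 * |z.im| ^ (-a)) :=
    hy ⟨him, him'.trans_lt hz2⟩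
  have h6 : c * (|z.im| / 4) ^ (-a) = ε / 2 * |z.im| ^ (-a) := by
    rw [Real.div_rpow him.le (by norm_num), Real.rpow_neg (by norm_num : (0:ℝ) ≤ 4), hc]
    field_simp
  simp only [h6]
  set V := Real.exp (ε / 2 * |z.im| ^ (-a)) with hV
  have hy2 : |z.im| ^ 2 ≤ 1 := pow_le_one₀ him.le (by linarith)
  have hV2 : 2 ≤ V := by
    refine le_trans ?_ h5
    rw [le_div_iff₀ (by positivity)]
    nlinarith
  have hV3 : 2 * K / |z.im| ^ 2 ≤ V := by
    refine le_trans ?_ h5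
    gcongr; linarith
  have h7 : 1 ≤ Real.exp V := Real.one_le_exp (by linarith)
  have h8 : V ≤ Real.exp V := by linarith [Real.add_one_le_exp V]
  calc K * (Real.exp V + 1) / |z.im| ^ 2
      ≤ K * (Real.exp V + Real.exp V) / |z.im| ^ 2 := by gcongr
    _ = 2 * K / |z.im| ^ 2 * Real.exp V := by ring
    _ ≤ Real.exp V * Real.exp V := by gcongr; exact hV3.trans h8
    _ = Real.exp (V + V) := by rw [← Real.exp_add]
    _ ≤ Real.exp (V * V) := Real.exp_le_exp.2 (by nlinarith)
    _ = Real.exp (Real.exp (ε * |z.im| ^ (-a))) := by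
      rw [hV, ← Real.exp_add]; ring_nf

/-- The corner bound for boundedness along `|x| ≤ y ^ γ`. -/
theorem exists_abs_re_le_of_cusp_corner {Φ : ℂ → ℂ} {δ γ : ℝ} (hδ : 0 < δ) (hγ0 : 0 < γ)
    (hγ1 : γ < 1) (hΦ : DifferentiableOn ℂ Φ {z | 0 < z.im})
    (h0 : ∀ t : ℝ, 0 < t → t < δ →
      Tendsto (fun z => (Φ z).re) (𝓝[{z : ℂ | 0 < z.im}] (t : ℂ)) (𝓝 0))
    (hΩ : ∃ ρ > 0, ∀ z : ℂ, 0 < z.im → |z.re| ≤ z.im ^ γ → ‖z‖ < ρ → |(Φ z).re| ≤ 1)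
    (hg : ∀ ε > 0, ∃ ρ > 0, ∀ z : ℂ, 0 < z.im → ‖z‖ < ρ →
      (Φ z).re ≤ Real.exp (Real.exp (ε * z.im ^ (γ - 1)))) :
    ∃ C, ∃ ρ > 0, ∀ z : ℂ, 0 < z.re → 0 < z.im → ‖z‖ < ρ → |(Φ z).re| ≤ C := by
  obtain ⟨X, hX, hXup, hXc, hX0⟩ := exists_reflection hΦ h0
  obtain ⟨ρΩ, hρΩ, hΩ⟩ := hΩ
  have hXΩ := abs_re_le_of_reflection (h := fun t => t ^ γ) hXup hXc hΩ
  set m := 1 / γ - 1 with hm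
  have hm0 : 0 < m := by rw [hm, sub_pos, lt_div_iff₀ hγ0]; linarith
  have hmγ : (m + 1) * γ = 1 := by rw [hm]; field_simp; ring
  have hma : -(m / (m + 1)) = γ - 1 := by
    have : m + 1 = 1 / γ := by rw [hm]; ring
    rw [this, hm]; field_simp; ring
  -- The curve `|y| = κ₀ x ^ (m + 1)` lies so far inside the region `|x| ≤ |y| ^ γ` that the disc of
  -- radius `|y| / 2` around each of its points does as well.
  set κ₀ : ℝ := 2 ^ (m + 2) with hκ₀
  have hκ0 : 0 < κ₀ := by positivity
  have hder := norm_deriv_le_exp_exp_of_re_le_exp_exp (a := 1 - γ) (by linarith) hΦ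
    (fun z hz => hX z (Or.inl hz)) hXup hXc (by simpa using hg)
  -- choice of the end `x₁` of the cusp
  obtain ⟨x₁, hx0, hxδ, hx1, hxρ, hxm, hxκ⟩ : ∃ x₁ > 0, x₁ < δ ∧ x₁ ≤ 1 / 2 ∧ 4 * x₁ < ρΩ ∧
      m * (κ₀ * 2 ^ (m + 1)) * x₁ ^ m ≤ 1 ∧ κ₀ * 2 ^ (m + 1) * x₁ ^ m ≤ 1 := by
    have t0 : Tendsto (fun x : ℝ => x ^ m) (𝓝[>] 0) (𝓝 0) := by
      have := (Real.continuousAt_rpow_const 0 m (Or.inr hm0.le)).tendsto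
      rw [Real.zero_rpow hm0.ne'] at this
      exact this.mono_left nhdsWithin_le_nhds
    have t1 := (t0.const_mul (m * (κ₀ * 2 ^ (m + 1)))).eventually
      (ge_mem_nhds (show _ < (1:ℝ) by rw [mul_zero]; exact one_pos))
    have t2 := (t0.const_mul (κ₀ * 2 ^ (m + 1))).eventually
      (ge_mem_nhds (show _ < (1:ℝ) by rw [mul_zero]; exact one_pos))
    have hmin : 0 < min δ (min (1 / 2) (ρΩ / 4)) := by positivity
    obtain ⟨x, ⟨h1, h2⟩, h3, h4⟩ := ((t1.and t2).and (Ioo_mem_nhdsGT hmin)).exists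
    rw [lt_min_iff, lt_min_iff] at h4
    exact ⟨x, h3, h4.1, h4.2.1.le, by linarith [h4.2.2], h1, h2⟩
  -- in the cusp the modulus is comparable to the real part
  have hyx : ∀ x : ℝ, 0 < x → x ≤ x₁ → κ₀ * x ^ (m + 1) ≤ x := by
    intro x h1 h2
    rw [Real.rpow_add h1, Real.rpow_one, ← mul_assoc]
    have e1 : x ^ m ≤ x₁ ^ m := Real.rpow_le_rpow h1.le h2 hm0.le
    have e2 : (1 : ℝ) ≤ 2 ^ (m + 1) := Real.one_le_rpow (by norm_num) (by linarith)
    have e3 : κ₀ * x ^ m ≤ 1 := by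
      calc κ₀ * x ^ m ≤ κ₀ * 1 * x₁ ^ m := by rw [mul_one]; gcongr
        _ ≤ κ₀ * 2 ^ (m + 1) * x₁ ^ m := by gcongr
        _ ≤ 1 := hxκ
    exact mul_le_of_le_one_left h1.le e3
  have hnorm : ∀ z : ℂ, 0 < z.re → z.re ≤ x₁ → |z.im| ≤ κ₀ * z.re ^ (m + 1) → ‖z‖ ≤ 2 * z.re := by
    intro z h1 h2 h3
    have := Complex.norm_le_abs_re_add_abs_im z
    rw [abs_of_pos h1] at this
    linarith [hyx _ h1 h2]
  -- the power compensates the size `O(1 / |y|)` of the derivative on the sides of the cusp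
  set f : ℂ → ℂ := fun z => deriv X z * z ^ ((m + 1 : ℝ) : ℂ) with hf
  have hfn : ∀ z : ℂ, 0 < z.re → ‖f z‖ = ‖deriv X z‖ * ‖z‖ ^ (m + 1) := by
    intro z hz
    simp only [hf]
    rw [norm_mul, Complex.norm_cpow_real]
  have hfd : ∀ z : ℂ, 0 < z.re → z.re < δ → DifferentiableAt ℂ f z := by
    intro z h1 h2
    have hS : IsOpen {z : ℂ | 0 < z.re ∧ z.re < δ} :=
      (isOpen_lt continuous_const Complex.continuous_re).inter
        (isOpen_lt Complex.continuous_re continuous_const)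
    have hd : DifferentiableOn ℂ X {z : ℂ | 0 < z.re ∧ z.re < δ} := fun w hw =>
      (hX w (Or.inr hw)).differentiableWithinAt
    have d1 : DifferentiableAt ℂ (deriv X) z :=
      (hd.deriv hS).differentiableAt (hS.mem_nhds ⟨h1, h2⟩)
    exact d1.mul (DifferentiableAt.cpow (by fun_prop) (by fun_prop) (Or.inl h1))
  have hside : ∀ z : ℂ, 0 < z.re → z.re ≤ x₁ → |z.im| = κ₀ * z.re ^ (m + 1) → ‖f z‖ ≤ 8 := by
    intro z h1 h2 h3
    have hy0 : 0 < |z.im| := by rw [h3]; positivity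
    have hyx' : |z.im| ≤ z.re := h3.trans_le (hyx _ h1 h2)
    have hball : ∀ v ∈ Metric.ball z (|z.im| / 2), v.im ≠ 0 ∧ |(X v).re| ≤ 1 := by
      intro v hv
      have hv' : ‖v - z‖ < |z.im| / 2 := by simpa [dist_eq_norm] using hv
      have b1 := Complex.abs_re_le_norm (v - z)
      have b2 := Complex.abs_im_le_norm (v - z)
      rw [Complex.sub_re] at b1
      rw [Complex.sub_im] at b2
      have b3 : |z.im| / 2 ≤ |v.im| := by
        have := abs_sub_abs_le_abs_sub z.im v.im
        rw [abs_sub_comm] at this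
        linarith
      have b4 : v.im ≠ 0 := by rw [← abs_pos]; linarith
      refine ⟨b4, hXΩ v b4 ?_ ?_⟩
      · have e1 : (2 * z.re) ^ (m + 1) ≤ |v.im| := by
          refine le_trans (le_of_eq ?_) b3
          rw [h3, hκ₀, Real.mul_rpow (by norm_num) h1.le, show m + 2 = m + 1 + 1 by ring,
            Real.rpow_add (by norm_num : (0:ℝ) < 2) (m + 1) 1, Real.rpow_one]
          ring
        have e2 : 2 * z.re ≤ |v.im| ^ γ := by
          have := Real.rpow_le_rpow (by positivity) e1 hγ0.le
          rwa [← Real.rpow_mul (by positivity), hmγ, Real.rpow_one] at this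
        refine le_trans ?_ e2
        have b5 := abs_le.1 (b1.trans hv'.le)
        rw [abs_le]
        constructor <;> linarith [b5.1, b5.2]
      · have : v = (v - z) + z := by ring
        rw [this]
        refine (norm_add_le _ _).trans_lt ?_
        linarith [hnorm z h1 h2 h3.le]
    have hdz := norm_deriv_le_of_abs_re_le (f := X) (c := z) (ρ := |z.im| / 2) (M := 1)
      (by positivity) one_pos (fun v hv => (hX v (Or.inl (hball v hv).1)).differentiableWithinAt)
      (fun v hv => (hball v hv).2)
    rw [hfn z h1]
    have e3 : ‖z‖ ^ (m + 1) ≤ |z.im| / 2 := by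
      have := Real.rpow_le_rpow (norm_nonneg z) (hnorm z h1 h2 h3.le) (show 0 ≤ m + 1 by linarith)
      refine this.trans (le_of_eq ?_)
      rw [h3, hκ₀, Real.mul_rpow (by norm_num) h1.le, show m + 2 = m + 1 + 1 by ring,
        Real.rpow_add (by norm_num : (0:ℝ) < 2) (m + 1) 1, Real.rpow_one]
      ring
    calc ‖deriv X z‖ * ‖z‖ ^ (m + 1) ≤ 8 * 1 / (|z.im| / 2) * (|z.im| / 2) := by gcongr
      _ = 8 := by field_simp
  obtain ⟨M, hM⟩ : ∃ M, ∀ z : ℂ, z.re = x₁ → |z.im| ≤ κ₀ * z.re ^ (m + 1) → ‖f z‖ ≤ M := by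
    have hK : IsCompact ({x₁} ×ℂ Set.Icc (-(κ₀ * x₁ ^ (m + 1))) (κ₀ * x₁ ^ (m + 1))) :=
      isCompact_singleton.reProdIm isCompact_Icc
    obtain ⟨M, hM⟩ := hK.exists_bound_of_continuousOn (f := f) (fun z hz => by
      have : z.re = x₁ := hz.1
      exact (hfd z (by linarith) (by linarith)).continuousAt.continuousWithinAt)
    exact ⟨M, fun z h1 h2 => hM z ⟨h1, abs_le.1 (by rwa [h1] at h2)⟩⟩
  set C := max 8 M with hC
  have hcusp := norm_le_of_double_exp_growth_on_cusp (f := f) (δ := δ) (C := C) hm0 hκ0 hx0 hxδ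
    ((by norm_num : (1:ℝ) ≤ 8).trans (le_max_left _ _)) hxm hxκ hfd
    (fun z h1 h2 h3 => (hside z h1 h2 h3).trans (le_max_left _ _))
    (fun z h1 h2 => (hM z h1 h2).trans (le_max_right _ _))
    (by
      intro ε hε
      obtain ⟨ρ, hρ, h⟩ := hder ε hε
      refine ⟨min x₁ (ρ / 2), by positivity, fun z him h1 h2 h3 => ?_⟩
      rw [lt_min_iff] at h2
      have hn := hnorm z h1 h2.1.le h3
      have := h z him (by linarith)
      rw [hfn z h1, hma]
      rw [neg_sub] at this
      have e : ‖z‖ ^ (m + 1) ≤ 1 := Real.rpow_le_one (norm_nonneg _) (by linarith) (by linarith)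
      calc _ ≤ Real.exp (Real.exp (ε * |z.im| ^ (γ - 1))) * 1 := by gcongr
        _ = _ := mul_one _)
  have hC0 : 0 < C := lt_of_lt_of_le (by norm_num) (le_max_left 8 M)
  refine ⟨max 1 (C * κ₀), min x₁ ρΩ, by positivity, fun z h1 h2 h3 => ?_⟩
  rw [lt_min_iff] at h3
  rcases le_or_gt (κ₀ * z.re ^ (m + 1)) z.im with h4 | h4
  · refine (hΩ z h2 ?_ h3.2).trans (le_max_left _ _)
    have e1 : z.re ^ (m + 1) ≤ z.im := by
      have : (1 : ℝ) ≤ κ₀ := Real.one_le_rpow (by norm_num) (by linarith)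
      refine le_trans ?_ h4
      exact le_mul_of_one_le_left (by positivity) this
    have := Real.rpow_le_rpow (by positivity) e1 hγ0.le
    rwa [← Real.rpow_mul h1.le, hmγ, Real.rpow_one, ← abs_of_pos h1] at this
  · refine le_trans ?_ (le_max_right _ _)
    have hzx : z.re < x₁ := (Complex.re_le_norm z).trans_lt h3.1
    rw [← hXup z h2]
    -- integration of `X'` along the vertical segment from the real axis, where `Re X = 0`
    have hseg : ∀ w ∈ segment ℝ (z.re : ℂ) z, w.re = z.re ∧ 0 ≤ w.im ∧ w.im ≤ z.im := by
      intro w hw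
      rw [segment_eq_image'] at hw
      obtain ⟨t, ⟨ht0, ht1⟩, rfl⟩ := hw
      simp
      exact ⟨by positivity, mul_le_of_le_one_left h2.le ht1⟩
    have hmv := (convex_segment (z.re : ℂ) z).norm_image_sub_le_of_norm_deriv_le (f := X)
      (C := C / z.re ^ (m + 1)) (fun w hw => by
        have := (hseg w hw).1
        exact hX w (Or.inr (by constructor <;> linarith)))
      (fun w hw => by
        obtain ⟨e1, e2, e3⟩ := hseg w hw
        have := hcusp w (by linarith) (by linarith) (by
          rw [abs_of_nonneg e2, e1]; linarith)
        rw [hfn w (by linarith)] at this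
        rw [le_div_iff₀ (by positivity)]
        refine le_trans ?_ this
        have : z.re ≤ ‖w‖ := e1 ▸ Complex.re_le_norm w
        gcongr)
      (left_mem_segment _ _ _) (right_mem_segment _ _ _)
    have e0 := hX0 z.re h1 (by linarith)
    have e1 : |(X z).re| ≤ ‖X z - X z.re‖ := by
      have := Complex.abs_re_le_norm (X z - X z.re)
      rwa [Complex.sub_re, e0, sub_zero] at this
    have e2 : ‖z - (z.re : ℂ)‖ = z.im := by
      have : z - (z.re : ℂ) = (z.im : ℂ) * Complex.I := by
        apply Complex.ext <;> simp
      rw [this, norm_mul, Complex.norm_I, mul_one, Complex.norm_real, Real.norm_of_nonneg h2.le]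
    rw [e2] at hmv
    refine e1.trans (hmv.trans ?_)
    rw [div_mul_eq_mul_div, div_le_iff₀ (by positivity)]
    rw [mul_assoc]
    gcongr

/-! ### The category argument -/

/-- `ReVanishesAt Ψ x`: the real part of `Ψ`, a function on the upper half-plane, has the
unrestricted boundary limit zero at the real point `x`. -/
def ReVanishesAt (Ψ : ℂ → ℂ) (x : ℝ) : Prop :=
  Tendsto (fun z => (Ψ z).re) (𝓝[{z : ℂ | 0 < z.im}] (x : ℂ)) (𝓝 0)

theorem ReVanishesAt.neg {Ψ : ℂ → ℂ} {x : ℝ} (h : ReVanishesAt Ψ x) :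
    ReVanishesAt (fun z => -Ψ z) x := by
  have := Tendsto.neg h
  simpa [ReVanishesAt] using this

/-- A bound over a closed set `F ⊆ ℝ` and on top extends to the whole box over `[p, q]`, if the real
part vanishes at the real points outside `F` and is bounded, by some constants, at the corners of the
components of the complement of `F`. These constants do not enter the conclusion. -/
theorem re_le_of_bound_over_closed_set {Ψ : ℂ → ℂ} (hΨ : DifferentiableOn ℂ Ψ {z | 0 < z.im})
    {F : Set ℝ} (hFc : IsClosed F) {p q η C : ℝ} (hp : p ∈ F) (hq : q ∈ F) (hC : 0 ≤ C)
    (hF : ∀ x ∈ F, p ≤ x → x ≤ q → ∀ y : ℝ, 0 < y → y ≤ η → (Ψ (x + y * Complex.I)).re ≤ C)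
    (htop : ∀ x : ℝ, p ≤ x → x ≤ q → (Ψ (x + η * Complex.I)).re ≤ C)
    (h0 : ∀ x : ℝ, p < x → x < q → x ∉ F → ReVanishesAt Ψ x)
    (hR : ∀ x ∈ F, p ≤ x → x < q → ∀ δ > 0, (∀ t : ℝ, x < t → t < x + δ → ReVanishesAt Ψ t) →
      ∃ M, ∃ ρ > 0, ∀ z : ℂ, x < z.re → 0 < z.im → ‖z - x‖ < ρ → (Ψ z).re ≤ M)
    (hL : ∀ x ∈ F, p < x → x ≤ q → ∀ δ > 0, (∀ t : ℝ, x - δ < t → t < x → ReVanishesAt Ψ t) →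
      ∃ M, ∃ ρ > 0, ∀ z : ℂ, z.re < x → 0 < z.im → ‖z - x‖ < ρ → (Ψ z).re ≤ M) :
    ∀ z : ℂ, p < z.re → z.re < q → 0 < z.im → z.im < η → (Ψ z).re ≤ C := by
  intro z hz1 hz2 hz3 hz4
  by_cases hzF : z.re ∈ F
  · have := hF _ hzF hz1.le hz2.le z.im hz3 hz4.le
    rwa [Complex.re_add_im] at this
  -- the component `(a, b)` of the complement of `F` below `z`
  obtain ⟨a, haF, hpa, haz, ha⟩ : ∃ a ∈ F, p ≤ a ∧ a < z.re ∧ ∀ t, a < t → t ≤ z.re → t ∉ F := by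
    have hne : (F ∩ Set.Iic z.re).Nonempty := ⟨p, hp, hz1.le⟩
    have hbdd : BddAbove (F ∩ Set.Iic z.re) := ⟨z.re, fun t ht => ht.2⟩
    have hmem := (hFc.inter isClosed_Iic).csSup_mem hne hbdd
    refine ⟨_, hmem.1, le_csSup hbdd ⟨hp, hz1.le⟩, lt_of_le_of_ne hmem.2 fun h => hzF (h ▸ hmem.1),
      fun t ht1 ht2 htF => ?_⟩
    exact absurd (le_csSup hbdd ⟨htF, ht2⟩) (not_le.2 ht1)
  obtain ⟨b, hbF, hbq, hzb, hb⟩ : ∃ b ∈ F, b ≤ q ∧ z.re < b ∧ ∀ t, z.re ≤ t → t < b → t ∉ F := by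
    have hne : (F ∩ Set.Ici z.re).Nonempty := ⟨q, hq, hz2.le⟩
    have hbdd : BddBelow (F ∩ Set.Ici z.re) := ⟨z.re, fun t ht => ht.2⟩
    have hmem := (hFc.inter isClosed_Ici).csInf_mem hne hbdd
    refine ⟨_, hmem.1, csInf_le hbdd ⟨hq, hz2.le⟩,
      lt_of_le_of_ne hmem.2 fun h => hzF (h ▸ hmem.1), fun t ht1 ht2 htF => ?_⟩
    exact absurd (csInf_le hbdd ⟨htF, ht1⟩) (not_le.2 ht2)
  have hab : ∀ t : ℝ, a < t → t < b → ReVanishesAt Ψ t := fun t h1 h2 =>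
    h0 t (by linarith) (by linarith) (by
      rcases le_total t z.re with h | h
      · exact ha t h1 h
      · exact hb t h h2)
  set D : Set ℂ := {w | (a < w.re ∧ w.re < b) ∧ 0 < w.im ∧ w.im < η} with hD
  have hDo : IsOpen D :=
    ((isOpen_lt continuous_const Complex.continuous_re).inter
      (isOpen_lt Complex.continuous_re continuous_const)).inter
      ((isOpen_lt continuous_const Complex.continuous_im).inter
      (isOpen_lt Complex.continuous_im continuous_const))
  have hcl : closure D ⊆ {w | (a ≤ w.re ∧ w.re ≤ b) ∧ 0 ≤ w.im ∧ w.im ≤ η} :=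
    closure_minimal (fun w hw => ⟨⟨hw.1.1.le, hw.1.2.le⟩, hw.2.1.le, hw.2.2.le⟩)
      (((isClosed_le continuous_const Complex.continuous_re).inter
      (isClosed_le Complex.continuous_re continuous_const)).inter
      ((isClosed_le continuous_const Complex.continuous_im).inter
      (isClosed_le Complex.continuous_im continuous_const)))
  have hbd : Bornology.IsBounded D := by
    have : Bornology.IsBounded (Set.Ioo a b ×ℂ Set.Ioo 0 η) :=
      (Metric.isBounded_Ioo a b).reProdIm (Metric.isBounded_Ioo 0 η)
    exact this.subset fun w hw => ⟨hw.1, hw.2⟩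
  have hDH : 𝓝[D] z ≤ 𝓝[{z : ℂ | 0 < z.im}] z := nhdsWithin_mono _ fun w hw => hw.2.1
  refine re_le_of_frontier_limsup_off_finset hDo hbd
    (fun w hw => (hΨ w hw.2.1).mono fun w hw => hw.2.1) {(a : ℂ), (b : ℂ)} ?_ ?_ ?_ z
    ⟨⟨haz, hzb⟩, hz3, hz4⟩
  · intro ζ hζ hζS ε hε
    rw [hDo.frontier_eq] at hζ
    obtain ⟨⟨h1, h2⟩, h3, h4⟩ := hcl hζ.1
    rcases h3.eq_or_lt with h5 | h5
    · have h6 : a < ζ.re := lt_of_le_of_ne h1 fun h => hζS (by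
        simp [show ζ = a from Complex.ext (by simp [h]) (by simp [← h5])])
      have h7 : ζ.re < b := lt_of_le_of_ne h2 fun h => hζS (by
        simp [show ζ = b from Complex.ext (by simp [h]) (by simp [← h5])])
      have h8 : ((ζ.re : ℝ) : ℂ) = ζ := Complex.ext (by simp) (by simp [← h5])
      have := (hab _ h6 h7).eventually (ge_mem_nhds (show (0:ℝ) < C + ε by linarith))
      rw [h8] at this
      exact this.filter_mono (nhdsWithin_mono _ fun w hw => hw.2.1)
    · have hval : (Ψ ζ).re ≤ C := by
        by_cases h6 : ζ.im = η
        · have := htop ζ.re (by linarith) (by linarith)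
          rwa [← h6, Complex.re_add_im] at this
        have h7 : ζ.im < η := lt_of_le_of_ne h4 h6
        have h8 : ζ.re ∈ F := by
          by_contra hne
          exact hζ.2 ⟨⟨lt_of_le_of_ne h1 fun h => hne (h ▸ haF),
            lt_of_le_of_ne h2 fun h => hne (h ▸ hbF)⟩, h5, h7⟩
        have := hF _ h8 (by linarith) (by linarith) ζ.im h5 h7.le
        rwa [Complex.re_add_im] at this
      have hc : ContinuousAt (fun w => (Ψ w).re) ζ :=
        Complex.continuous_re.continuousAt.comp
          (hΨ.differentiableAt (isOpen_im_pos.mem_nhds h5)).continuousAt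
      exact (hc.eventually (ge_mem_nhds (show (Ψ ζ).re < C + ε by linarith))).filter_mono
        nhdsWithin_le_nhds
  · intro ζ hζ
    simp only [Finset.mem_insert, Finset.mem_singleton] at hζ
    have hnear : ∀ (x : ℝ) {ρ : ℝ}, 0 < ρ → ∀ᶠ w in 𝓝[D] (x : ℂ), w ∈ D ∧ ‖w - x‖ < ρ := by
      intro x ρ hρ
      filter_upwards [self_mem_nhdsWithin, mem_nhdsWithin_of_mem_nhds (Metric.ball_mem_nhds _ hρ)]
        with w h1 h2
      exact ⟨h1, by simpa [dist_eq_norm] using h2⟩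
    rcases hζ with rfl | rfl
    · obtain ⟨M, ρ, hρ, h⟩ := hR a haF hpa (by linarith) (b - a) (by linarith) fun t h1 h2 =>
        hab t h1 (by linarith)
      exact ⟨M, (hnear a hρ).mono fun w hw => h w hw.1.1.1 hw.1.2.1 hw.2⟩
    · obtain ⟨M, ρ, hρ, h⟩ := hL b hbF (by linarith) hbq (b - a) (by linarith) fun t h1 h2 =>
        hab t (by linarith) h2
      exact ⟨M, (hnear b hρ).mono fun w hw => h w hw.1.1.2 hw.1.2.1 hw.2⟩
  · intro ζ hζ hζD
    simp only [Finset.mem_insert, Finset.mem_singleton] at hζ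
    rcases hζ with rfl | rfl
    · exact absurd hζD.1.1 (by simp)
    · exact absurd hζD.1.2 (by simp)

theorem exists_abs_re_le_on_vertical {Ψ : ℂ → ℂ} (hΨ : DifferentiableOn ℂ Ψ {z | 0 < z.im}) (x : ℝ)
    (hv : Tendsto (fun y : ℝ => (Ψ (x + y * Complex.I)).re) (𝓝[>] 0) (𝓝 0)) (η : ℝ) :
    ∃ C, ∀ y : ℝ, 0 < y → y ≤ η → |(Ψ (x + y * Complex.I)).re| ≤ C := by
  have h1 : ∀ᶠ y : ℝ in 𝓝[>] 0, |(Ψ (x + y * Complex.I)).re| ≤ 1 := by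
    have := hv.abs
    rw [abs_zero] at this
    exact this.eventually (ge_mem_nhds one_pos)
  obtain ⟨y₀, hy₀, hy⟩ := mem_nhdsGT_iff_exists_Ioo_subset.1 h1
  have hy₀ : 0 < y₀ := hy₀
  obtain ⟨M, hM⟩ := (isCompact_Icc (a := y₀) (b := η)).exists_bound_of_continuousOn
    (f := fun y : ℝ => (Ψ (x + y * Complex.I)).re) (fun y hy => by
      have him : 0 < ((x : ℂ) + y * Complex.I).im := by simpa using hy₀.trans_le hy.1
      have hc : ContinuousAt Ψ ((x : ℂ) + y * Complex.I) :=
        (hΨ.differentiableAt (isOpen_im_pos.mem_nhds him)).continuousAt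
      have h2 : ContinuousAt (fun y : ℝ => (x : ℂ) + y * Complex.I) y := by fun_prop
      exact (Complex.continuous_re.continuousAt.comp
        (ContinuousAt.comp (f := fun y : ℝ => (x : ℂ) + y * Complex.I) hc h2)).continuousWithinAt)
  refine ⟨max 1 M, fun y h2 h3 => ?_⟩
  rcases lt_or_ge y y₀ with h | h
  · exact (hy ⟨h2, h⟩ : |_| ≤ _).trans (le_max_left _ _)
  · exact (hM y ⟨h, h3⟩).trans (le_max_right _ _)

theorem exists_abs_re_le_on_horizontal {Ψ : ℂ → ℂ} (hΨ : DifferentiableOn ℂ Ψ {z | 0 < z.im}) (p q : ℝ)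
    {η : ℝ} (hη : 0 < η) : ∃ C, ∀ x : ℝ, p ≤ x → x ≤ q → |(Ψ (x + η * Complex.I)).re| ≤ C := by
  obtain ⟨M, hM⟩ := (isCompact_Icc (a := p) (b := q)).exists_bound_of_continuousOn
    (f := fun x : ℝ => (Ψ (x + η * Complex.I)).re) (fun x hx => by
      have him : 0 < ((x : ℂ) + η * Complex.I).im := by simpa using hη
      have hc : ContinuousAt Ψ ((x : ℂ) + η * Complex.I) :=
        (hΨ.differentiableAt (isOpen_im_pos.mem_nhds him)).continuousAt
      have h2 : ContinuousAt (fun x : ℝ => (x : ℂ) + η * Complex.I) x := by fun_prop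
      exact (Complex.continuous_re.continuousAt.comp
        (ContinuousAt.comp (f := fun x : ℝ => (x : ℂ) + η * Complex.I) hc h2)).continuousWithinAt)
  exact ⟨M, fun x h1 h2 => hM x ⟨h1, h2⟩⟩

/-- The box principle with the bounds on the vertical lines over `p` and `q` and on the top side
supplied by the vertical limits and by compactness. -/
theorem exists_re_le_of_closed_exceptional_set {Ψ : ℂ → ℂ}
    (hΨ : DifferentiableOn ℂ Ψ {z | 0 < z.im})
    (hv : ∀ x : ℝ, Tendsto (fun y : ℝ => (Ψ (x + y * Complex.I)).re) (𝓝[>] 0) (𝓝 0))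
    {F : Set ℝ} (hFc : IsClosed F) {p q η : ℝ} (hη : 0 < η)
    (hF : ∀ x ∈ F, p ≤ x → x ≤ q → ∀ y : ℝ, 0 < y → y ≤ η → |(Ψ (x + y * Complex.I)).re| ≤ 1)
    (h0 : ∀ x : ℝ, x ∉ F → ReVanishesAt Ψ x)
    (hR : ∀ x : ℝ, p ≤ x → x ≤ q → ∀ δ > 0, (∀ t : ℝ, x < t → t < x + δ → ReVanishesAt Ψ t) →
      ∃ M, ∃ ρ > 0, ∀ z : ℂ, x < z.re → 0 < z.im → ‖z - x‖ < ρ → (Ψ z).re ≤ M)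
    (hL : ∀ x : ℝ, p ≤ x → x ≤ q → ∀ δ > 0, (∀ t : ℝ, x - δ < t → t < x → ReVanishesAt Ψ t) →
      ∃ M, ∃ ρ > 0, ∀ z : ℂ, z.re < x → 0 < z.im → ‖z - x‖ < ρ → (Ψ z).re ≤ M) :
    ∃ C, ∀ z : ℂ, p < z.re → z.re < q → 0 < z.im → z.im < η → (Ψ z).re ≤ C := by
  obtain ⟨C₁, h1⟩ := exists_abs_re_le_on_vertical hΨ p (hv p) η
  obtain ⟨C₂, h2⟩ := exists_abs_re_le_on_vertical hΨ q (hv q) η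
  obtain ⟨C₃, h3⟩ := exists_abs_re_le_on_horizontal hΨ p q hη
  have hC1 : C₁ ≤ max 1 (max C₁ (max C₂ C₃)) := (le_max_left _ _).trans (le_max_right _ _)
  have hC2 : C₂ ≤ max 1 (max C₁ (max C₂ C₃)) :=
    (le_max_left _ _).trans ((le_max_right _ _).trans (le_max_right _ _))
  have hC3 : C₃ ≤ max 1 (max C₁ (max C₂ C₃)) :=
    (le_max_right _ _).trans ((le_max_right _ _).trans (le_max_right _ _))
  refine ⟨max 1 (max C₁ (max C₂ C₃)), re_le_of_bound_over_closed_set hΨ (F := F ∪ {p, q})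
    (hFc.union (Set.toFinite _).isClosed) (by simp) (by simp)
    (zero_le_one.trans (le_max_left _ _)) ?_ ?_ ?_ ?_ ?_⟩
  · rintro x (hx | rfl | rfl) hpx hxq y hy1 hy2
    · exact ((le_abs_self _).trans (hF x hx hpx hxq y hy1 hy2)).trans (le_max_left _ _)
    · exact ((le_abs_self _).trans (h1 y hy1 hy2)).trans hC1
    · exact ((le_abs_self _).trans (h2 y hy1 hy2)).trans hC2
  · exact fun x hp hq => ((le_abs_self _).trans (h3 x hp hq)).trans hC3
  · exact fun x _ _ hx => h0 x fun h => hx (Or.inl h)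
  · exact fun x _ hp hq => hR x hp hq.le
  · exact fun x _ hp hq => hL x hp.le hq

/-- If corner bounds hold at every real point, the vertical limits zero of `Re Ψ` are unrestricted
limits. The lower corner bounds `hLR`, `hLL` may use an upper bound around the point: in the category
argument the upper bound is obtained first. -/
theorem reVanishesAt_of_corner_bounds {Ψ P : ℂ → ℂ}
    (hP : ∀ z : ℂ, 0 < z.im → HasDerivAt P (Ψ z) z)
    (hΨ : DifferentiableOn ℂ Ψ {z | 0 < z.im})
    (hv : ∀ x : ℝ, Tendsto (fun y : ℝ => (Ψ (x + y * Complex.I)).re) (𝓝[>] 0) (𝓝 0))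
    (hUR : ∀ x : ℝ, ∀ δ > 0, (∀ t : ℝ, x < t → t < x + δ → ReVanishesAt Ψ t) →
      ∃ M, ∃ ρ > 0, ∀ z : ℂ, x < z.re → 0 < z.im → ‖z - x‖ < ρ → (Ψ z).re ≤ M)
    (hUL : ∀ x : ℝ, ∀ δ > 0, (∀ t : ℝ, x - δ < t → t < x → ReVanishesAt Ψ t) →
      ∃ M, ∃ ρ > 0, ∀ z : ℂ, z.re < x → 0 < z.im → ‖z - x‖ < ρ → (Ψ z).re ≤ M)
    (hLR : ∀ x : ℝ, (∃ M, ∃ r > 0, ∀ z : ℂ, 0 < z.im → ‖z - x‖ < r → (Ψ z).re ≤ M) →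
      ∀ δ > 0, (∀ t : ℝ, x < t → t < x + δ → ReVanishesAt Ψ t) →
      ∃ M, ∃ ρ > 0, ∀ z : ℂ, x < z.re → 0 < z.im → ‖z - x‖ < ρ → (-Ψ z).re ≤ M)
    (hLL : ∀ x : ℝ, (∃ M, ∃ r > 0, ∀ z : ℂ, 0 < z.im → ‖z - x‖ < r → (Ψ z).re ≤ M) →
      ∀ δ > 0, (∀ t : ℝ, x - δ < t → t < x → ReVanishesAt Ψ t) →
      ∃ M, ∃ ρ > 0, ∀ z : ℂ, z.re < x → 0 < z.im → ‖z - x‖ < ρ → (-Ψ z).re ≤ M) :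
    ∀ x : ℝ, ReVanishesAt Ψ x := by
  set G : Set ℝ := {x | ∃ r > 0, ∃ C, ∀ z : ℂ, 0 < z.im → ‖z - x‖ < r → |(Ψ z).re| ≤ C} with hG
  have hGo : IsOpen G := by
    rw [Metric.isOpen_iff]
    rintro x ⟨r, hr, C, h⟩
    refine ⟨r / 2, by positivity, fun x' hx' => ⟨r / 2, by positivity, C, fun z hz hzx => h z hz ?_⟩⟩
    have e : ‖(x' : ℂ) - x‖ < r / 2 := by
      rw [← Complex.ofReal_sub, Complex.norm_real]; simpa [dist_eq_norm] using hx'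
    calc ‖z - x‖ = ‖(z - x') + (x' - x)‖ := by ring_nf
      _ ≤ _ := norm_add_le _ _
      _ < r := by linarith
  have hG0 : ∀ x ∈ G, ReVanishesAt Ψ x := by
    rintro x ⟨r, hr, C, h⟩
    exact tendsto_re_of_bounded_of_vertical_limits hr hP h hv hΨ.continuousOn
  by_contra! hne
  obtain ⟨x₁, hx₁⟩ := hne
  have hFc : IsClosed Gᶜ := hGo.isClosed_compl
  have : CompleteSpace ↥Gᶜ := hFc.completeSpace_coe
  have : Nonempty ↥Gᶜ := ⟨⟨x₁, fun h => hx₁ (hG0 _ h)⟩⟩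
  have hclosed : ∀ n : ℕ, IsClosed {x : ↥Gᶜ | ∀ y : ℝ, 0 < y → y ≤ 1 / ((n : ℝ) + 1) →
      |(Ψ ((x : ℝ) + y * Complex.I)).re| ≤ 1} := by
    intro n
    simp only [Set.ofPred_forall]
    refine isClosed_iInter fun y => isClosed_iInter fun hy => isClosed_iInter fun _ => ?_
    refine isClosed_le (continuous_iff_continuousAt.2 fun x => ?_) continuous_const
    have him : 0 < (((x : ℝ) : ℂ) + y * Complex.I).im := by simpa using hy
    have hc : ContinuousAt Ψ (((x : ℝ) : ℂ) + y * Complex.I) :=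
      (hΨ.differentiableAt (isOpen_im_pos.mem_nhds him)).continuousAt
    have h2 : ContinuousAt (fun x : ↥Gᶜ => ((x : ℝ) : ℂ) + y * Complex.I) x := by fun_prop
    exact (Complex.continuous_re.continuousAt.comp
      (ContinuousAt.comp (f := fun x : ↥Gᶜ => ((x : ℝ) : ℂ) + y * Complex.I) hc h2)).abs
  obtain ⟨n, ⟨x₀, hx₀⟩, hint⟩ := nonempty_interior_of_iUnion_of_closed hclosed (by
    rw [Set.eq_univ_iff_forall]
    intro x
    have h1 := (hv x).abs
    rw [abs_zero] at h1
    obtain ⟨y₀, hy₀, hy⟩ := mem_nhdsGT_iff_exists_Ioo_subset.1 (h1.eventually (ge_mem_nhds one_pos))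
    obtain ⟨n, hn⟩ := exists_nat_one_div_lt (show (0:ℝ) < y₀ from hy₀)
    exact Set.mem_iUnion.2 ⟨n, fun y h2 h3 => hy ⟨h2, h3.trans_lt hn⟩⟩)
  rw [mem_interior_iff_mem_nhds, Metric.mem_nhds_iff] at hint
  obtain ⟨r, hr, hball⟩ := hint
  set η := 1 / ((n : ℝ) + 1) with hη
  have hη0 : 0 < η := by positivity
  have hFb : ∀ x ∈ Gᶜ, |x - x₀| < r → ∀ y : ℝ, 0 < y → y ≤ η →
      |(Ψ (x + y * Complex.I)).re| ≤ 1 := fun x hx hxr =>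
    hball (show (⟨x, hx⟩ : ↥Gᶜ) ∈ Metric.ball ⟨x₀, hx₀⟩ r by
      simpa [Subtype.dist_eq, Real.dist_eq] using hxr)
  -- upper bound first; the lower bound is then obtained on a shorter interval, around each point of
  -- which the upper bound is available on both sides
  obtain ⟨C, hC⟩ := exists_re_le_of_closed_exceptional_set hΨ hv hFc (p := x₀ - r / 2)
    (q := x₀ + r / 2) hη0 (fun x hx h1 h2 => hFb x hx (by rw [abs_lt]; constructor <;> linarith))
    (fun x hx => hG0 x (not_not.1 hx)) (fun x _ _ => hUR x) (fun x _ _ => hUL x)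
  have hup : ∀ x : ℝ, x₀ - r / 4 ≤ x → x ≤ x₀ + r / 4 →
      ∃ M, ∃ r > 0, ∀ z : ℂ, 0 < z.im → ‖z - x‖ < r → (Ψ z).re ≤ M := by
    intro x h1 h2
    refine ⟨C, min (r / 4) η, by positivity, fun z hz hzx => ?_⟩
    rw [lt_min_iff] at hzx
    have b1 := abs_lt.1 ((Complex.abs_re_le_norm (z - x)).trans_lt hzx.1)
    have b2 := (Complex.im_le_norm (z - x)).trans_lt hzx.2
    simp only [Complex.sub_re, Complex.ofReal_re, Complex.sub_im, Complex.ofReal_im, sub_zero]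
      at b1 b2
    exact hC z (by linarith) (by linarith) hz b2
  have hneg : ∀ t, ReVanishesAt (fun z => -Ψ z) t → ReVanishesAt Ψ t := fun t ht => by
    simpa using ht.neg
  obtain ⟨C', hC'⟩ := exists_re_le_of_closed_exceptional_set (Ψ := fun z => -Ψ z) hΨ.neg
    (fun x => by simpa using (hv x).neg) hFc (p := x₀ - r / 4)
    (q := x₀ + r / 4) hη0 (fun x hx h1 h2 => by
      simpa using hFb x hx (by rw [abs_lt]; constructor <;> linarith))
    (fun x hx => (hG0 x (not_not.1 hx)).neg)
    (fun x h1 h2 δ hδ h => hLR x (hup x h1 h2) δ hδ fun t h3 h4 => hneg t (h t h3 h4))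
    (fun x h1 h2 δ hδ h => hLL x (hup x h1 h2) δ hδ fun t h3 h4 => hneg t (h t h3 h4))
  refine hx₀ ⟨min (r / 4) η, by positivity, max C C', fun z hz hzx => ?_⟩
  rw [lt_min_iff] at hzx
  have b1 := abs_lt.1 ((Complex.abs_re_le_norm (z - x₀)).trans_lt hzx.1)
  have b2 := (Complex.im_le_norm (z - x₀)).trans_lt hzx.2
  simp only [Complex.sub_re, Complex.ofReal_re, Complex.sub_im, Complex.ofReal_im, sub_zero]
    at b1 b2
  have c1 := hC z (by linarith) (by linarith) hz b2
  have c2 := hC' z (by linarith) (by linarith) hz b2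
  rw [Complex.neg_re] at c2
  exact abs_le.2 ⟨by linarith [le_max_right C C'], c1.trans (le_max_left _ _)⟩

/-! ### Coordinates on the disc -/

theorem one_sub_norm_sq_discMap (φ : ℝ) {z : ℂ} (hz : 0 < z.im) :
    1 - ‖discMap φ z‖ ^ 2 = 4 * z.im / ‖Complex.I + z‖ ^ 2 := by
  have h : Complex.normSq (Complex.I + z) ≠ 0 := by
    rw [Ne, Complex.normSq_eq_zero]
    intro h
    have := congrArg Complex.im h
    simp at this; linarith
  rw [discMap, norm_mul, Complex.norm_exp_ofReal_mul_I, one_mul, norm_div, div_pow,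
    ← Complex.normSq_eq_norm_sq, ← Complex.normSq_eq_norm_sq]
  field_simp
  simp only [Complex.normSq_apply, Complex.add_re, Complex.sub_re, Complex.I_re, Complex.I_im,
    Complex.add_im, Complex.sub_im]
  ring

theorem I_add_ne_zero {z : ℂ} (hz : -1 < z.im) : Complex.I + z ≠ 0 := fun h => by
  have := congrArg Complex.im h
  simp at this; linarith

theorem norm_discMap_lt_one (φ : ℝ) {z : ℂ} (hz : 0 < z.im) : ‖discMap φ z‖ < 1 := by
  have h := one_sub_norm_sq_discMap φ hz
  have : 0 < 4 * z.im / ‖Complex.I + z‖ ^ 2 := by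
    have := norm_pos_iff.2 (I_add_ne_zero (z := z) (by linarith))
    positivity
  nlinarith [norm_nonneg (discMap φ z)]

theorem discMap_mem_ball (φ : ℝ) {z : ℂ} (hz : 0 < z.im) : discMap φ z ∈ Metric.ball (0 : ℂ) 1 := by
  rw [mem_ball_zero_iff]; exact norm_discMap_lt_one φ hz

theorem differentiableAt_discMap (φ : ℝ) {z : ℂ} (hz : -1 < z.im) :
    DifferentiableAt ℂ (discMap φ) z := by
  unfold discMap
  exact ((differentiableAt_const _).sub differentiableAt_id).div
    ((differentiableAt_const _).add differentiableAt_id) (I_add_ne_zero hz) |>.const_mul _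

theorem discMap_apply_zero (φ : ℝ) : discMap φ 0 = Complex.exp ((φ : ℂ) * Complex.I) := by
  simp [discMap]

/-- The function `tan (s / 2)`, written through `e^{is}`. It changes the coordinate
`s ↦ e^{i (φ + s)}` on the disc into `discMap φ`. -/
noncomputable def halfTan (s : ℂ) : ℂ :=
  Complex.I * (1 - Complex.exp (Complex.I * s)) / (1 + Complex.exp (Complex.I * s))

theorem norm_exp_I_mul (s : ℂ) : ‖Complex.exp (Complex.I * s)‖ = Real.exp (-s.im) := by
  rw [Complex.norm_exp]; simp

theorem norm_exp_I_mul_lt_one {s : ℂ} (hs : 0 < s.im) : ‖Complex.exp (Complex.I * s)‖ < 1 := by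
  rw [norm_exp_I_mul]; simpa using hs

theorem one_add_ne_zero_of_norm_lt {q : ℂ} (hq : ‖q‖ < 1) : 1 + q ≠ 0 := fun h => by
  have : q = -1 := by linear_combination h
  simp [this] at hq

theorem discMap_halfTan (φ : ℝ) {s : ℂ} (hs : 0 < s.im) :
    discMap φ (halfTan s) = Complex.exp (Complex.I * (φ + s)) := by
  have h1 := one_add_ne_zero_of_norm_lt (norm_exp_I_mul_lt_one hs)
  rw [mul_add, Complex.exp_add, discMap, halfTan, mul_comm (φ : ℂ)]
  set q := Complex.exp (Complex.I * s) with hq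
  congr 1
  have e1 : Complex.I - Complex.I * (1 - q) / (1 + q) = 2 * Complex.I * q / (1 + q) := by
    field_simp; ring
  have e2 : Complex.I + Complex.I * (1 - q) / (1 + q) = 2 * Complex.I / (1 + q) := by
    field_simp; ring
  rw [e1, e2]
  have := Complex.I_ne_zero
  field_simp

theorem halfTan_im_and_re (s : ℂ) :
    (halfTan s).im = (1 - ‖Complex.exp (Complex.I * s)‖ ^ 2) /
        Complex.normSq (1 + Complex.exp (Complex.I * s)) ∧
      (halfTan s).re = 2 * (Complex.exp (Complex.I * s)).im /
        Complex.normSq (1 + Complex.exp (Complex.I * s)) := by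
  rw [halfTan, ← Complex.normSq_eq_norm_sq]
  set q := Complex.exp (Complex.I * s) with hq
  rw [Complex.div_im, Complex.div_re, ← sub_div, ← add_div]
  constructor
  · congr 1
    simp [Complex.normSq_apply]; ring
  · congr 1
    simp; ring

theorem halfTan_im_pos {s : ℂ} (hs : 0 < s.im) : 0 < (halfTan s).im := by
  rw [(halfTan_im_and_re s).1]
  have h := norm_exp_I_mul_lt_one hs
  have h1 := Complex.normSq_pos.2 (one_add_ne_zero_of_norm_lt h)
  have h2 : ‖Complex.exp (Complex.I * s)‖ ^ 2 < 1 := by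
    nlinarith [norm_nonneg (Complex.exp (Complex.I * s))]
  exact div_pos (by linarith) h1

theorem exp_I_mul_im (s : ℂ) :
    (Complex.exp (Complex.I * s)).im = Real.exp (-s.im) * Real.sin s.re := by
  rw [Complex.exp_im]; simp

theorem halfTan_re_pos {s : ℂ} (hs : 0 < s.im) (h0 : 0 < s.re) (h1 : s.re < Real.pi) :
    0 < (halfTan s).re := by
  rw [(halfTan_im_and_re s).2, exp_I_mul_im]
  have h2 := Complex.normSq_pos.2 (one_add_ne_zero_of_norm_lt (norm_exp_I_mul_lt_one hs))
  have := Real.sin_pos_of_pos_of_lt_pi h0 h1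
  positivity

theorem halfTan_re_neg {s : ℂ} (hs : 0 < s.im) (h0 : s.re < 0) (h1 : -Real.pi < s.re) :
    (halfTan s).re < 0 := by
  rw [(halfTan_im_and_re s).2, exp_I_mul_im]
  have h2 := Complex.normSq_pos.2 (one_add_ne_zero_of_norm_lt (norm_exp_I_mul_lt_one hs))
  have := Real.sin_neg_of_neg_of_neg_pi_lt h0 h1
  refine div_neg_of_neg_of_pos ?_ h2
  have := Real.exp_pos (-s.im)
  nlinarith

theorem halfTan_re_eq_zero {s : ℂ} (h0 : s.re = 0) : (halfTan s).re = 0 := by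
  rw [(halfTan_im_and_re s).2, exp_I_mul_im, h0]; simp

theorem continuousAt_halfTan : ContinuousAt halfTan 0 := by
  unfold halfTan
  refine ContinuousAt.div (by fun_prop) (by fun_prop) (by norm_num)

theorem halfTan_zero : halfTan 0 = 0 := by simp [halfTan]

/-- The function `2 arctan w`, the local inverse of `halfTan` near the real axis. -/
noncomputable def twoArctan (w : ℂ) : ℂ :=
  -Complex.I * Complex.log ((Complex.I - w) / (Complex.I + w))

theorem cayley_eq_discMap (w : ℂ) : (Complex.I - w) / (Complex.I + w) = discMap 0 w := by
  simp [discMap]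

theorem discMap_zero_left_ne_zero {w : ℂ} (h0 : -1 < w.im) (h1 : w.im < 1) : discMap 0 w ≠ 0 := by
  rw [← cayley_eq_discMap]
  refine div_ne_zero (fun h => ?_) (I_add_ne_zero h0)
  have := congrArg Complex.im h
  simp at this; linarith

theorem exp_I_mul_add_twoArctan (φ : ℝ) {w : ℂ} (h0 : -1 < w.im) (h1 : w.im < 1) :
    Complex.exp (Complex.I * (φ + twoArctan w)) = discMap φ w := by
  have h := discMap_zero_left_ne_zero h0 h1
  rw [twoArctan, cayley_eq_discMap, mul_add, Complex.exp_add, ← mul_assoc]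
  rw [show Complex.I * -Complex.I = 1 by simp, one_mul, Complex.exp_log h, ← cayley_eq_discMap,
    discMap, mul_comm (φ : ℂ)]

theorem twoArctan_im (w : ℂ) : (twoArctan w).im = -Real.log ‖discMap 0 w‖ := by
  rw [twoArctan, cayley_eq_discMap]
  simp [Complex.mul_im, Complex.log_re]

theorem twoArctan_im_pos {w : ℂ} (h0 : 0 < w.im) (h1 : w.im < 1) : 0 < (twoArctan w).im := by
  rw [twoArctan_im, neg_pos]
  exact Real.log_neg (norm_pos_iff.2 (discMap_zero_left_ne_zero (by linarith) h1))
    (norm_discMap_lt_one 0 h0)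

theorem discMap_zero_left_ofReal (t : ℝ) : (discMap 0 t).re = (1 - t ^ 2) / (1 + t ^ 2) ∧
    (discMap 0 t).im = 2 * t / (1 + t ^ 2) := by
  rw [← cayley_eq_discMap, Complex.div_re, Complex.div_im]
  have : (1 + t ^ 2) ≠ 0 := by positivity
  have e : Complex.normSq (Complex.I + t) = 1 + t ^ 2 := by
    simp [Complex.normSq_apply]; ring
  rw [e]
  simp
  constructor <;> (field_simp; ring)

theorem twoArctan_ofReal (t : ℝ) : twoArctan t = (((discMap 0 t).arg : ℝ) : ℂ) := by
  have h : ‖discMap 0 (t : ℂ)‖ = 1 := by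
    rw [← sq_eq_sq₀ (norm_nonneg _) zero_le_one, ← Complex.normSq_eq_norm_sq,
      Complex.normSq_apply, (discMap_zero_left_ofReal t).1, (discMap_zero_left_ofReal t).2]
    have : (1 + t ^ 2) ≠ 0 := by positivity
    field_simp; ring
  apply Complex.ext
  · rw [twoArctan, cayley_eq_discMap]
    simp [Complex.mul_re, Complex.log_im]
  · rw [twoArctan_im, h]; simp

theorem continuousAt_twoArctan {t : ℝ} (ht : |t| < 1) : ContinuousAt twoArctan t := by
  have e : twoArctan = fun w => -Complex.I * Complex.log (discMap 0 w) := by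
    funext w; rw [twoArctan, cayley_eq_discMap]
  rw [e]
  refine continuousAt_const.mul (ContinuousAt.clog ?_ (Or.inl ?_))
  · exact (differentiableAt_discMap 0 (by simp)).continuousAt
  · rw [(discMap_zero_left_ofReal t).1]
    have : t ^ 2 < 1 := by rw [← sq_abs]; nlinarith [abs_nonneg t]
    exact div_pos (by linarith) (by positivity)

theorem twoArctan_zero : twoArctan 0 = 0 := by
  simp [twoArctan]

/-- Limits zero in the coordinate `z ↦ e^{iz}` at points near `x` are limits zero in the coordinate
`discMap x` at real points near `0`, on the same side. -/
theorem exists_reVanishesAt_discMap (F : ℂ → ℂ) (x : ℝ) {δ : ℝ} (hδ : 0 < δ) :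
    ∃ δ' > 0, ∀ t : ℝ, |t| < δ' → ∃ l : ℝ, |l| < δ ∧ (0 < t → 0 < l) ∧ (t < 0 → l < 0) ∧
      (ReVanishesAt (fun z => F (Complex.exp (Complex.I * z))) (x + l) →
        ReVanishesAt (fun w => F (discMap x w)) t) := by
  have h1 : ContinuousAt (fun t : ℝ => twoArctan t) 0 := by
    have := continuousAt_twoArctan (t := 0) (by simp)
    exact ContinuousAt.comp (f := fun t : ℝ => (t : ℂ)) this Complex.continuous_ofReal.continuousAt
  obtain ⟨δ₁, hδ₁, h⟩ := Metric.continuousAt_iff.1 h1 δ hδ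
  refine ⟨min δ₁ 1, by positivity, fun t ht => ⟨(discMap 0 t).arg, ?_, ?_, ?_, ?_⟩⟩
  · rw [lt_min_iff] at ht
    have := h (show dist t 0 < δ₁ by simpa using ht.1)
    simp only [Complex.ofReal_zero, twoArctan_zero, dist_zero_right] at this
    rwa [twoArctan_ofReal, Complex.norm_real, Real.norm_eq_abs] at this
  · intro h0
    have : 0 < (discMap 0 t).im := by rw [(discMap_zero_left_ofReal t).2]; positivity
    refine lt_of_le_of_ne (Complex.arg_nonneg_iff.2 this.le) fun h => ?_
    have := (Complex.arg_eq_zero_iff.1 h.symm).2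
    linarith
  · intro h0
    rw [Complex.arg_neg_iff, (discMap_zero_left_ofReal t).2]
    exact div_neg_of_neg_of_pos (by linarith) (by positivity)
  · intro hv
    have ht1 : |t| < 1 := ht.trans_le (min_le_right _ _)
    have hc : Tendsto (fun w : ℂ => (x : ℂ) + twoArctan w) (𝓝[{z : ℂ | 0 < z.im}] (t : ℂ))
        (𝓝[{z : ℂ | 0 < z.im}] ((x + (discMap 0 t).arg : ℝ) : ℂ)) := by
      refine tendsto_nhdsWithin_iff.2 ⟨?_, ?_⟩
      · have := (continuousAt_twoArctan ht1).const_add (x : ℂ)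
        rw [ContinuousAt, twoArctan_ofReal, ← Complex.ofReal_add] at this
        exact this.mono_left nhdsWithin_le_nhds
      · filter_upwards [self_mem_nhdsWithin, mem_nhdsWithin_of_mem_nhds
          ((isOpen_lt Complex.continuous_im continuous_const).mem_nhds
            (show ((t : ℝ) : ℂ).im < 1 by simp))] with w hw hw'
        have := twoArctan_im_pos hw hw'
        simpa using this
    refine (hv.comp hc).congr' ?_
    filter_upwards [self_mem_nhdsWithin, mem_nhdsWithin_of_mem_nhds
      ((isOpen_lt Complex.continuous_im continuous_const).mem_nhds
        (show ((t : ℝ) : ℂ).im < 1 by simp))] with w hw hw'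
    have hw : 0 < w.im := hw
    simp only [Function.comp]
    rw [exp_I_mul_add_twoArctan x (by linarith) hw']

theorem exists_discMap_eq_exp (x : ℝ) {ρ : ℝ} (hρ : 0 < ρ) :
    ∃ ρ' > 0, ∀ z : ℂ, 0 < z.im → ‖z - x‖ < ρ' → ∃ w : ℂ, 0 < w.im ∧ ‖w‖ < ρ ∧
      (x < z.re → 0 < w.re) ∧ (z.re < x → w.re < 0) ∧
      Complex.exp (Complex.I * z) = discMap x w := by
  obtain ⟨δ₁, hδ₁, h⟩ := Metric.continuousAt_iff.1 continuousAt_halfTan ρ hρ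
  have hpi := Real.pi_pos
  refine ⟨min δ₁ Real.pi, by positivity, fun z hz hzx => ?_⟩
  rw [lt_min_iff] at hzx
  have him : 0 < (z - x).im := by simpa using hz
  have hre := abs_lt.1 ((Complex.abs_re_le_norm (z - x)).trans_lt hzx.2)
  refine ⟨halfTan (z - x), halfTan_im_pos him, ?_, fun h0 => ?_, fun h0 => ?_, ?_⟩
  · have := h (show dist (z - x) 0 < δ₁ by simpa using hzx.1)
    simpa [halfTan_zero] using this
  · exact halfTan_re_pos him (by simpa using h0) hre.2
  · exact halfTan_re_neg him (by simpa using h0) hre.1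
  · rw [discMap_halfTan x him, add_sub_cancel]

theorem exists_exp_eq_discMap (x : ℝ) {r : ℝ} (hr : 0 < r) :
    ∃ ρ > 0, ∀ w : ℂ, 0 < w.im → ‖w‖ < ρ → ∃ z : ℂ, 0 < z.im ∧ ‖z - x‖ < r ∧
      Complex.exp (Complex.I * z) = discMap x w := by
  have h1 := continuousAt_twoArctan (t := 0) (by simp)
  rw [Complex.ofReal_zero] at h1
  obtain ⟨δ₁, hδ₁, h⟩ := Metric.continuousAt_iff.1 h1 r hr
  refine ⟨min δ₁ 1, by positivity, fun w hw hwρ => ?_⟩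
  rw [lt_min_iff] at hwρ
  have hw1 : w.im < 1 := (Complex.im_le_norm w).trans_lt hwρ.2
  refine ⟨x + twoArctan w, by simpa using twoArctan_im_pos hw hw1, ?_,
    exp_I_mul_add_twoArctan x (by linarith) hw1⟩
  have := h (show dist w 0 < δ₁ by simpa using hwρ.1)
  simpa [twoArctan_zero] using this

/-! ### Reduction to corner bounds -/

/-- The reflection of a function in the imaginary axis. -/
noncomputable def mirror (Φ : ℂ → ℂ) (z : ℂ) : ℂ := (starRingEnd ℂ) (Φ (-(starRingEnd ℂ) z))

theorem mirror_re (Φ : ℂ → ℂ) (z : ℂ) : (mirror Φ z).re = (Φ (-(starRingEnd ℂ) z)).re := by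
  simp [mirror]

theorem differentiableOn_mirror {Φ : ℂ → ℂ} (hΦ : DifferentiableOn ℂ Φ {z | 0 < z.im}) :
    DifferentiableOn ℂ (mirror Φ) {z | 0 < z.im} := by
  intro z hz
  have hz : 0 < z.im := hz
  have h1 : DifferentiableAt ℂ Φ (-(starRingEnd ℂ) z) :=
    hΦ.differentiableAt (isOpen_im_pos.mem_nhds (by simpa using hz))
  have h2 : DifferentiableAt ℂ (fun w => Φ (-w)) ((starRingEnd ℂ) z) :=
    DifferentiableAt.comp ((starRingEnd ℂ) z) h1 differentiableAt_id.neg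
  have h3 := h2.hasDerivAt.conj_conj
  rw [Complex.conj_conj] at h3
  exact h3.differentiableAt.differentiableWithinAt

theorem ReVanishesAt.mirror {Φ : ℂ → ℂ} {t : ℝ} (h : ReVanishesAt Φ (-t)) :
    ReVanishesAt (mirror Φ) t := by
  have hc : Tendsto (fun z : ℂ => -(starRingEnd ℂ) z) (𝓝[{z : ℂ | 0 < z.im}] (t : ℂ))
      (𝓝[{z : ℂ | 0 < z.im}] ((-t : ℝ) : ℂ)) := by
    refine tendsto_nhdsWithin_iff.2 ⟨?_, ?_⟩
    · have : Continuous fun z : ℂ => -(starRingEnd ℂ) z := by fun_prop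
      have := this.tendsto (t : ℂ)
      simp only [Complex.conj_ofReal] at this
      rw [Complex.ofReal_neg]
      exact this.mono_left nhdsWithin_le_nhds
    · filter_upwards [self_mem_nhdsWithin] with w hw
      have hw : 0 < w.im := hw
      simpa using hw
  exact (h.comp hc).congr fun z => by simp [mirror_re]

/-- `Φ` is the function `F` on the disc, read in a half-plane coordinate centred at a boundary point
`e^{iφ}`, possibly reflected in the imaginary axis. The reflection turns corners on the left into
corners on the right. -/
def IsDiscChart (F Φ : ℂ → ℂ) : Prop :=
  ∃ φ : ℝ, Φ = (fun z => F (discMap φ z)) ∨ Φ = mirror (fun z => F (discMap φ z))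

theorem IsDiscChart.differentiableOn {F Φ : ℂ → ℂ} (h : IsDiscChart F Φ)
    (hF : DifferentiableOn ℂ F (Metric.ball 0 1)) : DifferentiableOn ℂ Φ {z | 0 < z.im} := by
  obtain ⟨φ, h⟩ := h
  have h1 : DifferentiableOn ℂ (fun z => F (discMap φ z)) {z | 0 < z.im} := fun z hz => by
    have hz : 0 < z.im := hz
    exact (DifferentiableAt.comp z
      (hF.differentiableAt (Metric.isOpen_ball.mem_nhds (discMap_mem_ball φ hz)))
      (differentiableAt_discMap φ (by linarith))).differentiableWithinAt
  rcases h with rfl | rfl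
  · exact h1
  · exact differentiableOn_mirror h1

theorem IsDiscChart.exists_re_eq {F Φ : ℂ → ℂ} (h : IsDiscChart F Φ) : ∃ φ : ℝ, ∀ z : ℂ,
    ∃ w : ℂ, w.im = z.im ∧ |w.re| = |z.re| ∧ ‖w‖ = ‖z‖ ∧ (Φ z).re = (F (discMap φ w)).re := by
  obtain ⟨φ, rfl | rfl⟩ := h
  · exact ⟨φ, fun z => ⟨z, rfl, rfl, rfl, rfl⟩⟩
  · exact ⟨φ, fun z => ⟨-(starRingEnd ℂ) z, by simp, by simp, by simp, mirror_re _ _⟩⟩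

/-- A primitive of `F (e^{iz})` is `F(0) z` plus a function of `e^{iz}`. -/
theorem exists_primitive_comp_exp {F : ℂ → ℂ} (hF : DifferentiableOn ℂ F (Metric.ball 0 1)) :
    ∃ P : ℂ → ℂ, ∀ z : ℂ, 0 < z.im → HasDerivAt P (F (Complex.exp (Complex.I * z))) z := by
  have h0 : Metric.ball (0 : ℂ) 1 ∈ 𝓝 (0 : ℂ) := Metric.ball_mem_nhds _ one_pos
  obtain ⟨G, hG⟩ := ((Complex.differentiableOn_dslope h0).2 hF).isExactOn_ball
  refine ⟨fun z => F 0 * z - Complex.I * G (Complex.exp (Complex.I * z)), fun z hz => ?_⟩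
  have hq := norm_exp_I_mul_lt_one hz
  have d1 : HasDerivAt (fun z : ℂ => Complex.exp (Complex.I * z))
      (Complex.exp (Complex.I * z) * (Complex.I * 1)) z :=
    ((hasDerivAt_id z).const_mul Complex.I).cexp
  have d2 := ((hG _ (mem_ball_zero_iff.2 hq)).comp z d1).const_mul Complex.I
  have d3 := ((hasDerivAt_id z).const_mul (F 0)).sub d2
  refine HasDerivAt.congr_deriv d3 ?_
  have e := sub_smul_dslope F 0 (Complex.exp (Complex.I * z))
  rw [sub_zero, smul_eq_mul] at e
  linear_combination (-1) * dslope F 0 (Complex.exp (Complex.I * z)) *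
    Complex.exp (Complex.I * z) * Complex.I_sq + e

theorem re_nonpos_of_reVanishesAt {F : ℂ → ℂ} (hF : DifferentiableOn ℂ F (Metric.ball 0 1))
    (h : ∀ x : ℝ, ReVanishesAt (fun z => F (Complex.exp (Complex.I * z))) x) :
    ∀ z ∈ Metric.ball (0 : ℂ) 1, (F z).re ≤ 0 := by
  refine re_le_of_frontier_limsup Metric.isOpen_ball Metric.isBounded_ball hF fun ζ hζ ε hε => ?_
  rw [frontier_ball _ one_ne_zero, mem_sphere_zero_iff_norm] at hζ
  have hζ0 : ζ ≠ 0 := norm_pos_iff.1 (by rw [hζ]; exact one_pos)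
  have hζe : Complex.exp (Complex.I * (ζ.arg : ℂ)) = ζ := by
    have := Complex.norm_mul_exp_arg_mul_I ζ
    rwa [hζ, Complex.ofReal_one, one_mul, mul_comm] at this
  have hc : Tendsto (fun z : ℂ => (ζ.arg : ℂ) + -Complex.I * Complex.log (z / ζ))
      (𝓝[Metric.ball 0 1] ζ) (𝓝[{z : ℂ | 0 < z.im}] (ζ.arg : ℂ)) := by
    refine tendsto_nhdsWithin_iff.2 ⟨?_, ?_⟩
    · have : ContinuousAt (fun z : ℂ => (ζ.arg : ℂ) + -Complex.I * Complex.log (z / ζ)) ζ := by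
        refine continuousAt_const.add (continuousAt_const.mul (ContinuousAt.clog (by fun_prop) ?_))
        rw [div_self hζ0]; exact Complex.one_mem_slitPlane
      rw [ContinuousAt, div_self hζ0, Complex.log_one, mul_zero, add_zero] at this
      exact this.mono_left nhdsWithin_le_nhds
    · filter_upwards [self_mem_nhdsWithin, mem_nhdsWithin_of_mem_nhds
        (isOpen_ne.mem_nhds hζ0)] with z hz hz0
      have h1 : ‖z‖ < 1 := mem_ball_zero_iff.1 hz
      have h2 : Real.log ‖z‖ < 0 := Real.log_neg (norm_pos_iff.2 hz0) h1
      simpa [Complex.mul_im, Complex.log_re, hζ] using h2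
  filter_upwards [((h ζ.arg).comp hc).eventually (ge_mem_nhds (show (0:ℝ) < 0 + ε by linarith)),
    mem_nhdsWithin_of_mem_nhds (isOpen_ne.mem_nhds hζ0)] with z hz hz0
  have e : Complex.exp (Complex.I * ((ζ.arg : ℂ) + -Complex.I * Complex.log (z / ζ))) = z := by
    rw [mul_add, Complex.exp_add, hζe, ← mul_assoc, show Complex.I * -Complex.I = 1 by simp,
      one_mul, Complex.exp_log (div_ne_zero hz0 hζ0), mul_div_cancel₀ _ hζ0]
  simpa only [Function.comp, e] using hz

/-- A holomorphic `F` whose real part has radial limits zero satisfies `Re F = 0` as soon as corner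
bounds hold in all charts. -/
theorem re_eq_zero_of_corner_bounds {F : ℂ → ℂ} (hF : DifferentiableOn ℂ F (Metric.ball 0 1))
    (hrad : ∀ φ : ℝ, ∀ η > 0, ∃ ρ > 0, ∀ z : ℂ, 0 < z.im → |z.re| ≤ 0 → ‖z‖ < ρ →
      |(F (discMap φ z)).re| ≤ η)
    (hU : ∀ Φ, IsDiscChart F Φ → ∀ δ > 0, (∀ t : ℝ, 0 < t → t < δ → ReVanishesAt Φ t) →
      ∃ C, ∃ ρ > 0, ∀ z : ℂ, 0 < z.re → 0 < z.im → ‖z‖ < ρ → (Φ z).re ≤ C)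
    (hL : ∀ Φ, IsDiscChart F Φ →
      (∃ M, ∃ r > 0, ∀ z : ℂ, 0 < z.im → ‖z‖ < r → (Φ z).re ≤ M) →
      ∀ δ > 0, (∀ t : ℝ, 0 < t → t < δ → ReVanishesAt Φ t) →
      ∃ C, ∃ ρ > 0, ∀ z : ℂ, 0 < z.re → 0 < z.im → ‖z‖ < ρ → (-Φ z).re ≤ C) :
    ∀ z ∈ Metric.ball (0 : ℂ) 1, (F z).re = 0 := by
  set Ψ : ℂ → ℂ := fun z => F (Complex.exp (Complex.I * z)) with hΨdef
  obtain ⟨P, hP⟩ := exists_primitive_comp_exp hF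
  have hΨ : DifferentiableOn ℂ Ψ {z | 0 < z.im} := fun z hz =>
    (DifferentiableAt.comp z (hF.differentiableAt (Metric.isOpen_ball.mem_nhds
      (mem_ball_zero_iff.2 (norm_exp_I_mul_lt_one hz)))) (by fun_prop)).differentiableWithinAt
  have hv : ∀ x : ℝ, Tendsto (fun y : ℝ => (Ψ (x + y * Complex.I)).re) (𝓝[>] 0) (𝓝 0) := by
    intro x
    rw [Metric.tendsto_nhds]
    intro η hη
    obtain ⟨ρ, hρ, h⟩ := hrad x (η / 2) (by positivity)
    have hc : Tendsto (fun y : ℝ => halfTan (y * Complex.I)) (𝓝[>] 0) (𝓝 0) := by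
      have h1 : Tendsto (fun y : ℝ => (y : ℂ) * Complex.I) (𝓝[>] 0) (𝓝 0) := by
        have : Continuous fun y : ℝ => (y : ℂ) * Complex.I := by fun_prop
        have := this.tendsto 0
        simp only [Complex.ofReal_zero, zero_mul] at this
        exact this.mono_left nhdsWithin_le_nhds
      have h2 := continuousAt_halfTan.tendsto
      rw [halfTan_zero] at h2
      exact h2.comp h1
    filter_upwards [hc.eventually (Metric.ball_mem_nhds 0 hρ), self_mem_nhdsWithin] with y hy hy0
    have hy0 : 0 < y := hy0
    have him : 0 < ((y : ℂ) * Complex.I).im := by simpa using hy0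
    have := h _ (halfTan_im_pos him) (by rw [halfTan_re_eq_zero (by simp)]; simp)
      (by simpa using hy)
    rw [discMap_halfTan x him] at this
    rw [Real.dist_eq, sub_zero]
    exact this.trans_lt (by linarith)
  have hchart : ∀ x : ℝ, IsDiscChart F (fun z => F (discMap x z)) := fun x => ⟨x, Or.inl rfl⟩
  have hchart' : ∀ x : ℝ, IsDiscChart F (mirror fun z => F (discMap x z)) :=
    fun x => ⟨x, Or.inr rfl⟩
  have hvR : ∀ x : ℝ, ∀ δ > 0, (∀ t : ℝ, x < t → t < x + δ → ReVanishesAt Ψ t) →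
      ∃ δ' > 0, ∀ t : ℝ, 0 < t → t < δ' → ReVanishesAt (fun z => F (discMap x z)) t := by
    intro x δ hδ h
    obtain ⟨δ', hδ', h'⟩ := exists_reVanishesAt_discMap F x hδ
    refine ⟨δ', hδ', fun t h1 h2 => ?_⟩
    obtain ⟨l, hl, hl1, -, hl2⟩ := h' t (by rwa [abs_of_pos h1])
    exact hl2 (h _ (by linarith [hl1 h1]) (by linarith [(abs_lt.1 hl).2]))
  have hvL : ∀ x : ℝ, ∀ δ > 0, (∀ t : ℝ, x - δ < t → t < x → ReVanishesAt Ψ t) →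
      ∃ δ' > 0, ∀ t : ℝ, 0 < t → t < δ' →
        ReVanishesAt (mirror fun z => F (discMap x z)) t := by
    intro x δ hδ h
    obtain ⟨δ', hδ', h'⟩ := exists_reVanishesAt_discMap F x hδ
    refine ⟨δ', hδ', fun t h1 h2 => ReVanishesAt.mirror ?_⟩
    obtain ⟨l, hl, -, hl1, hl2⟩ := h' (-t) (by rwa [abs_neg, abs_of_pos h1])
    exact hl2 (h _ (by linarith [(abs_lt.1 hl).1]) (by linarith [hl1 (by linarith)]))
  -- corner bounds are transported along the coordinate changes
  have htR : ∀ (x σ : ℝ), (∃ C, ∃ ρ > 0, ∀ z : ℂ, 0 < z.re → 0 < z.im → ‖z‖ < ρ →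
        σ * (F (discMap x z)).re ≤ C) →
      ∃ M, ∃ ρ > 0, ∀ z : ℂ, x < z.re → 0 < z.im → ‖z - x‖ < ρ → σ * (Ψ z).re ≤ M := by
    rintro x σ ⟨C, ρ, hρ, h⟩
    obtain ⟨ρ', hρ', h'⟩ := exists_discMap_eq_exp x hρ
    refine ⟨C, ρ', hρ', fun z h1 h2 h3 => ?_⟩
    obtain ⟨w, hw1, hw2, hw3, -, hw4⟩ := h' z h2 h3
    simp only [hΨdef, hw4]
    exact h w (hw3 h1) hw1 hw2
  have htL : ∀ (x σ : ℝ), (∃ C, ∃ ρ > 0, ∀ z : ℂ, 0 < z.re → 0 < z.im → ‖z‖ < ρ →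
        σ * (mirror (fun z => F (discMap x z)) z).re ≤ C) →
      ∃ M, ∃ ρ > 0, ∀ z : ℂ, z.re < x → 0 < z.im → ‖z - x‖ < ρ → σ * (Ψ z).re ≤ M := by
    rintro x σ ⟨C, ρ, hρ, h⟩
    obtain ⟨ρ', hρ', h'⟩ := exists_discMap_eq_exp x hρ
    refine ⟨C, ρ', hρ', fun z h1 h2 h3 => ?_⟩
    obtain ⟨w, hw1, hw2, -, hw3, hw4⟩ := h' z h2 h3
    have := h (-(starRingEnd ℂ) w) (by simpa using hw3 h1) (by simpa using hw1) (by simpa using hw2)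
    rw [mirror_re] at this
    simp only [map_neg, Complex.conj_conj, neg_neg] at this
    simp only [hΨdef, hw4]
    exact this
  have htM : ∀ x : ℝ, (∃ M, ∃ r > 0, ∀ z : ℂ, 0 < z.im → ‖z - x‖ < r → (Ψ z).re ≤ M) →
      ∃ M, ∃ r > 0, ∀ z : ℂ, 0 < z.im → ‖z‖ < r → (F (discMap x z)).re ≤ M := by
    rintro x ⟨M, r, hr, h⟩
    obtain ⟨ρ, hρ, h'⟩ := exists_exp_eq_discMap x hr
    refine ⟨M, ρ, hρ, fun w h1 h2 => ?_⟩
    obtain ⟨z, hz1, hz2, hz3⟩ := h' w h1 h2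
    rw [← hz3]
    exact h z hz1 hz2
  have htM' : ∀ x : ℝ, (∃ M, ∃ r > 0, ∀ z : ℂ, 0 < z.im → ‖z - x‖ < r → (Ψ z).re ≤ M) →
      ∃ M, ∃ r > 0, ∀ z : ℂ, 0 < z.im → ‖z‖ < r →
        (mirror (fun z => F (discMap x z)) z).re ≤ M := by
    intro x h
    obtain ⟨M, r, hr, h⟩ := htM x h
    refine ⟨M, r, hr, fun z h1 h2 => ?_⟩
    rw [mirror_re]
    exact h _ (by simpa using h1) (by simpa using h2)
  have hvan := reVanishesAt_of_corner_bounds hP hΨ hv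
    (fun x δ hδ h => by
      obtain ⟨δ', hδ', h'⟩ := hvR x δ hδ h
      simpa using htR x 1 (by simpa using hU _ (hchart x) δ' hδ' h'))
    (fun x δ hδ h => by
      obtain ⟨δ', hδ', h'⟩ := hvL x δ hδ h
      simpa using htL x 1 (by simpa using hU _ (hchart' x) δ' hδ' h'))
    (fun x hM δ hδ h => by
      obtain ⟨δ', hδ', h'⟩ := hvR x δ hδ h
      simpa using htR x (-1) (by simpa using hL _ (hchart x) (htM x hM) δ' hδ' h'))
    (fun x hM δ hδ h => by
      obtain ⟨δ', hδ', h'⟩ := hvL x δ hδ h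
      simpa using htL x (-1) (by simpa using hL _ (hchart' x) (htM' x hM) δ' hδ' h'))
  intro z hz
  refine le_antisymm (re_nonpos_of_reVanishesAt hF hvan z hz) ?_
  have := re_nonpos_of_reVanishesAt (F := fun z => -F z) hF.neg (fun x => (hvan x).neg) z hz
  rw [Complex.neg_re] at this
  linarith

/-! ### Growth and zero limits in half-plane coordinates -/

theorem discMap_add_int_mul_two_pi (φ : ℝ) (n : ℤ) : discMap (φ + n * (2 * Real.pi)) = discMap φ := by
  funext z
  have : ((φ + n * (2 * Real.pi) : ℝ) : ℂ) * Complex.I =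
      (φ : ℂ) * Complex.I + n * (2 * Real.pi * Complex.I) := by push_cast; ring
  rw [discMap, discMap, this, Complex.exp_periodic.int_mul n]

theorem exists_discMap_eq_of_mem_Icc (φ : ℝ) :
    ∃ φ' ∈ Set.Icc (0 : ℝ) (2 * Real.pi), discMap φ' = discMap φ := by
  have hpi : 0 < 2 * Real.pi := by positivity
  have h := toIcoMod_mem_Ico hpi 0 φ
  refine ⟨toIcoMod hpi 0 φ, ⟨h.1, by linarith [h.2]⟩, ?_⟩
  have := discMap_add_int_mul_two_pi (toIcoMod hpi 0 φ) (toIcoDiv hpi 0 φ)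
  rw [← this]
  congr 1
  have := toIcoMod_add_toIcoDiv_zsmul hpi 0 φ
  rw [zsmul_eq_mul] at this
  exact this

theorem HasZeroLimitsAlong.exists_abs_le {h : ℝ → ℝ} {u : ℂ → ℝ} (hu : HasZeroLimitsAlong h u)
    (φ : ℝ) {η : ℝ} (hη : 0 < η) : ∃ ρ > 0, ∀ z : ℂ, 0 < z.im → |z.re| ≤ h z.im → ‖z‖ < ρ →
      |u (discMap φ z)| ≤ η := by
  obtain ⟨φ', hφ', e⟩ := exists_discMap_eq_of_mem_Icc φ
  rw [← e]
  have hc : Tendsto (discMap φ') (𝓝[approachDomain h] 0)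
      (𝓝[approachRegion h φ'] Complex.exp ((φ' : ℂ) * Complex.I)) := by
    refine tendsto_nhdsWithin_iff.2 ⟨?_, ?_⟩
    · have := (differentiableAt_discMap φ' (z := 0) (by simp)).continuousAt.tendsto
      rw [discMap_apply_zero] at this
      exact this.mono_left nhdsWithin_le_nhds
    · filter_upwards [self_mem_nhdsWithin] with z hz using Set.mem_image_of_mem _ hz
  have := ((hu φ' hφ').comp hc).abs.eventually
    (ge_mem_nhds (show |(0:ℝ)| < η by rwa [abs_zero]))
  obtain ⟨ρ, hρ, hb⟩ := Metric.mem_nhdsWithin_iff.1 this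
  refine ⟨min ρ 1, by positivity, fun z h1 h2 h3 => ?_⟩
  rw [lt_min_iff] at h3
  exact hb ⟨by simpa using h3.1, h1, (Complex.im_le_norm z).trans_lt h3.2, h2⟩

/-- The supremum is over a bounded set by compactness of the circle. -/
theorem le_circleMax {u : ℂ → ℝ} (hu : ContinuousOn u (Metric.ball 0 1)) {z : ℂ} (hz : ‖z‖ < 1) :
    u z ≤ circleMax u ‖z‖ := by
  have hcont : ContinuousOn (fun θ : ℝ => u ((‖z‖ : ℂ) * Complex.exp ((θ : ℂ) * Complex.I)))
      (Set.Icc 0 (2 * Real.pi)) :=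
    hu.comp (by fun_prop) fun θ _ => by
      rw [mem_ball_zero_iff, norm_mul, Complex.norm_exp_ofReal_mul_I, mul_one, Complex.norm_real,
        norm_norm]
      exact hz
  refine le_csSup (isCompact_Icc.image_of_continuousOn hcont).bddAbove ?_
  have hpi : 0 < 2 * Real.pi := by positivity
  have h := toIcoMod_mem_Ico hpi 0 z.arg
  refine ⟨toIcoMod hpi 0 z.arg, ⟨h.1, by linarith [h.2]⟩, ?_⟩
  have e1 := toIcoMod_add_toIcoDiv_zsmul hpi 0 z.arg
  rw [zsmul_eq_mul] at e1
  have e2 : Complex.exp (((toIcoMod hpi 0 z.arg : ℝ) : ℂ) * Complex.I) =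
      Complex.exp ((z.arg : ℂ) * Complex.I) := by
    have : (z.arg : ℂ) * Complex.I = ((toIcoMod hpi 0 z.arg : ℝ) : ℂ) * Complex.I +
        (toIcoDiv hpi 0 z.arg : ℤ) * (2 * Real.pi * Complex.I) := by
      conv_lhs => rw [← e1]
      push_cast; ring
    rw [this, Complex.exp_periodic.int_mul]
  simp only [e2, Complex.norm_mul_exp_arg_mul_I]

/-- Near `0` the point `discMap φ z` has distance at least `Im z / 2` to the circle. -/
theorem exists_le_of_circleMax_le {u : ℂ → ℝ} (hu : ContinuousOn u (Metric.ball 0 1)) {N : ℝ → ℝ}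
    (hN : ∀ y y', 0 < y → y ≤ y' → N y' ≤ N y)
    (h : ∀ᶠ r in 𝓝[<] (1 : ℝ), circleMax u r ≤ N (1 - r)) :
    ∃ ρ > 0, ∀ (φ : ℝ) (z : ℂ), 0 < z.im → ‖z‖ < ρ → u (discMap φ z) ≤ N (z.im / 2) := by
  obtain ⟨r₀, hr₀, hr⟩ := mem_nhdsLT_iff_exists_Ioo_subset.1 h
  have hr₀ : r₀ < 1 := hr₀
  refine ⟨min (1 / 2) ((1 - r₀) / 16), lt_min (by norm_num) (by linarith), fun φ z h1 h2 => ?_⟩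
  rw [lt_min_iff] at h2
  have hlt := norm_discMap_lt_one φ h1
  have hn := norm_nonneg (discMap φ z)
  have e := one_sub_norm_sq_discMap φ h1
  have n1 : ‖Complex.I + z‖ ≤ 3 / 2 := by
    have := norm_add_le Complex.I z
    rw [Complex.norm_I] at this; linarith [h2.1]
  have n2 : 1 / 2 ≤ ‖Complex.I + z‖ := by
    have := norm_sub_norm_le Complex.I (-z)
    rw [Complex.norm_I, norm_neg, sub_neg_eq_add] at this; linarith [h2.1]
  rw [eq_div_iff (by positivity)] at e
  have n3 : ‖Complex.I + z‖ ^ 2 ≤ 4 := by nlinarith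
  have n4 : 1 / 4 ≤ ‖Complex.I + z‖ ^ 2 := by nlinarith
  have hd : 0 ≤ 1 - ‖discMap φ z‖ ^ 2 := by nlinarith
  have him := Complex.im_le_norm z
  have b1 : z.im / 2 ≤ 1 - ‖discMap φ z‖ := by nlinarith
  have b2 : 1 - ‖discMap φ z‖ < 1 - r₀ := by nlinarith
  exact (le_circleMax hu hlt).trans
    ((hr ⟨by linarith, hlt⟩ : circleMax u _ ≤ _).trans (hN _ _ (by positivity) b1))

theorem half_rpow_neg {y a : ℝ} (hy : 0 ≤ y) : (y / 2) ^ (-a) = 2 ^ a * y ^ (-a) := by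
  rw [Real.div_rpow hy (by norm_num), Real.rpow_neg (by norm_num : (0:ℝ) ≤ 2), div_inv_eq_mul,
    mul_comm]

/-- The growth condition in half-plane coordinates. The function `g` stands for an iterated `log⁺`
and `B` for the corresponding iterated exponential. -/
theorem exists_le_of_growth {u : ℂ → ℝ} (hu : ContinuousOn u (Metric.ball 0 1)) {a : ℝ}
    (ha : 0 ≤ a) {B : ℝ → ℝ} (hB : Monotone B) {g : ℝ → ℝ} (hBg : ∀ x t, |g x| ≤ t → x ≤ B t)
    (h : (fun r : ℝ => g (circleMax u r)) =o[𝓝[<] 1] fun r : ℝ => (1 - r) ^ (-a)) :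
    ∀ ε > 0, ∃ ρ > 0, ∀ (φ : ℝ) (z : ℂ), 0 < z.im → ‖z‖ < ρ →
      u (discMap φ z) ≤ B (ε * z.im ^ (-a)) := by
  intro ε hε
  have h2 : (0 : ℝ) < 2 ^ a := by positivity
  have hb := h.bound (show 0 < ε / 2 ^ a by positivity)
  obtain ⟨ρ, hρ, hle⟩ := exists_le_of_circleMax_le hu (N := fun y => B (ε / 2 ^ a * y ^ (-a)))
    (fun y y' h1 h3 => hB (by
      have := Real.rpow_le_rpow_of_nonpos h1 h3 (show -a ≤ 0 by linarith)
      gcongr)) (by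
      filter_upwards [hb, self_mem_nhdsWithin] with r hr hr1
      have hr1 : 0 < 1 - r := sub_pos.2 hr1
      rw [Real.norm_eq_abs, Real.norm_of_nonneg (by positivity)] at hr
      exact hBg _ _ hr)
  refine ⟨ρ, hρ, fun φ z h1 h3 => (hle φ z h1 h3).trans_eq ?_⟩
  simp only [half_rpow_neg h1.le]
  congr 1
  field_simp

theorem le_exp_of_abs_posLog_le {x t : ℝ} (h : |Real.posLog x| ≤ t) : x ≤ Real.exp t := by
  have h1 := (le_abs_self _).trans h
  rcases le_or_gt x 0 with hx | hx
  · exact hx.trans (Real.exp_pos t).le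
  · rw [Real.posLog_def] at h1
    exact (Real.log_le_iff_le_exp hx).1 ((le_max_right _ _).trans h1)

/-- The reduction when the corner bounds for `Φ` and `-Φ` come together. -/
theorem re_eq_zero_of_two_sided_corner_bounds {F : ℂ → ℂ}
    (hF : DifferentiableOn ℂ F (Metric.ball 0 1))
    (hrad : ∀ φ : ℝ, ∀ η > 0, ∃ ρ > 0, ∀ z : ℂ, 0 < z.im → |z.re| ≤ 0 → ‖z‖ < ρ →
      |(F (discMap φ z)).re| ≤ η)
    (h : ∀ Φ, IsDiscChart F Φ → ∀ δ > 0, (∀ t : ℝ, 0 < t → t < δ → ReVanishesAt Φ t) →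
      ∃ C, ∃ ρ > 0, ∀ z : ℂ, 0 < z.re → 0 < z.im → ‖z‖ < ρ → |(Φ z).re| ≤ C) :
    ∀ z ∈ Metric.ball (0 : ℂ) 1, (F z).re = 0 := by
  refine re_eq_zero_of_corner_bounds hF hrad (fun Φ hΦ δ hδ h0 => ?_)
    (fun Φ hΦ _ δ hδ h0 => ?_)
  · obtain ⟨C, ρ, hρ, hC⟩ := h Φ hΦ δ hδ h0
    exact ⟨C, ρ, hρ, fun z h1 h2 h3 => (le_abs_self _).trans (hC z h1 h2 h3)⟩
  · obtain ⟨C, ρ, hρ, hC⟩ := h Φ hΦ δ hδ h0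
    exact ⟨C, ρ, hρ, fun z h1 h2 h3 => by
      rw [Complex.neg_re]; exact (neg_le_abs _).trans (hC z h1 h2 h3)⟩

theorem IsDiscChart.exists_abs_re_le {F Φ : ℂ → ℂ} {u : ℂ → ℝ} {h : ℝ → ℝ} (hΦ : IsDiscChart F Φ)
    (hFu : ∀ z ∈ Metric.ball (0 : ℂ) 1, (F z).re = u z) (hu : HasZeroLimitsAlong h u) {η : ℝ}
    (hη : 0 < η) : ∃ ρ > 0, ∀ z : ℂ, 0 < z.im → |z.re| ≤ h z.im → ‖z‖ < ρ → |(Φ z).re| ≤ η := by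
  obtain ⟨φ, hφ⟩ := hΦ.exists_re_eq
  obtain ⟨ρ, hρ, hb⟩ := hu.exists_abs_le φ hη
  refine ⟨ρ, hρ, fun z h1 h2 h3 => ?_⟩
  obtain ⟨w, w1, w2, w3, w4⟩ := hφ z
  rw [w4, hFu _ (discMap_mem_ball φ (by rwa [w1]))]
  exact hb w (by rwa [w1]) (by rwa [w1, w2]) (by rwa [w3])

theorem IsDiscChart.exists_re_le {F Φ : ℂ → ℂ} {u : ℂ → ℝ} (hΦ : IsDiscChart F Φ)
    (hFu : ∀ z ∈ Metric.ball (0 : ℂ) 1, (F z).re = u z) {N : ℝ → ℝ}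
    (h : ∃ ρ > 0, ∀ (φ : ℝ) (z : ℂ), 0 < z.im → ‖z‖ < ρ → u (discMap φ z) ≤ N z.im) :
    ∃ ρ > 0, ∀ z : ℂ, 0 < z.im → ‖z‖ < ρ → (Φ z).re ≤ N z.im := by
  obtain ⟨φ, hφ⟩ := hΦ.exists_re_eq
  obtain ⟨ρ, hρ, hb⟩ := h
  refine ⟨ρ, hρ, fun z h1 h3 => ?_⟩
  obtain ⟨w, w1, w2, w3, w4⟩ := hφ z
  rw [w4, hFu _ (discMap_mem_ball φ (by rwa [w1])), ← w1]
  exact hb φ w (by rwa [w1]) (by rwa [w3])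

/-- An upper bound for the real part near `0` gives a lower bound `O(1 / y) = o(y ^ (-2))`. -/
theorem exists_neg_re_le_mul_rpow {Φ : ℂ → ℂ} (hΦ : DifferentiableOn ℂ Φ {z | 0 < z.im})
    (hM : ∃ M, ∃ r > 0, ∀ z : ℂ, 0 < z.im → ‖z‖ < r → (Φ z).re ≤ M) :
    ∀ ε > 0, ∃ ρ > 0, ∀ z : ℂ, 0 < z.im → ‖z‖ < ρ → (-Φ z).re ≤ ε * z.im ^ (-2 : ℝ) := by
  obtain ⟨M, r, hr, hM⟩ := hM
  obtain ⟨K, hK, h⟩ := exists_norm_and_norm_deriv_le_of_re_le (δ := r / 8) (by positivity) hΦ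
  intro ε hε
  have hM1 : 0 < |M| + 1 := by positivity
  refine ⟨min (r / 8) (ε / (K * (|M| + 1))), by positivity, fun z hz hzρ => ?_⟩
  rw [lt_min_iff] at hzρ
  have him := Complex.im_le_norm z
  have hb := (h z hz ((Complex.abs_re_le_norm z).trans hzρ.1.le) (him.trans hzρ.1.le) |M|
    (abs_nonneg _) fun w h1 h2 => (hM w (by linarith) (by linarith)).trans (le_abs_self M)).1
  have h3 : z.im < ε / (K * (|M| + 1)) := him.trans_lt hzρ.2
  rw [lt_div_iff₀ (by positivity)] at h3
  have e : z.im ^ (-2 : ℝ) = (z.im ^ 2)⁻¹ := by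
    rw [Real.rpow_neg hz.le]; norm_cast
  rw [e, Complex.neg_re]
  refine (neg_le_abs _).trans ((Complex.abs_re_le_norm _).trans (hb.trans ?_))
  rw [← div_eq_mul_inv, div_le_div_iff₀ hz (by positivity)]
  nlinarith

theorem theorem1p3 (u : ℂ → ℝ)
    (hu : InnerProductSpace.HarmonicOnNhd u (Metric.ball (0 : ℂ) 1)) :
    -- (a) radial limits
    (HasZeroLimitsAlong (fun _ => 0) u →
      (fun r : ℝ => circleMax u r) =o[𝓝[<] 1] (fun r : ℝ => (1 - r) ^ (-2 : ℝ)) →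
      ∀ z ∈ Metric.ball (0 : ℂ) 1, u z = 0) ∧
    -- (b)
    (∀ c : ℝ, 0 < c → HasZeroLimitsAlong (fun t => c * t ^ 3) u →
      (fun r : ℝ => Real.posLog (circleMax u r)) =o[𝓝[<] 1] (fun r : ℝ => (1 - r) ^ (-1 : ℝ)) →
      ∀ z ∈ Metric.ball (0 : ℂ) 1, u z = 0) ∧
    -- (c)
    (∀ c : ℝ, 0 < c → HasZeroLimitsAlong (fun t => c * t) u →
      (fun r : ℝ => Real.posLog (circleMax u r)) =o[𝓝[<] 1]
        (fun r : ℝ => (1 - r) ^ (-(Real.pi / (2 * Real.arctan (1 / c))))) →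
      ∀ z ∈ Metric.ball (0 : ℂ) 1, u z = 0) ∧
    -- (d)
    (∀ γ : ℝ, 0 < γ → γ < 1 → HasZeroLimitsAlong (fun t => t ^ γ) u →
      (fun r : ℝ => Real.posLog (Real.posLog (circleMax u r))) =o[𝓝[<] 1]
        (fun r : ℝ => (1 - r) ^ (γ - 1)) →
      ∀ z ∈ Metric.ball (0 : ℂ) 1, u z = 0) := by
  obtain ⟨F, hFa, hFe⟩ := hu.exists_analyticOnNhd_ball_re_eq
  have hF : DifferentiableOn ℂ F (Metric.ball 0 1) := hFa.differentiableOn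
  have hFu : ∀ z ∈ Metric.ball (0 : ℂ) 1, (F z).re = u z := fun z hz => hFe hz
  have huc : ContinuousOn u (Metric.ball 0 1) :=
    (Complex.continuous_re.comp_continuousOn hF.continuousOn).congr fun z hz => (hFu z hz).symm
  -- zero limits along `h ≥ 0` contain the radial limits
  have hrad : ∀ h : ℝ → ℝ, (∀ t, 0 < t → 0 ≤ h t) → HasZeroLimitsAlong h u →
      ∀ φ : ℝ, ∀ η > 0, ∃ ρ > 0, ∀ z : ℂ, 0 < z.im → |z.re| ≤ 0 → ‖z‖ < ρ →
        |(F (discMap φ z)).re| ≤ η := by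
    intro h hh hz φ η hη
    obtain ⟨ρ, hρ, hb⟩ := hz.exists_abs_le φ hη
    refine ⟨ρ, hρ, fun z h1 h2 h3 => ?_⟩
    rw [hFu _ (discMap_mem_ball φ h1)]
    exact hb z h1 (h2.trans (hh _ h1)) h3
  refine ⟨fun hz hg z hzb => ?_, fun c hc hz hg z hzb => ?_, fun c hc hz hg z hzb => ?_,
    fun γ hγ0 hγ1 hz hg z hzb => ?_⟩ <;> rw [← hFu z hzb]
  · have hgr := exists_le_of_growth huc (a := 2) (by norm_num) (B := fun t => t) (g := fun x => x)
      monotone_id (fun x t h => (le_abs_self x).trans h) hg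
    have hradial : ∀ Φ, IsDiscChart F Φ →
        ∃ ρ > 0, ∀ z : ℂ, z.re = 0 → 0 < z.im → ‖z‖ < ρ → |(Φ z).re| ≤ 1 := by
      intro Φ hΦ
      obtain ⟨ρ, hρ, h⟩ := hΦ.exists_abs_re_le hFu hz one_pos
      exact ⟨ρ, hρ, fun z h1 h2 h3 => h z h2 (by simp [h1]) h3⟩
    refine re_eq_zero_of_corner_bounds hF (hrad _ (fun _ _ => le_rfl) hz) (fun Φ hΦ δ hδ h0 => ?_)
      (fun Φ hΦ hM δ hδ h0 => ?_) z hzb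
    · obtain ⟨ρ, hρ, h⟩ := hradial Φ hΦ
      exact exists_re_le_of_radial_corner hδ (hΦ.differentiableOn hF) h0
        ⟨ρ, hρ, fun z h1 h2 h3 => (le_abs_self _).trans (h z h1 h2 h3)⟩
        (fun ε hε => hΦ.exists_re_le hFu (N := fun y => ε * y ^ (-2 : ℝ)) (hgr ε hε))
    · obtain ⟨ρ, hρ, h⟩ := hradial Φ hΦ
      exact exists_re_le_of_radial_corner (Φ := fun z => -Φ z) hδ (hΦ.differentiableOn hF).neg
        (fun t h1 h2 => (h0 t h1 h2).neg)
        ⟨ρ, hρ, fun z h1 h2 h3 => by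
          rw [Complex.neg_re]; exact (neg_le_abs _).trans (h z h1 h2 h3)⟩
        (exists_neg_re_le_mul_rpow (hΦ.differentiableOn hF) hM)
  · have hgr := exists_le_of_growth huc (a := 1) zero_le_one Real.exp_monotone
      (fun x t h => le_exp_of_abs_posLog_le h) hg
    exact re_eq_zero_of_two_sided_corner_bounds hF (hrad _ (fun t ht => by positivity) hz)
      (fun Φ hΦ δ hδ h0 => exists_abs_re_le_of_cubic_corner hδ hc (hΦ.differentiableOn hF) h0
        (fun η hη => hΦ.exists_abs_re_le hFu hz hη)
        (fun ε hε => hΦ.exists_re_le hFu (N := fun y => Real.exp (ε * y ^ (-1 : ℝ)))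
          (hgr ε hε))) z hzb
  · have hβ : 0 < Real.arctan (1 / c) := Real.arctan_pos.2 (by positivity)
    have hgr := exists_le_of_growth huc (a := Real.pi / (2 * Real.arctan (1 / c)))
      (by have := Real.pi_pos; positivity) Real.exp_monotone
      (fun x t h => le_exp_of_abs_posLog_le h) hg
    exact re_eq_zero_of_two_sided_corner_bounds hF (hrad _ (fun t ht => by positivity) hz)
      (fun Φ hΦ δ hδ h0 => exists_abs_re_le_of_conical_corner hδ hc (hΦ.differentiableOn hF) h0
        (hΦ.exists_abs_re_le hFu hz one_pos)
        (fun ε hε => hΦ.exists_re_le hFu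
          (N := fun y => Real.exp (ε * y ^ (-(Real.pi / (2 * Real.arctan (1 / c))))))
          (hgr ε hε))) z hzb
  · rw [show (fun r : ℝ => (1 - r) ^ (γ - 1)) = fun r => (1 - r) ^ (-(1 - γ)) by simp] at hg
    have hgr := exists_le_of_growth huc (a := 1 - γ) (by linarith)
      (B := fun t => Real.exp (Real.exp t)) (g := fun x => Real.posLog (Real.posLog x))
      (Real.exp_monotone.comp Real.exp_monotone)
      (fun x t h => le_exp_of_abs_posLog_le (by
        rw [abs_of_nonneg Real.posLog_nonneg]; exact le_exp_of_abs_posLog_le h)) hg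
    simp only [neg_sub] at hgr
    exact re_eq_zero_of_two_sided_corner_bounds hF (hrad _ (fun t ht => by positivity) hz)
      (fun Φ hΦ δ hδ h0 => exists_abs_re_le_of_cusp_corner hδ hγ0 hγ1 (hΦ.differentiableOn hF) h0
        (hΦ.exists_abs_re_le hFu hz one_pos)
        (fun ε hε => hΦ.exists_re_le hFu
          (N := fun y => Real.exp (Real.exp (ε * y ^ (γ - 1)))) (hgr ε hε))) z hzb
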